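/- **Conventions.** For a vector space $W$ over $\mathbb F_2=\mathbb Z/2$ let $\mathbb F_W$ be the field of fractions of the symmetric algebra of $W$; a linear injection $\varphi:W\hookrightarrow V$ induces a field extension $\mathbb F_W\to\mathbb F_V$. All gradings are by a fixed abelian group $G$ with a distinguished element $1$ (for instance $\mathbb Z$, or $\mathbb Q\supset\frac12\mathbb Z$), and $X[k]_d=X_{d+k}$. Let $(A,\mu_1,\mu_2)$ be a graded unital differential algebra over $\mathbb F_2$ with differential of degree $-1$, and let $\mathcal I\subset A$ be a subalgebra concentrated in degree $0$ with $\mu_1(\mathcal I)=0$ (the ground ring). Put $A_W=A\otimes\mathbb F_W$, $\mathcal I_W=\mathcal I\otimes\mathbb F_W$, with operations $\mu_{W,j}=\mu_j\otimes 1$. Tensor products below are over $\mathcal I_W$. *$A_\infty$-modules.* A right $A_\infty$-module over $A_W$ is a graded right $\mathcal I_W$-module $M$ with $\mathcal I_W$-linear maps $m_i:M\otimes A_W^{\otimes(i-1)}\to M[i-2]$, $i\ge1$, such that for all $n$ $$\sum_{i+j=n+1}m_i(m_j\otimes 1^{\otimes(i-1)})+\sum_{i+j=n+1,\ j\le 2,\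 k>0}m_i(1^{\otimes k}\otimes\mu_{W,j}\otimes1^{\otimes(i-k-1)})=0 .$$ For a family of $\mathcal I_W$-linear maps $f_i:M\otimes A_W^{\otimes(i-1)}\to M'$, let $(\partial f)_n$ be $$\sum_{i+j=n+1}m'_i(f_j\otimes1^{\otimes(i-1)})+\sum_{i+j=n+1}f_i(m_j\otimes1^{\otimes(i-1)})+\sum_{i+j=n+1,\ j\le2,\ k>0}f_i(1^{\otimes k}\otimes\mu_{W,j}\otimes1^{\otimes(i-k-1)}).$$ A homomorphism is a family $\psi_i:M\otimes A_W^{\otimes (i-1)}\to M'[i-1]$ with $\partial\psi=0$; a homotopy between $\psi$ and $\phi$ is a family $h_i:M\otimes A_W^{\otimes (i-1)}\to M'[i]$ with $\psi+\phi=\partial h$; composition is $(\phi*\psi)_n=\sum_{i+j=n+1}\phi_i(\psi_j\otimes1^{\otimes(i-1)})$, and the identity has $\mathrm{id}_1=\mathrm{id}_M$ and $\mathrm{id}_n=0$ for $n>1$. A homotopy equivalence is a quadruple $(f,g,h,h')$ of homomorphisms $f:M\to M'$, $g:M'\to M$ and homotopies $h$ between $g*f$ and $\mathrm{id}_M$,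 $h'$ between $f*g$ and $\mathrm{id}_{M'}$. A family $f_i$ is *bounded* if for each $x\in M$ one has $f_i(x\otimes\cdots)=0$ for all large $i$; $M$ is bounded if $(m_i)$ is. *Type $D$ structures.* A left type $D$ structure over $A_W$ is a graded left $\mathcal I_W$-module $N$ with an $\mathcal I_W$-linear map $\delta:N\to (A_W\otimes N)[-1]$ such that $(\mu_{W,2}\otimes1)(1\otimes\delta)\delta+(\mu_{W,1}\otimes1)\delta=0$. Put $\Delta_0=1_N$ and $\Delta_k=(1^{\otimes(k-1)}\otimes\delta)\Delta_{k-1}:N\to A_W^{\otimes k}\otimes N$. $N$ is *bounded* if for each $y\in N$ one has $\Delta_k(y)=0$ for all large $k$. *Extension of scalars and pairing.* For $\varphi:W\hookrightarrow V$ let $\mathcal F_\varphi(M)=M\otimes_\varphi\mathbb F_V$ and $\mathcal G_\varphi(N)=N\otimes_\varphi\mathbb F_V$ with the $\mathbb F_V$-linearly extended operations. For $M$ over $A_W$ and $N$ over $A_{\widetilde W}$, let $M\boxtimes^*N$ be the graded $\mathbb F_{W\oplus\widetilde W}$-vector space $\mathcal F(M)\otimes\mathcal G(N)$, with $\mathcal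 F,\mathcal G$ taken along the canonical inclusions of $W$ and $\widetilde W$ into $W\oplus\widetilde W$, with the map $\partial=\sum_{k\ge0}(m_{k+1}\otimes 1)(1\otimes\Delta_k)$, where $m_{k+1}$ and $\Delta_k$ are those of $\mathcal F(M)$ and $\mathcal G(N)$. **Proposition.** Let $W,W',W'',\widetilde W$ be $\mathbb F_2$-vector spaces, $N$ a type $D$ structure over $A_{\widetilde W}$, and $M$, $M'$ $A_\infty$-modules over $A_W$, $A_{W'}$. Let $\varphi:W\hookrightarrow W''$ and $\varphi':W'\hookrightarrow W''$ be linear injections and let $e$ be a homotopy equivalence between the $A_\infty$-modules $\mathcal F_\varphi(M)$ and $\mathcal F_{\varphi'}(M')$ over $A_{W''}$ (that is, $M$ and $M'$ are stably homotopy equivalent via $(\varphi,\varphi',W'')$). Assume that $N$ is bounded, or that $M$, $M'$ and the four families of maps that constitute $e$ are bounded. Then $M\boxtimes^*N$ and $M'\boxtimes^*N$ are chain complexes (the maps $\partial$ have degree $-1$ and $\partial^2=0$), and they are stably chain homotopic via the triple $(\varphi\oplus\mathrm{id},\varphi'\oplus\mathrm{id},W''\oplus\widetilde W)$: the complexes $$(M\boxtimes^*N)\otimes_{\varphi\oplus\mathrm{id}}\mathbb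 F_{W''\oplus\widetilde W}\quad\text{and}\quad(M'\boxtimes^*N)\otimes_{\varphi'\oplus\mathrm{id}}\mathbb F_{W''\oplus\widetilde W}$$ are chain homotopy equivalent over $\mathbb F_{W''\oplus\widetilde W}$, through graded maps (chain maps of degree $0$ and homotopies of degree $1$). -/

import Mathlib

open scoped TensorProduct

universe u v

noncomputable section

namespace StableBox

/-! ## The field of rational functions of a vector space -/

/-- The field `F_W`: the field of fractions of the symmetric algebra of the
`Z/2`-vector space `W`. -/
def RatFun (W : Type u) [AddCommGroup W] [Module (ZMod 2) W] : Type u :=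
  FractionRing (SymmetricAlgebra (ZMod 2) W)

section RatFun

variable (W : Type u) [AddCommGroup W] [Module (ZMod 2) W]

instance : Field (RatFun W) :=
  inferInstanceAs (Field (FractionRing (SymmetricAlgebra (ZMod 2) W)))

instance : Algebra (SymmetricAlgebra (ZMod 2) W) (RatFun W) :=
  inferInstanceAs (Algebra _ (FractionRing (SymmetricAlgebra (ZMod 2) W)))

instance : IsFractionRing (SymmetricAlgebra (ZMod 2) W) (RatFun W) :=
  inferInstanceAs (IsFractionRing _ (FractionRing (SymmetricAlgebra (ZMod 2) W)))

instance : Algebra (ZMod 2) (RatFun W) :=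
  inferInstanceAs (Algebra (ZMod 2) (FractionRing (SymmetricAlgebra (ZMod 2) W)))

variable {W} {V : Type u} [AddCommGroup V] [Module (ZMod 2) V]

/-- The algebra map of symmetric algebras induced by a linear map. -/
def symMap (φ : W →ₗ[ZMod 2] V) :
    SymmetricAlgebra (ZMod 2) W →ₐ[ZMod 2] SymmetricAlgebra (ZMod 2) V :=
  SymmetricAlgebra.lift (SymmetricAlgebra.ι (ZMod 2) V ∘ₗ φ)

theorem symMap_injective (φ : W →ₗ[ZMod 2] V) (hφ : Function.Injective φ) :
    Function.Injective (symMap φ) := by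
  obtain ⟨ψ, hψ⟩ := φ.exists_leftInverse_of_injective (LinearMap.ker_eq_bot.2 hφ)
  have h : (symMap ψ).comp (symMap φ) = AlgHom.id (ZMod 2) _ := by
    apply SymmetricAlgebra.algHom_ext
    ext x
    have hx : ψ (φ x) = x := LinearMap.congr_fun hψ x
    simp [symMap, hx]
  intro x y hxy
  have := congrArg (symMap ψ) hxy
  simpa using (DFunLike.congr_fun h x).symm.trans (this.trans (DFunLike.congr_fun h y))

/-- The field extension `F_W → F_V` induced by a linear injection `W → V`. -/
def RatFun.map (φ : W →ₗ[ZMod 2] V) (hφ : Function.Injective φ) : RatFun W →+* RatFun V :=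
  IsFractionRing.map (A := SymmetricAlgebra (ZMod 2) W) (B := SymmetricAlgebra (ZMod 2) V)
    (j := (symMap φ).toRingHom) (symMap_injective φ hφ)

end RatFun

/-! ## Modules over the ground ring and tensor products over it

Let `K` be a commutative `Z/2`-algebra and `R` a ring (the ground ring, not necessarily
commutative).  A module over `R ⊗ K` is a `K`-module with a commuting action of `R`. -/

/-- Left `R ⊗ K`-modules. -/
structure LMod (R : Type u) [Ring R] (K : Type u) [CommRing K] : Type (u + 1) where
  carrier : Type u
  [grp : AddCommGroup carrier]
  [mod : Module K carrier]
  act : R →+* Module.End K carrier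

/-- Right `R ⊗ K`-modules: `act (op e) x` is `x · e`. -/
structure RMod (R : Type u) [Ring R] (K : Type u) [CommRing K] : Type (u + 1) where
  carrier : Type u
  [grp : AddCommGroup carrier]
  [mod : Module K carrier]
  act : Rᵐᵒᵖ →+* Module.End K carrier

attribute [instance] LMod.grp LMod.mod RMod.grp RMod.mod

section GroundRing

variable {R : Type u} [Ring R] {K : Type u} [CommRing K]

/-- Homomorphisms of left modules. -/
@[ext]
structure LHom (N N' : LMod R K) where
  lin : N.carrier →ₗ[K] N'.carrier
  map_act : ∀ e x, lin (N.act e x) = N'.act e (lin x)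

/-- Homomorphisms of right modules. -/
@[ext]
structure RHom (M M' : RMod R K) where
  lin : M.carrier →ₗ[K] M'.carrier
  map_act : ∀ e x, lin (M.act e x) = M'.act e (lin x)

/-- The identity. -/
def LHom.id (N : LMod R K) : LHom N N := ⟨LinearMap.id, fun _ _ => rfl⟩

/-- The identity. -/
def RHom.id (M : RMod R K) : RHom M M := ⟨LinearMap.id, fun _ _ => rfl⟩

/-- The zero homomorphism. -/
def RHom.zero (M M' : RMod R K) : RHom M M' := ⟨0, fun _ _ => by simp⟩

@[simp]
theorem LHom.id_lin (N : LMod R K) (x : N.carrier) : (LHom.id N).lin x = x := rfl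

@[simp]
theorem RHom.id_lin (M : RMod R K) (x : M.carrier) : (RHom.id M).lin x = x := rfl

/-- Composition. -/
def LHom.comp {N N' N'' : LMod R K} (g : LHom N' N'') (f : LHom N N') : LHom N N'' :=
  ⟨g.lin ∘ₗ f.lin, fun e x => by simp [f.map_act, g.map_act]⟩

/-- Composition. -/
def RHom.comp {M M' M'' : RMod R K} (g : RHom M' M'') (f : RHom M M') : RHom M M'' :=
  ⟨g.lin ∘ₗ f.lin, fun e x => by simp [f.map_act, g.map_act]⟩

/-- The relations `x · e ⊗ y = x ⊗ e · y`. -/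
def balRel (M : RMod R K) (N : LMod R K) : Submodule K (M.carrier ⊗[K] N.carrier) :=
  Submodule.span K {z | ∃ (x : M.carrier) (e : R) (y : N.carrier),
    z = M.act (MulOpposite.op e) x ⊗ₜ[K] y - x ⊗ₜ[K] N.act e y}

/-- The tensor product `M ⊗ N` over `R ⊗ K`. -/
abbrev Bal (M : RMod R K) (N : LMod R K) : Type u :=
  (M.carrier ⊗[K] N.carrier) ⧸ balRel M N

/-- The class of `x ⊗ y`. -/
def Bal.mk {M : RMod R K} {N : LMod R K} (x : M.carrier) (y : N.carrier) : Bal M N :=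
  (balRel M N).mkQ (x ⊗ₜ[K] y)

theorem Bal.mk_act {M : RMod R K} {N : LMod R K} (e : R) (x : M.carrier) (y : N.carrier) :
    (Bal.mk (M.act (MulOpposite.op e) x) y : Bal M N) = Bal.mk x (N.act e y) :=
  (Submodule.Quotient.eq _).2 (Submodule.subset_span ⟨x, e, y, rfl⟩)

theorem Bal.induction {M : RMod R K} {N : LMod R K} {p : Bal M N → Prop}
    (zero : p 0) (mk : ∀ x y, p (Bal.mk x y)) (add : ∀ z w, p z → p w → p (z + w)) (z : Bal M N) :
    p z := by
  obtain ⟨t, rfl⟩ := (balRel M N).mkQ_surjective z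
  induction t using TensorProduct.induction_on with
  | zero => simpa using zero
  | tmul x y => exact mk x y
  | add z w hz hw => rw [map_add]; exact add _ _ hz hw

/-- The map `M ⊗ N → X` induced by a balanced `K`-bilinear map. -/
def Bal.lift {M : RMod R K} {N : LMod R K} {X : Type u} [AddCommGroup X] [Module K X]
    (b : M.carrier →ₗ[K] N.carrier →ₗ[K] X)
    (hb : ∀ x e y, b (M.act (MulOpposite.op e) x) y = b x (N.act e y)) : Bal M N →ₗ[K] X :=
  (balRel M N).liftQ (TensorProduct.lift b) (by
    rw [balRel, Submodule.span_le]
    rintro z ⟨x, e, y, rfl⟩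
    simp [hb])

@[simp]
theorem Bal.lift_mk {M : RMod R K} {N : LMod R K} {X : Type u} [AddCommGroup X] [Module K X]
    (b : M.carrier →ₗ[K] N.carrier →ₗ[K] X)
    (hb : ∀ x e y, b (M.act (MulOpposite.op e) x) y = b x (N.act e y)) (x y) :
    Bal.lift b hb (Bal.mk x y) = b x y := by
  simp [Bal.lift, Bal.mk]

/-- The bilinear map `(x, y) ↦ x ⊗ y`. -/
def Bal.mkLin (M : RMod R K) (N : LMod R K) : M.carrier →ₗ[K] N.carrier →ₗ[K] Bal M N :=
  (TensorProduct.mk K M.carrier N.carrier).compr₂ (balRel M N).mkQ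

@[simp]
theorem Bal.mkLin_apply (M : RMod R K) (N : LMod R K) (x y) :
    Bal.mkLin M N x y = Bal.mk x y := rfl

theorem Bal.mk_add_left {M : RMod R K} {N : LMod R K} (x x' : M.carrier) (y : N.carrier) :
    (Bal.mk (x + x') y : Bal M N) = Bal.mk x y + Bal.mk x' y :=
  LinearMap.map_add₂ (Bal.mkLin M N) x x' y

theorem Bal.mk_add_right {M : RMod R K} {N : LMod R K} (x : M.carrier) (y y' : N.carrier) :
    (Bal.mk x (y + y') : Bal M N) = Bal.mk x y + Bal.mk x y' :=
  map_add (Bal.mkLin M N x) y y'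

theorem Bal.mk_smul_left {M : RMod R K} {N : LMod R K} (r : K) (x : M.carrier) (y : N.carrier) :
    (Bal.mk (r • x) y : Bal M N) = r • Bal.mk x y :=
  LinearMap.map_smul₂ (Bal.mkLin M N) r x y

theorem Bal.mk_smul_right {M : RMod R K} {N : LMod R K} (r : K) (x : M.carrier) (y : N.carrier) :
    (Bal.mk x (r • y) : Bal M N) = r • Bal.mk x y :=
  map_smul (Bal.mkLin M N x) r y

@[simp]
theorem Bal.mk_zero_left {M : RMod R K} {N : LMod R K} (y : N.carrier) :
    (Bal.mk 0 y : Bal M N) = 0 :=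
  LinearMap.map_zero₂ (Bal.mkLin M N) y

@[simp]
theorem Bal.mk_zero_right {M : RMod R K} {N : LMod R K} (x : M.carrier) :
    (Bal.mk x 0 : Bal M N) = 0 :=
  map_zero (Bal.mkLin M N x)

theorem Bal.hom_ext {M : RMod R K} {N : LMod R K} {X : Type u} [AddCommGroup X] [Module K X]
    {f g : Bal M N →ₗ[K] X} (h : ∀ x y, f (Bal.mk x y) = g (Bal.mk x y)) : f = g := by
  refine LinearMap.ext fun z => ?_
  induction z using Bal.induction with
  | zero => simp
  | mk x y => exact h x y
  | add z w hz hw => simp [hz, hw]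

/-- The map `f ⊗ g`. -/
def Bal.map {M M' : RMod R K} {N N' : LMod R K} (f : RHom M M') (g : LHom N N') :
    Bal M N →ₗ[K] Bal M' N' :=
  Bal.lift ((Bal.mkLin M' N').compl₁₂ f.lin g.lin) fun x e y => by
    simp [f.map_act, g.map_act, Bal.mk_act]

@[simp]
theorem Bal.map_mk {M M' : RMod R K} {N N' : LMod R K} (f : RHom M M') (g : LHom N N') (x y) :
    Bal.map f g (Bal.mk x y) = Bal.mk (f.lin x) (g.lin y) := by
  simp [Bal.map]

end GroundRing

/-! ## Differential graded algebras over `Z/2` -/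

/-- A unital differential graded algebra `(A, d)` over `Z/2` with differential of degree `-1`,
together with a ground ring: a subalgebra `I` (of idempotents, in the applications)
concentrated in degree zero and annihilated by the differential. -/
structure DGAlg (G : Type v) [AddCommGroupWithOne G] [DecidableEq G] : Type (max (u + 1) v) where
  A : Type u
  [ring : Ring A]
  [alg : Algebra (ZMod 2) A]
  gr : G → Submodule (ZMod 2) A
  [graded : GradedAlgebra gr]
  d : A →ₗ[ZMod 2] A
  d_mem : ∀ g, ∀ a ∈ gr g, d a ∈ gr (g - 1)
  d_d : ∀ a, d (d a) = 0
  leibniz : ∀ a b, d (a * b) = d a * b + a * d b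
  I : Subalgebra (ZMod 2) A
  I_mem : ∀ e ∈ I, e ∈ gr 0
  d_I : ∀ e ∈ I, d e = 0

attribute [instance] DGAlg.ring DGAlg.alg DGAlg.graded

section Algebra

variable {G : Type v} [AddCommGroupWithOne G] [DecidableEq G] (D : DGAlg.{u} G)
variable (K : Type u) [CommRing K] [Algebra (ZMod 2) K]

/-- `A_K`, the algebra `A` with scalars extended to `K`. -/
abbrev Ext : Type u := K ⊗[ZMod 2] D.A

/-- The differential `μ₁` of `A_K`. -/
def mu1 : Ext D K →ₗ[K] Ext D K := D.d.baseChange K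

/-- The grading of `A_K`. -/
def grExt (g : G) : Submodule K (Ext D K) := (D.gr g).baseChange K

/-- The inclusion of the ground ring into `A_K`. -/
def inc : D.I →+* Ext D K :=
  (Algebra.TensorProduct.includeRight (R := ZMod 2) (A := K) (B := D.A)).toRingHom.comp
    D.I.val.toRingHom

/-- `A_K` as a left module over the ground ring. -/
abbrev algL : LMod D.I K where
  carrier := Ext D K
  act := (Algebra.lmul K (Ext D K)).toRingHom.comp (inc D K)

/-- `A_K` as a right module over the ground ring. -/
abbrev algR : RMod D.I K where
  carrier := Ext D K
  act :=
    { toFun := fun e => LinearMap.mulRight K (inc D K e.unop)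
      map_one' := LinearMap.ext fun a => by simp
      map_mul' := fun e f => LinearMap.ext fun a => by simp [mul_assoc]
      map_zero' := LinearMap.ext fun a => by simp
      map_add' := fun e f => LinearMap.ext fun a => by simp [mul_add] }

variable {D K}

theorem inc_apply (e : D.I) : inc D K e = 1 ⊗ₜ[ZMod 2] (e : D.A) := rfl

/-- Left multiplication by an element of `A_K`. -/
def mulL (a : Ext D K) : RHom (algR D K) (algR D K) :=
  ⟨LinearMap.mulLeft K a, fun e x => (mul_assoc a x (inc D K e.unop)).symm⟩

/-- Right multiplication by an element of `A_K`. -/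
def mulR (a : Ext D K) : LHom (algL D K) (algL D K) :=
  ⟨LinearMap.mulRight K a, fun e x => mul_assoc (inc D K e) x a⟩

@[simp]
theorem mulL_lin (a b : Ext D K) : (mulL a).lin b = a * b := rfl

@[simp]
theorem mulR_lin (a b : Ext D K) : (mulR a).lin b = b * a := rfl

theorem mu1_mul_inc (x : Ext D K) (e : D.I) : mu1 D K (x * inc D K e) = mu1 D K x * inc D K e := by
  induction x using TensorProduct.induction_on with
  | zero => simp
  | tmul r a => simp [mu1, inc_apply, D.leibniz, D.d_I e e.2]
  | add x y hx hy => rw [add_mul, map_add, hx, hy, map_add, add_mul]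

/-- The differential `μ₁` as a map of right modules. -/
def mu1R : RHom (algR D K) (algR D K) := ⟨mu1 D K, fun e x => mu1_mul_inc x e.unop⟩

/-- `M ⊗ A_K`, over the ground ring, as a right module. -/
abbrev tensA (M : RMod D.I K) : RMod D.I K where
  carrier := Bal M (algL D K)
  act :=
    { toFun := fun e => Bal.map (RHom.id M) (mulR (inc D K e.unop))
      map_one' := Bal.hom_ext fun x a => by
        simp only [Bal.map_mk, MulOpposite.unop_one, map_one]
        rw [mulR_lin, mul_one]; rfl
      map_mul' := fun e f => Bal.hom_ext fun x a => by
        simp only [Bal.map_mk, MulOpposite.unop_mul, map_mul, Module.End.mul_apply]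
        rw [mulR_lin, mulR_lin, mulR_lin, mul_assoc]; rfl
      map_zero' := Bal.hom_ext fun x a => by
        simp only [Bal.map_mk, MulOpposite.unop_zero, map_zero]
        rw [mulR_lin, mul_zero]; exact Bal.mk_zero_right _
      map_add' := fun e f => Bal.hom_ext fun x a => by
        simp only [Bal.map_mk, MulOpposite.unop_add, map_add, LinearMap.add_apply]
        rw [mulR_lin, mulR_lin, mulR_lin, mul_add]; exact Bal.mk_add_right _ _ _ }

/-- `A_K ⊗ N`, over the ground ring, as a left module. -/
abbrev Atens (N : LMod D.I K) : LMod D.I K where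
  carrier := Bal (algR D K) N
  act :=
    { toFun := fun e => Bal.map (mulL (inc D K e)) (LHom.id N)
      map_one' := Bal.hom_ext fun a y => by
        simp only [Bal.map_mk, map_one]
        rw [mulL_lin, one_mul]; rfl
      map_mul' := fun e f => Bal.hom_ext fun a y => by
        simp only [Bal.map_mk, map_mul, Module.End.mul_apply]
        rw [mulL_lin, mulL_lin, mulL_lin, mul_assoc]; rfl
      map_zero' := Bal.hom_ext fun a y => by
        simp only [Bal.map_mk, map_zero]
        rw [mulL_lin, zero_mul]; exact Bal.mk_zero_left _
      map_add' := fun e f => Bal.hom_ext fun a y => by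
        simp only [Bal.map_mk, map_add, LinearMap.add_apply]
        rw [mulL_lin, mulL_lin, mulL_lin, add_mul]; exact Bal.mk_add_left _ _ _ }

theorem tensA_act (M : RMod D.I K) (e : D.I) (x : M.carrier) (a : Ext D K) :
    (tensA M).act (MulOpposite.op e) (Bal.mk (N := algL D K) x a)
      = Bal.mk (N := algL D K) x (a * inc D K e) := Bal.map_mk _ _ _ _

theorem Atens_act (N : LMod D.I K) (e : D.I) (a : Ext D K) (y : N.carrier) :
    (Atens N).act e (Bal.mk (M := algR D K) a y)
      = Bal.mk (M := algR D K) (inc D K e * a) y := Bal.map_mk _ _ _ _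

/-- The map `f ⊗ 1` on `M ⊗ A_K`. -/
def tensAMap {M M' : RMod D.I K} (f : RHom M M') : RHom (tensA M) (tensA M') :=
  ⟨Bal.map f (LHom.id (algL D K)), fun e x => by
    induction x using Bal.induction with
    | zero => simp
    | mk x a => simp only [Bal.map_mk]; rfl
    | add z w hz hw => simp only [map_add, hz, hw]⟩

/-- The map `1 ⊗ f` on `A_K ⊗ N`. -/
def AtensMap {N N' : LMod D.I K} (f : LHom N N') : LHom (Atens N) (Atens N') :=
  ⟨Bal.map (RHom.id (algR D K)) f, fun e x => by
    induction x using Bal.induction with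
    | zero => simp
    | mk x a => simp only [Bal.map_mk]; rfl
    | add z w hz hw => simp only [map_add, hz, hw]⟩

/-- The map `a ↦ x ⊗ a`. -/
def insL {M : RMod D.I K} (x : M.carrier) : RHom (algR D K) (tensA M) :=
  ⟨Bal.mkLin M (algL D K) x, fun e a => (tensA_act M e.unop x a).symm⟩

theorem insL_lin {M : RMod D.I K} (x : M.carrier) (a : Ext D K) :
    (insL x).lin a = Bal.mk (N := algL D K) x a := rfl

/-- The rebracketing `M ⊗ (A_K ⊗ N) → (M ⊗ A_K) ⊗ N`. -/
def assoc (M : RMod D.I K) (N : LMod D.I K) : Bal M (Atens N) →ₗ[K] Bal (tensA M) N :=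
  Bal.lift
    (LinearMap.mk₂ K (fun x t => Bal.map (insL x) (LHom.id N) t)
      (fun x x' t => by
        induction t using Bal.induction with
        | zero => simp
        | mk a y =>
          simp only [Bal.map_mk]
          rw [insL_lin, insL_lin, insL_lin, Bal.mk_add_left]; exact Bal.mk_add_left _ _ _
        | add z w hz hw => simp only [map_add, hz, hw]; abel)
      (fun r x t => by
        induction t using Bal.induction with
        | zero => simp
        | mk a y =>
          simp only [Bal.map_mk]
          rw [insL_lin, insL_lin, Bal.mk_smul_left]; exact Bal.mk_smul_left _ _ _
        | add z w hz hw => simp only [map_add, hz, hw, smul_add])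
      (fun x t t' => by simp)
      (fun r x t => by simp))
    (fun x e t => by
      simp only [LinearMap.mk₂_apply]
      induction t using Bal.induction with
      | zero => simp
      | mk a y =>
        refine (Bal.map_mk (insL _) (LHom.id N) a y).trans
          (Eq.trans ?_ (Bal.map_mk (insL x) (LHom.id N) (inc D K e * a) y).symm)
        exact congrArg (fun z => Bal.mk (M := tensA M) z y)
          (Bal.mk_act (N := algL D K) e x a)
      | add z w hz hw => simp only [map_add, hz, hw])

theorem assoc_mk (M : RMod D.I K) (N : LMod D.I K) (x : M.carrier) (a : Ext D K)
    (y : N.carrier) :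
    assoc M N (Bal.mk (N := Atens N) x (Bal.mk (M := algR D K) a y))
      = Bal.mk (M := tensA M) (Bal.mk (N := algL D K) x a) y := by
  simp only [assoc, Bal.lift_mk, LinearMap.mk₂_apply, Bal.map_mk]; rfl

/-- The map `μ₂ ⊗ 1 : A_K ⊗ (A_K ⊗ N) → A_K ⊗ N`. -/
def mu2N (N : LMod D.I K) : Bal (algR D K) (Atens N) →ₗ[K] Bal (algR D K) N :=
  Bal.lift
    (LinearMap.mk₂ K (fun a t => Bal.map (mulL a) (LHom.id N) t)
      (fun a a' t => by
        induction t using Bal.induction with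
        | zero => simp
        | mk b y =>
          simp only [Bal.map_mk]
          rw [mulL_lin, mulL_lin, mulL_lin, add_mul]; exact Bal.mk_add_left _ _ _
        | add z w hz hw => simp only [map_add, hz, hw]; abel)
      (fun r a t => by
        induction t using Bal.induction with
        | zero => simp
        | mk b y =>
          simp only [Bal.map_mk]
          rw [mulL_lin, mulL_lin, smul_mul_assoc]; exact Bal.mk_smul_left _ _ _
        | add z w hz hw => simp only [map_add, hz, hw, smul_add])
      (fun a t t' => by simp)
      (fun r a t => by simp))
    (fun a e t => by
      simp only [LinearMap.mk₂_apply]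
      induction t using Bal.induction with
      | zero => simp
      | mk b y =>
        refine (Bal.map_mk (mulL _) (LHom.id N) b y).trans
          (Eq.trans ?_ (Bal.map_mk (mulL a) (LHom.id N) (inc D K e * b) y).symm)
        exact congrArg (fun c => Bal.mk (M := algR D K) c y) (mul_assoc a (inc D K e) b)
      | add z w hz hw => simp only [map_add, hz, hw])

theorem mu2N_mk (N : LMod D.I K) (a b : Ext D K) (y : N.carrier) :
    mu2N N (Bal.mk (M := algR D K) (N := Atens N) a (Bal.mk (M := algR D K) b y))
      = Bal.mk (M := algR D K) (a * b) y := by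
  simp only [mu2N, Bal.lift_mk, LinearMap.mk₂_apply, Bal.map_mk]; rfl

/-! ### Iterated tensor products -/

/-- `M ⊗ A_K ⊗ ⋯ ⊗ A_K` with `k` factors `A_K`, tensor products over the ground ring. -/
def S (M : RMod D.I K) : ℕ → RMod D.I K
  | 0 => M
  | k + 1 => tensA (S M k)

/-- The pure tensor `x ⊗ a₀ ⊗ ⋯ ⊗ a_{k-1}`; only the first `k` entries of the sequence `a`
are used. -/
def pure {M : RMod D.I K} (x : M.carrier) (a : ℕ → Ext D K) : (k : ℕ) → (S M k).carrier
  | 0 => x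
  | k + 1 => Bal.mk (M := S M k) (N := algL D K) (pure x a k) (a k)

/-- `A_K ⊗ ⋯ ⊗ A_K ⊗ N` with `k` factors `A_K`, tensor products over the ground ring. -/
def T : ℕ → LMod D.I K → LMod D.I K
  | 0, N => N
  | k + 1, N => T k (Atens N)

/-- The map `1 ⊗ ⋯ ⊗ 1 ⊗ f` on `A_K ⊗ ⋯ ⊗ A_K ⊗ N`. -/
def TMap : (k : ℕ) → {N N' : LMod D.I K} → LHom N N' → LHom (T k N) (T k N')
  | 0, _, _, f => f
  | k + 1, _, _, f => TMap k (AtensMap f)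

/-- The rebracketing `M ⊗ (A_K ⊗ ⋯ ⊗ A_K ⊗ N) → (M ⊗ A_K ⊗ ⋯ ⊗ A_K) ⊗ N`. -/
def rebracket (M : RMod D.I K) : (k : ℕ) → (N : LMod D.I K) → Bal M (T k N) →ₗ[K] Bal (S M k) N
  | 0, _ => LinearMap.id
  | k + 1, N => assoc (S M k) N ∘ₗ rebracket M k (Atens N)

/-- The iterates `Δ_k : N → A_K ⊗ ⋯ ⊗ A_K ⊗ N` of `δ`, with `Δ₀ = 1` and
`Δ_{k+1} = (1 ⊗ ⋯ ⊗ 1 ⊗ δ) Δ_k`. -/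
def Delta {N : LMod D.I K} (δ : LHom N (Atens N)) : (k : ℕ) → LHom N (T k N)
  | 0 => LHom.id N
  | k + 1 => (TMap k δ).comp (Delta δ k)

/-! ### Families of operations -/

/-- Families of maps `f_{k+1} : M ⊗ A_K ⊗ ⋯ ⊗ A_K → M'` (with `k ≥ 0` factors `A_K`), linear over
the ground ring.  The map `f_{k+1}` is the entry at index `k`. -/
abbrev Ops (M M' : RMod D.I K) : Type u := (k : ℕ) → RHom (S M k) M'

/-- `f_{n+1}(x ⊗ a₀ ⊗ ⋯ ⊗ a_{n-1})`. -/
def ev {M M' : RMod D.I K} (f : Ops M M') (n : ℕ) (x : M.carrier) (a : ℕ → Ext D K) :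
    M'.carrier :=
  (f n).lin (pure x a n)

/-- The sequence `a` with the entries `a_k, a_{k+1}` replaced by their product. -/
def contract (a : ℕ → Ext D K) (k : ℕ) : ℕ → Ext D K := fun t =>
  if t < k then a t else if t = k then a k * a (k + 1) else a (t + 1)

/-- `∑ g_i (f_j ⊗ 1 ⊗ ⋯ ⊗ 1)`, the sum over `i + j = n + 2`, evaluated on
`x ⊗ a₀ ⊗ ⋯ ⊗ a_{n-1}`. -/
def star {M M' M'' : RMod D.I K} (g : Ops M' M'') (f : Ops M M') (n : ℕ) (x : M.carrier)
    (a : ℕ → Ext D K) : M''.carrier :=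
  ∑ j ∈ Finset.range (n + 1), ev g (n - j) (ev f j x a) (fun t => a (j + t))

/-- `∑ f_i (1 ⊗ ⋯ ⊗ μ_j ⊗ ⋯ ⊗ 1)`, the sum over `i + j = n + 2`, `j ∈ {1, 2}`, and over all
positions of `μ_j` among the algebra factors, evaluated on `x ⊗ a₀ ⊗ ⋯ ⊗ a_{n-1}`. -/
def inner {M M' : RMod D.I K} (f : Ops M M') (n : ℕ) (x : M.carrier) (a : ℕ → Ext D K) :
    M'.carrier :=
  ∑ k ∈ Finset.range n, ev f n x (Function.update a k (mu1 D K (a k)))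
    + ∑ k ∈ Finset.range (n - 1), ev f (n - 1) x (contract a k)

/-- The identity morphism: `id₁ = id` and `id_n = 0` for `n > 1`. -/
def idOps (M : RMod D.I K) : Ops M M
  | 0 => RHom.id M
  | k + 1 => RHom.zero (S M (k + 1)) M

/-- The map `f_{n+1}` raises the degree by `n + s`, for all `n`. -/
def OpsDegree {M M' : RMod D.I K} (grM : G → Submodule K M.carrier)
    (grM' : G → Submodule K M'.carrier) (f : Ops M M') (s : ℤ) : Prop :=
  ∀ (n : ℕ) (x : M.carrier) (a : ℕ → Ext D K) (p : G) (q : ℕ → G), x ∈ grM p →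
    (∀ t < n, a t ∈ grExt D K (q t)) →
    ev f n x a ∈ grM' (p + ∑ t ∈ Finset.range n, q t + ((n + s : ℤ) : G))

/-- For every `x` the maps `f_n(x ⊗ ⋯)` vanish for all large `n`. -/
def OpsBounded {M M' : RMod D.I K} (f : Ops M M') : Prop :=
  ∀ x : M.carrier, ∃ n₀ : ℕ, ∀ n ≥ n₀, ∀ a : ℕ → Ext D K, ev f n x a = 0

/-! ### A-infinity modules -/

/-- The data of a right A-infinity module over `A_K`: a module over the ground ring, a family
of submodules (the grading), and operations `m_{k+1}` (at index `k`). -/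
structure AData (D : DGAlg.{u} G) (K : Type u) [CommRing K] [Algebra (ZMod 2) K]
    extends RMod D.I K where
  gr : G → Submodule K carrier
  m : Ops toRMod toRMod

/-- The axioms of a right A-infinity module over `A_K`: `M` is a graded module over the ground
ring, `m_i` has degree `i - 2`, and the A-infinity relations hold. -/
structure AData.IsAInf (M : AData D K) : Prop where
  internal : DirectSum.IsInternal M.gr
  act_mem : ∀ e g, ∀ x ∈ M.gr g, M.act e x ∈ M.gr g
  degree : OpsDegree M.gr M.gr M.m (-1)
  rel : ∀ n x a, star M.m M.m n x a + inner M.m n x a = 0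

/-- A-infinity homomorphisms. -/
structure IsAHom (M M' : AData D K) (ψ : Ops M.toRMod M'.toRMod) : Prop where
  degree : OpsDegree M.gr M'.gr ψ 0
  rel : ∀ n x a, star M'.m ψ n x a + star ψ M.m n x a + inner ψ n x a = 0

/-- `h` is a homotopy between the morphisms whose components are given by `ψ` and `φ`. -/
structure IsAHomotopy (M M' : AData D K)
    (ψ φ : ℕ → M.carrier → (ℕ → Ext D K) → M'.carrier) (h : Ops M.toRMod M'.toRMod) : Prop where
  degree : OpsDegree M.gr M'.gr h 1
  rel : ∀ n x a, ψ n x a + φ n x a = star M'.m h n x a + star h M.m n x a + inner h n x a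

/-- A homotopy equivalence of A-infinity modules. -/
structure AEquiv (M M' : AData D K) : Type u where
  f : Ops M.toRMod M'.toRMod
  g : Ops M'.toRMod M.toRMod
  h : Ops M.toRMod M.toRMod
  h' : Ops M'.toRMod M'.toRMod
  hom_f : IsAHom M M' f
  hom_g : IsAHom M' M g
  homotopy_h : IsAHomotopy M M (star g f) (ev (idOps M.toRMod)) h
  homotopy_h' : IsAHomotopy M' M' (star f g) (ev (idOps M'.toRMod)) h'

/-- The module `M` is (operationally) bounded. -/
def AData.Bounded (M : AData D K) : Prop := OpsBounded M.m

/-- The homotopy equivalence consists of bounded families of maps. -/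
def AEquiv.Bounded {M M' : AData D K} (e : AEquiv M M') : Prop :=
  OpsBounded e.f ∧ OpsBounded e.g ∧ OpsBounded e.h ∧ OpsBounded e.h'

/-! ### Type D structures -/

/-- The grading of a tensor product: `deg (x ⊗ y) = deg x + deg y`. -/
def grBal {M : RMod D.I K} {N : LMod D.I K} (grM : G → Submodule K M.carrier)
    (grN : G → Submodule K N.carrier) (g : G) : Submodule K (Bal M N) :=
  Submodule.span K {z | ∃ p q x y, x ∈ grM p ∧ y ∈ grN q ∧ p + q = g ∧ z = Bal.mk x y}

/-- The data of a left type D structure over `A_K`. -/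
structure DData (D : DGAlg.{u} G) (K : Type u) [CommRing K] [Algebra (ZMod 2) K]
    extends LMod D.I K where
  gr : G → Submodule K carrier
  δ : LHom toLMod (Atens toLMod)

/-- The axioms of a left type D structure over `A_K`. -/
structure DData.IsTypeD (N : DData D K) : Prop where
  internal : DirectSum.IsInternal N.gr
  act_mem : ∀ e g, ∀ y ∈ N.gr g, N.act e y ∈ N.gr g
  degree : ∀ g, ∀ y ∈ N.gr g,
    N.δ.lin y ∈ grBal (M := algR D K) (N := N.toLMod) (grExt D K) N.gr (g - 1)
  rel : ∀ y, mu2N N.toLMod ((AtensMap N.δ).lin (N.δ.lin y))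
    + Bal.map mu1R (LHom.id N.toLMod) (N.δ.lin y) = 0

/-- The type D structure is bounded: for every `y`, `Δ_k(y) = 0` for all large `k`. -/
def DData.Bounded (N : DData D K) : Prop :=
  ∀ y : N.carrier, ∃ k₀ : ℕ, ∀ k ≥ k₀, (Delta N.δ k).lin y = 0

end Algebra

/-! ## Graded differential spaces -/

section Complexes

/-- A `K`-module with a family of submodules indexed by `G` and an endomorphism. -/
structure DiffSpace (G : Type v) (K : Type u) [CommRing K] : Type (max (u + 1) v) where
  carrier : Type u
  [grp : AddCommGroup carrier]
  [mod : Module K carrier]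
  gr : G → Submodule K carrier
  d : carrier →ₗ[K] carrier

attribute [instance] DiffSpace.grp DiffSpace.mod

variable {G : Type v} [AddCommGroupWithOne G] {K : Type u} [CommRing K]

/-- The endomorphism is a differential of degree `-1`. -/
structure DiffSpace.IsComplex (C : DiffSpace G K) : Prop where
  d_mem : ∀ g, ∀ z ∈ C.gr g, C.d z ∈ C.gr (g - 1)
  d_d : ∀ z, C.d (C.d z) = 0

/-- Chain homotopy equivalence: chain maps `f`, `f'` of degree `0` in both directions whose
composites are homotopic to the identities through maps of degree `1`. -/
def ChainHomotopic (C C' : DiffSpace G K) : Prop :=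
  ∃ (f : C.carrier →ₗ[K] C'.carrier) (f' : C'.carrier →ₗ[K] C.carrier)
    (h : C.carrier →ₗ[K] C.carrier) (h' : C'.carrier →ₗ[K] C'.carrier),
    (∀ g, ∀ z ∈ C.gr g, f z ∈ C'.gr g) ∧ (∀ g, ∀ z ∈ C'.gr g, f' z ∈ C.gr g) ∧
    (∀ g, ∀ z ∈ C.gr g, h z ∈ C.gr (g + 1)) ∧ (∀ g, ∀ z ∈ C'.gr g, h' z ∈ C'.gr (g + 1)) ∧
    (∀ z, f (C.d z) = C'.d (f z)) ∧ (∀ z, f' (C'.d z) = C.d (f' z)) ∧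
    (∀ z, f' (f z) - z = C.d (h z) + h (C.d z)) ∧
    (∀ z, f (f' z) - z = C'.d (h' z) + h' (C'.d z))

/-- The pointwise finite sum `∑ₖ φ_k` of linear maps (zero if it is not pointwise finite). -/
def locSum {X Y : Type u} [AddCommGroup X] [Module K X] [AddCommGroup Y] [Module K Y]
    (φ : ℕ → X →ₗ[K] Y) : X →ₗ[K] Y :=
  open Classical in
  if hφ : ∀ x, (Function.support fun k => φ k x).Finite then
    { toFun := fun x => ∑ᶠ k, φ k x
      map_add' := fun x y => by
        simp only [map_add]
        exact finsum_add_distrib (hφ x) (hφ y)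
      map_smul' := fun r x => by
        simp only [map_smul, RingHom.id_apply]
        exact (smul_finsum' r (hφ x)).symm }
  else 0

end Complexes

/-! ## The box tensor product -/

section Box

variable {G : Type v} [AddCommGroupWithOne G] [DecidableEq G] {D : DGAlg.{u} G}
variable {K : Type u} [CommRing K] [Algebra (ZMod 2) K]

/-- The box tensor product `M ⊠ N` of an A-infinity module and a type D structure over the same
`A_K`: the graded module `M ⊗ N` with `∂ = ∑ₖ (m_{k+1} ⊗ 1) (1 ⊗ Δ_k)`. -/
def box (M : AData D K) (N : DData D K) : DiffSpace G K where
  carrier := Bal M.toRMod N.toLMod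
  gr := grBal M.gr N.gr
  d := locSum fun k => Bal.map (M.m k) (LHom.id N.toLMod) ∘ₗ rebracket M.toRMod k N.toLMod ∘ₗ
    Bal.map (RHom.id M.toRMod) (Delta N.δ k)

end Box

/-! ## Extension of scalars -/

section BaseChange

section Modules

variable {R : Type u} [Ring R] {K : Type u} [CommRing K] (L : Type u) [CommRing L] [Algebra K L]

/-- Extension of scalars of a left module. -/
abbrev LMod.bc (N : LMod R K) : LMod R L where
  carrier := L ⊗[K] N.carrier
  act := (Module.End.baseChangeHom K L N.carrier).toRingHom.comp N.act

/-- Extension of scalars of a right module. -/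
abbrev RMod.bc (M : RMod R K) : RMod R L where
  carrier := L ⊗[K] M.carrier
  act := (Module.End.baseChangeHom K L M.carrier).toRingHom.comp M.act

/-- Extension of scalars of a homomorphism. -/
def LHom.bc {N N' : LMod R K} (f : LHom N N') : LHom (N.bc L) (N'.bc L) :=
  ⟨f.lin.baseChange L, fun e x => by
    change (f.lin.baseChange L) ((N.act e).baseChange L x)
      = (N'.act e).baseChange L (f.lin.baseChange L x)
    rw [← LinearMap.comp_apply, ← LinearMap.comp_apply, ← LinearMap.baseChange_comp,
      ← LinearMap.baseChange_comp]
    congr 2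
    exact LinearMap.ext fun y => f.map_act e y⟩

/-- Extension of scalars of a homomorphism. -/
def RHom.bc {M M' : RMod R K} (f : RHom M M') : RHom (M.bc L) (M'.bc L) :=
  ⟨f.lin.baseChange L, fun e x => by
    change (f.lin.baseChange L) ((M.act e).baseChange L x)
      = (M'.act e).baseChange L (f.lin.baseChange L x)
    rw [← LinearMap.comp_apply, ← LinearMap.comp_apply, ← LinearMap.baseChange_comp,
      ← LinearMap.baseChange_comp]
    congr 2
    exact LinearMap.ext fun y => f.map_act e y⟩

/-- The canonical map `L ⊗ (M ⊗ N) → (L ⊗ M) ⊗ (L ⊗ N)`. -/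
def Bal.toBC (M : RMod R K) (N : LMod R K) :
    L ⊗[K] Bal M N →ₗ[L] Bal (M.bc L) (N.bc L) :=
  LinearMap.liftBaseChange L ((balRel M N).liftQ
    (((balRel (M.bc L) (N.bc L)).mkQ.restrictScalars K) ∘ₗ
      ((TensorProduct.AlgebraTensorModule.distribBaseChange K L M.carrier
        N.carrier).toLinearMap.restrictScalars K) ∘ₗ
      TensorProduct.mk K L (M.carrier ⊗[K] N.carrier) 1) (by
    rw [balRel, Submodule.span_le]
    rintro z ⟨x, e, y, rfl⟩
    change (balRel (M.bc L) (N.bc L)).mkQ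
      (TensorProduct.AlgebraTensorModule.distribBaseChange K L M.carrier N.carrier
        (1 ⊗ₜ[K] (M.act (MulOpposite.op e) x ⊗ₜ[K] y - x ⊗ₜ[K] N.act e y))) = 0
    rw [TensorProduct.tmul_sub, map_sub, map_sub, sub_eq_zero]
    exact Bal.mk_act (M := M.bc L) (N := N.bc L) e (1 ⊗ₜ x) (1 ⊗ₜ y)))

theorem Bal.toBC_tmul (M : RMod R K) (N : LMod R K) (r : L) (x : M.carrier) (y : N.carrier) :
    Bal.toBC L M N (r ⊗ₜ[K] Bal.mk x y)
      = r • Bal.mk (M := M.bc L) (N := N.bc L) (1 ⊗ₜ[K] x) (1 ⊗ₜ[K] y) := rfl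

/-- The canonical map `(L ⊗ M) ⊗ (L ⊗ N) → L ⊗ (M ⊗ N)`. -/
def Bal.ofBC (M : RMod R K) (N : LMod R K) :
    Bal (M.bc L) (N.bc L) →ₗ[L] L ⊗[K] Bal M N :=
  Bal.lift (TensorProduct.curry ((balRel M N).mkQ.baseChange L ∘ₗ
      (TensorProduct.AlgebraTensorModule.distribBaseChange K L M.carrier
        N.carrier).symm.toLinearMap)) fun x e y => by
    induction x using TensorProduct.induction_on with
    | zero => simp
    | add x x' hx hx' => simp only [map_add, LinearMap.add_apply, hx, hx']
    | tmul r x =>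
      induction y using TensorProduct.induction_on with
      | zero => simp
      | add y y' hy hy' => simp only [map_add, hy, hy']
      | tmul r' y =>
        change (balRel M N).mkQ.baseChange L
            ((TensorProduct.AlgebraTensorModule.distribBaseChange K L M.carrier N.carrier).symm
              ((r ⊗ₜ[K] M.act (MulOpposite.op e) x) ⊗ₜ[L] (r' ⊗ₜ[K] y)))
          = (balRel M N).mkQ.baseChange L
            ((TensorProduct.AlgebraTensorModule.distribBaseChange K L M.carrier N.carrier).symm
              ((r ⊗ₜ[K] x) ⊗ₜ[L] (r' ⊗ₜ[K] N.act e y)))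
        rw [TensorProduct.AlgebraTensorModule.distribBaseChange_symm_tmul,
          TensorProduct.AlgebraTensorModule.distribBaseChange_symm_tmul,
          LinearMap.baseChange_tmul, LinearMap.baseChange_tmul]
        exact congrArg (fun z => (r * r') ⊗ₜ[K] z) (Bal.mk_act e x y)

theorem Bal.ofBC_mk (M : RMod R K) (N : LMod R K) (r r' : L) (x : M.carrier) (y : N.carrier) :
    Bal.ofBC L M N (Bal.mk (M := M.bc L) (N := N.bc L) (r ⊗ₜ[K] x) (r' ⊗ₜ[K] y))
      = (r * r') ⊗ₜ[K] Bal.mk x y := by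
  refine (Bal.lift_mk _ _ _ _).trans ?_
  change (balRel M N).mkQ.baseChange L
      ((TensorProduct.AlgebraTensorModule.distribBaseChange K L M.carrier N.carrier).symm
        ((r ⊗ₜ[K] x) ⊗ₜ[L] (r' ⊗ₜ[K] y))) = _
  rw [TensorProduct.AlgebraTensorModule.distribBaseChange_symm_tmul, LinearMap.baseChange_tmul]
  rfl

theorem Bal.ofBC_map {M M' : RMod R K} {N N' : LMod R K} (f : RHom M M') (g : LHom N N')
    (z : Bal (M.bc L) (N.bc L)) :
    Bal.ofBC L M' N' (Bal.map (f.bc L) (g.bc L) z) = (Bal.map f g).baseChange L (Bal.ofBC L M N z) := by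
  induction z using Bal.induction with
  | zero => simp
  | add z w hz hw => simp only [map_add, hz, hw]
  | mk x y =>
    induction (show L ⊗[K] M.carrier from x) using TensorProduct.induction_on with
    | zero => simp
    | add x x' hx hx' =>
      have h := Bal.mk_add_left (M := M.bc L) (N := N.bc L) x x' y
      generalize (Bal.mk (M := M.bc L) (N := N.bc L) (x + x') y) = w at h ⊢
      rw [h]
      simp only [map_add, hx, hx']
    | tmul r x =>
      induction (show L ⊗[K] N.carrier from y) using TensorProduct.induction_on with
      | zero => simp
      | add y y' hy hy' =>
        have h := Bal.mk_add_right (M := M.bc L) (N := N.bc L) (r ⊗ₜ[K] x) y y'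
        generalize (Bal.mk (M := M.bc L) (N := N.bc L) (r ⊗ₜ[K] x) (y + y')) = w at h ⊢
        rw [h]
        simp only [map_add, hy, hy']
      | tmul r' y =>
        refine (Bal.ofBC_mk L M' N' r r' (f.lin x) (g.lin y)).trans ?_
        rw [Bal.ofBC_mk, LinearMap.baseChange_tmul, Bal.map_mk]

theorem Bal.toBC_map {M M' : RMod R K} {N N' : LMod R K} (f : RHom M M') (g : LHom N N')
    (z : L ⊗[K] Bal M N) :
    Bal.toBC L M' N' ((Bal.map f g).baseChange L z)
      = Bal.map (f.bc L) (g.bc L) (Bal.toBC L M N z) := by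
  induction z using TensorProduct.induction_on with
  | zero => simp
  | add z w hz hw => simp only [map_add, hz, hw]
  | tmul r t =>
    induction t using Bal.induction with
    | zero => simp
    | add t t' ht ht' => simp only [TensorProduct.tmul_add, map_add, ht, ht']
    | mk x y =>
      rw [LinearMap.baseChange_tmul, Bal.map_mk, Bal.toBC_tmul, Bal.toBC_tmul, map_smul,
        Bal.map_mk]
      rfl

end Modules

section Structures

variable {G : Type v} [AddCommGroupWithOne G] [DecidableEq G] {D : DGAlg.{u} G}
variable {K : Type u} [CommRing K] [Algebra (ZMod 2) K]
variable (L : Type u) [CommRing L] [Algebra (ZMod 2) L] [Algebra K L] [IsScalarTower (ZMod 2) K L]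

/-- The canonical isomorphism `L ⊗ A_K ≅ A_L`. -/
def cancel (D : DGAlg.{u} G) (K : Type u) [CommRing K] [Algebra (ZMod 2) K]
    (L : Type u) [CommRing L] [Algebra (ZMod 2) L] [Algebra K L] [IsScalarTower (ZMod 2) K L] :
    L ⊗[K] Ext D K ≃ₗ[L] Ext D L :=
  TensorProduct.AlgebraTensorModule.cancelBaseChange (ZMod 2) K L L D.A

theorem cancel_act_right (e : D.I) (z : L ⊗[K] Ext D K) :
    cancel D K L ((LinearMap.mulRight K (inc D K e)).baseChange L z)
      = cancel D K L z * inc D L e := by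
  induction z using TensorProduct.induction_on with
  | zero => simp
  | add z w hz hw => simp only [map_add, hz, hw, add_mul]
  | tmul r b =>
    induction b using TensorProduct.induction_on with
    | zero => simp
    | add z w hz hw => simp only [TensorProduct.tmul_add, map_add, hz, hw, add_mul]
    | tmul s a => simp [cancel, inc_apply]

theorem cancel_act_left (e : D.I) (z : L ⊗[K] Ext D K) :
    cancel D K L ((Algebra.lmul K (Ext D K) (inc D K e)).baseChange L z)
      = inc D L e * cancel D K L z := by
  induction z using TensorProduct.induction_on with
  | zero => simp
  | add z w hz hw => simp only [map_add, hz, hw, mul_add]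
  | tmul r b =>
    induction b using TensorProduct.induction_on with
    | zero => simp
    | add z w hz hw => simp only [TensorProduct.tmul_add, map_add, hz, hw, mul_add]
    | tmul s a => simp [cancel, inc_apply]

/-- The isomorphism `L ⊗ A_K ≅ A_L` as a map of right modules. -/
def cancelR : RHom ((algR D K).bc L) (algR D L) :=
  ⟨(cancel D K L).toLinearMap, fun e z => cancel_act_right L e.unop z⟩

/-- The inverse isomorphism `A_L ≅ L ⊗ A_K` as a map of left modules. -/
def uncancelL : LHom (algL D L) ((algL D K).bc L) :=
  ⟨(cancel D K L).symm.toLinearMap, fun e a => by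
    apply (cancel D K L).injective
    refine ((cancel D K L).apply_symm_apply _).trans (Eq.trans ?_ (cancel_act_left L e _).symm)
    exact congrArg (fun b => inc D L e * b) ((cancel D K L).apply_symm_apply a).symm⟩

/-- The canonical map `(L ⊗ M) ⊗ A_L → L ⊗ (M ⊗ A_K)`. -/
def tensAOfBC (M : RMod D.I K) : RHom (tensA (M.bc L)) ((tensA M).bc L) :=
  ⟨Bal.ofBC L M (algL D K) ∘ₗ Bal.map (RHom.id (M.bc L)) (uncancelL L), fun e z => by
    induction z using Bal.induction with
    | zero => simp
    | add z w hz hw => simp only [map_add, hz, hw]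
    | mk x b =>
      refine Eq.trans ?_ (Bal.ofBC_map L (RHom.id M) (mulR (inc D K e.unop))
        (Bal.mk (M := M.bc L) (N := (algL D K).bc L) x ((cancel D K L).symm b)))
      change Bal.ofBC L M (algL D K) (Bal.mk (M := M.bc L) (N := (algL D K).bc L) x
          ((cancel D K L).symm (b * inc D L e.unop)))
        = Bal.ofBC L M (algL D K) (Bal.mk (M := M.bc L) (N := (algL D K).bc L)
          ((LinearMap.id : M.carrier →ₗ[K] M.carrier).baseChange L x)
          ((LinearMap.mulRight K (inc D K e.unop)).baseChange L ((cancel D K L).symm b)))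
      rw [LinearMap.baseChange_id, LinearMap.id_apply,
        (LinearEquiv.symm_apply_eq (cancel D K L)).2]
      rw [cancel_act_right, LinearEquiv.apply_symm_apply]⟩

/-- The canonical map `L ⊗ (A_K ⊗ N) → A_L ⊗ (L ⊗ N)`. -/
def AtensToBC (N : LMod D.I K) : LHom ((Atens N).bc L) (Atens (N.bc L)) :=
  ⟨Bal.map (cancelR L) (LHom.id (N.bc L)) ∘ₗ Bal.toBC L (algR D K) N, fun e z => by
    change Bal.map (cancelR L) (LHom.id (N.bc L)) (Bal.toBC L (algR D K) N
      ((Bal.map (mulL (inc D K e)) (LHom.id N)).baseChange L z)) = _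
    rw [Bal.toBC_map]
    change _ = Bal.map (mulL (inc D L e)) (LHom.id (N.bc L))
      (Bal.map (cancelR L) (LHom.id (N.bc L)) (Bal.toBC L (algR D K) N z))
    induction Bal.toBC L (algR D K) N z using Bal.induction with
    | zero => simp
    | add z w hz hw => simp only [map_add, hz, hw]
    | mk b y =>
      simp only [Bal.map_mk]
      change Bal.mk (M := algR D L) (N := N.bc L)
          (cancel D K L ((LinearMap.mulLeft K (inc D K e)).baseChange L b))
          ((LinearMap.id : N.carrier →ₗ[K] N.carrier).baseChange L y)
        = Bal.mk (M := algR D L) (N := N.bc L) (inc D L e * cancel D K L b) y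
      rw [LinearMap.baseChange_id, LinearMap.id_apply]
      exact congrArg (fun c => Bal.mk (M := algR D L) (N := N.bc L) c y) (cancel_act_left L e b)⟩

/-- The canonical map `(L ⊗ M) ⊗ A_L ⊗ ⋯ ⊗ A_L → L ⊗ (M ⊗ A_K ⊗ ⋯ ⊗ A_K)`, that is
`(r ⊗ x) ⊗ (r₁ ⊗ a₁) ⊗ ⋯ ↦ r r₁ ⋯ ⊗ (x ⊗ a₁ ⊗ ⋯)`. -/
def SOfBC (M : RMod D.I K) : (k : ℕ) → RHom (S (M.bc L) k) ((S M k).bc L)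
  | 0 => RHom.id (M.bc L)
  | k + 1 => (tensAOfBC L (S M k)).comp (tensAMap (SOfBC M k))

/-- Extension of scalars of a family of operations. -/
def Ops.bc {M M' : RMod D.I K} (f : Ops M M') : Ops (M.bc L) (M'.bc L) :=
  fun k => ((f k).bc L).comp (SOfBC L M k)

/-- Extension of scalars of an A-infinity module. -/
def AData.bc (M : AData D K) : AData D L where
  toRMod := M.toRMod.bc L
  gr g := (M.gr g).baseChange L
  m := Ops.bc L M.m

/-- Extension of scalars of a type D structure. -/
def DData.bc (N : DData D K) : DData D L where
  toLMod := N.toLMod.bc L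
  gr g := (N.gr g).baseChange L
  δ := (AtensToBC L N.toLMod).comp (N.δ.bc L)

/-- Extension of scalars of a graded differential space. -/
def DiffSpace.bc (C : DiffSpace G K) : DiffSpace G L where
  carrier := L ⊗[K] C.carrier
  gr g := (C.gr g).baseChange L
  d := C.d.baseChange L

end Structures

end BaseChange

/-! ## Change of the vector space, and stable homotopy -/

section Stable

variable {G : Type v} [AddCommGroupWithOne G] [DecidableEq G] {D : DGAlg.{u} G}
variable {W V : Type u} [AddCommGroup W] [Module (ZMod 2) W] [AddCommGroup V] [Module (ZMod 2) V]

theorem isScalarTower_zmod {K L : Type u} [CommRing K] [Algebra (ZMod 2) K] [CommRing L]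
    [Algebra (ZMod 2) L] [Algebra K L] : IsScalarTower (ZMod 2) K L :=
  IsScalarTower.of_algebraMap_eq' (Subsingleton.elim _ _)

/-- `F_φ(M)`: extension of scalars of an A-infinity module along the field extension
`F_W → F_V` induced by a linear injection `φ : W → V`. -/
def AData.ext (M : AData D (RatFun W)) (φ : W →ₗ[ZMod 2] V) (hφ : Function.Injective φ) :
    AData D (RatFun V) :=
  letI := (RatFun.map φ hφ).toAlgebra
  haveI : IsScalarTower (ZMod 2) (RatFun W) (RatFun V) := isScalarTower_zmod
  M.bc (RatFun V)

/-- `G_φ(N)`: extension of scalars of a type D structure along the field extension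
`F_W → F_V` induced by a linear injection `φ : W → V`. -/
def DData.ext (N : DData D (RatFun W)) (φ : W →ₗ[ZMod 2] V) (hφ : Function.Injective φ) :
    DData D (RatFun V) :=
  letI := (RatFun.map φ hφ).toAlgebra
  haveI : IsScalarTower (ZMod 2) (RatFun W) (RatFun V) := isScalarTower_zmod
  N.bc (RatFun V)

/-- Extension of scalars of a graded differential space along the field extension
`F_W → F_V` induced by a linear injection `φ : W → V`. -/
def DiffSpace.ext (C : DiffSpace G (RatFun W)) (φ : W →ₗ[ZMod 2] V)
    (hφ : Function.Injective φ) : DiffSpace G (RatFun V) :=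
  letI := (RatFun.map φ hφ).toAlgebra
  C.bc (RatFun V)

/-- The modified box tensor product of an A-infinity module over `A_W` and a type D structure
over `A_V`: the box tensor product of their extensions of scalars to `W ⊕ V`. -/
def boxStar (M : AData D (RatFun W)) (N : DData D (RatFun V)) :
    DiffSpace G (RatFun (W × V)) :=
  box (M.ext (LinearMap.inl (ZMod 2) W V) LinearMap.inl_injective)
    (N.ext (LinearMap.inr (ZMod 2) W V) LinearMap.inr_injective)

/-- Stable chain homotopy equivalence of complexes over `F_W` and `F_{W'}` via the triple
`(φ, φ', V)`. -/
def StablyChainHomotopicVia {W' : Type u} [AddCommGroup W'] [Module (ZMod 2) W']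
    (C : DiffSpace G (RatFun W)) (C' : DiffSpace G (RatFun W'))
    (φ : W →ₗ[ZMod 2] V) (φ' : W' →ₗ[ZMod 2] V) : Prop :=
  ∃ (hφ : Function.Injective φ) (hφ' : Function.Injective φ'),
    ChainHomotopic (C.ext φ hφ) (C'.ext φ' hφ')

end Stable

end StableBox

end

/-! A family `f` of maps f_{k+1} : M ⊗ A^{⊗k} → M' has a total map f^⊠ = ∑ₖ (f_{k+1} ⊗ 1)(1 ⊗ Δ_k) :
M ⊠ N → M' ⊠ N, called `boxTotal f δ`. The theorem holds because f ↦ f^⊠ respects composition,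
identities and differentials.

Composition: 1 ⊗ Δ_{j+i} is obtained from 1 ⊗ Δ_j by i further coactions, and these commute with f_j
acting on the left factor. Hence the family ∑ g_i (f_j ⊗ 1) goes to g^⊠ f^⊠, a Cauchy product
(`LocFinite.boxSum_starOp`).

Inner terms: by the type D equation, multiplying two adjacent entries of Δ_{n+1} equals, modulo 2,
applying μ₁ to the corresponding entry of Δ_n (`coact_rel`, `exists_mu1At`). So the μ₂ terms of one
arity cancel the μ₁ terms of the preceding one, and the whole sum telescopes to 0
(`LocFinite.boxSum_innerOp`).

Together these show that the morphism differential ∂f goes to ∂ f^⊠ + f^⊠ ∂ (`boxTotal_rel`). The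
A-infinity relations give ∂² = 0, homomorphisms give chain maps, and homotopies give chain
homotopies. Degrees match because Δ_k lowers the degree by k while f_{k+1} raises it by k + s.
Boundedness serves only to make the sums finite at each vector; both alternatives in the hypothesis
imply the common condition `LocFinite`.

Scalars: all the relations are equalities of linear maps on tensor powers, so after extension of
scalars they can be tested on generators defined over the smaller ring. Modules, homotopy
equivalences, type D structures and boundedness therefore survive the extension. The equivalence e,
extended from F_{W''} to F_{W''⊕W̃}, gives a chain homotopy equivalence of box products there. These
box products are the extended complexes of the statement, since (φ ⊕ id) ∘ inl = inl ∘ φ and (φ ⊕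
id) ∘ inr = inr make the two routes of field extensions agree (`box_diffIso`,
`boxStar_ext_diffIso`). -/

noncomputable section

namespace StableBox

/-! ### Additive structure on module maps, and the tensor product as a functor. -/

section RHomAdd

variable {R : Type u} [Ring R] {K : Type u} [CommRing K]

instance (M M' : RMod R K) : Zero (RHom M M') := ⟨RHom.zero M M'⟩

instance (M M' : RMod R K) : Add (RHom M M') :=
  ⟨fun f g => ⟨f.lin + g.lin, fun e x => by simp [f.map_act, g.map_act]⟩⟩

instance (M M' : RMod R K) : SMul ℕ (RHom M M') :=
  ⟨fun n f => ⟨n • f.lin, fun e x => by simp [f.map_act]⟩⟩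

theorem RHom.lin_injective (M M' : RMod R K) :
    Function.Injective (RHom.lin : RHom M M' → (M.carrier →ₗ[K] M'.carrier)) :=
  fun _ _ h => RHom.ext h

instance (M M' : RMod R K) : AddCommMonoid (RHom M M') :=
  (RHom.lin_injective M M').addCommMonoid _ rfl (fun _ _ => rfl) fun _ _ => rfl

theorem RHom.zero_lin {M M' : RMod R K} (x : M.carrier) : (0 : RHom M M').lin x = 0 := rfl

theorem RHom.add_lin {M M' : RMod R K} (f g : RHom M M') (x : M.carrier) :
    (f + g).lin x = f.lin x + g.lin x := rfl

theorem RHom.comp_lin {M M' M'' : RMod R K} (g : RHom M' M'') (f : RHom M M') (x : M.carrier) :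
    (g.comp f).lin x = g.lin (f.lin x) := rfl

theorem RHom.sum_lin {M M' : RMod R K} {ι : Type*} (s : Finset ι) (f : ι → RHom M M')
    (x : M.carrier) : (∑ i ∈ s, f i).lin x = ∑ i ∈ s, (f i).lin x := by
  classical
  induction s using Finset.induction_on with
  | empty => simp [RHom.zero_lin]
  | insert i s hi h => rw [Finset.sum_insert hi, Finset.sum_insert hi, RHom.add_lin, h]

/-- The map `f ⊗ 1` on `M ⊗ N`. -/
def rmap {M M' : RMod R K} (f : RHom M M') (N : LMod R K) : Bal M N →ₗ[K] Bal M' N :=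
  Bal.map f (LHom.id N)

theorem rmap_mk {M M' : RMod R K} (f : RHom M M') {N : LMod R K} (x : M.carrier)
    (y : N.carrier) : rmap f N (Bal.mk x y) = Bal.mk (f.lin x) y :=
  Bal.map_mk _ _ _ _

theorem rmap_id {M : RMod R K} {N : LMod R K} (z : Bal M N) : rmap (RHom.id M) N z = z := by
  induction z using Bal.induction with
  | zero => simp
  | mk x y => rw [rmap_mk]; rfl
  | add z w hz hw => rw [map_add, hz, hw]

theorem rmap_comp {M M' M'' : RMod R K} (g : RHom M' M'') (f : RHom M M') {N : LMod R K}
    (z : Bal M N) : rmap (g.comp f) N z = rmap g N (rmap f N z) := by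
  induction z using Bal.induction with
  | zero => simp
  | mk x y => rw [rmap_mk, rmap_mk, rmap_mk]; rfl
  | add z w hz hw => rw [map_add, hz, hw, map_add, map_add]

theorem rmap_zero {M M' : RMod R K} {N : LMod R K} (z : Bal M N) :
    rmap (0 : RHom M M') N z = 0 := by
  induction z using Bal.induction with
  | zero => simp
  | mk x y => rw [rmap_mk, RHom.zero_lin, Bal.mk_zero_left]
  | add z w hz hw => rw [map_add, hz, hw, add_zero]

theorem rmap_add {M M' : RMod R K} (f g : RHom M M') {N : LMod R K} (z : Bal M N) :
    rmap (f + g) N z = rmap f N z + rmap g N z := by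
  induction z using Bal.induction with
  | zero => simp
  | mk x y => rw [rmap_mk, RHom.add_lin, Bal.mk_add_left, rmap_mk, rmap_mk]
  | add z w hz hw => rw [map_add, hz, hw, map_add, map_add]; abel

theorem rmap_sum {M M' : RMod R K} {ι : Type*} (s : Finset ι) (f : ι → RHom M M')
    {N : LMod R K} (z : Bal M N) : rmap (∑ i ∈ s, f i) N z = ∑ i ∈ s, rmap (f i) N z := by
  classical
  induction s using Finset.induction_on with
  | empty => simp [rmap_zero]
  | insert i s hi h => rw [Finset.sum_insert hi, Finset.sum_insert hi, rmap_add, h]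

theorem lmap_comp (M : RMod R K) {N N' N'' : LMod R K} (g : LHom N' N'') (f : LHom N N')
    (z : Bal M N) : Bal.map (RHom.id M) (g.comp f) z
      = Bal.map (RHom.id M) g (Bal.map (RHom.id M) f z) :=
  LinearMap.congr_fun (g := Bal.map (RHom.id M) g ∘ₗ Bal.map (RHom.id M) f)
    (Bal.hom_ext fun x y => by rw [LinearMap.comp_apply, Bal.map_mk, Bal.map_mk, Bal.map_mk]; rfl) z

/-- Bilinearity reduces to generators one factor at a time. This is the inductive step for
`span_pure`. -/
theorem span_mk {P : RMod R K} {N : LMod R K} {X : Set P.carrier} {Y : Set N.carrier}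
    (hX : Submodule.span K X = ⊤) (hY : Submodule.span K Y = ⊤) :
    Submodule.span K {z : Bal P N | ∃ x ∈ X, ∃ y ∈ Y, z = Bal.mk x y} = ⊤ := by
  refine Submodule.eq_top_iff'.2 fun z => ?_
  induction z using Bal.induction with
  | zero => exact Submodule.zero_mem _
  | add z w hz hw => exact Submodule.add_mem _ hz hw
  | mk p q =>
    have h1 : p ∈ Submodule.span K X := hX ▸ Submodule.mem_top
    have h2 : q ∈ Submodule.span K Y := hY ▸ Submodule.mem_top
    change Bal.mkLin P N p q ∈ _
    refine Submodule.span_induction (p := fun p _ => Bal.mkLin P N p q ∈ _) ?_ ?_ ?_ ?_ h1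
    · intro x hx
      refine Submodule.span_induction (p := fun q _ => Bal.mkLin P N x q ∈ _) ?_ ?_ ?_ ?_ h2
      · intro y hy; exact Submodule.subset_span ⟨x, hx, y, hy, rfl⟩
      · rw [map_zero]; exact Submodule.zero_mem _
      · intro c c' _ _ h h'; rw [map_add]; exact Submodule.add_mem _ h h'
      · intro r c _ h; rw [map_smul]; exact Submodule.smul_mem _ r h
    · rw [map_zero, LinearMap.zero_apply]; exact Submodule.zero_mem _
    · intro c c' _ _ h h'
      rw [map_add, LinearMap.add_apply]; exact Submodule.add_mem _ h h'
    · intro r c _ h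
      rw [map_smul, LinearMap.smul_apply]; exact Submodule.smul_mem _ r h

end RHomAdd

/-! ### The coaction 1 ⊗ δ, its iterates, and pure tensors. -/

section Coaction

variable {G : Type v} [AddCommGroupWithOne G] [DecidableEq G] {D : DGAlg.{u} G}
variable {K : Type u} [CommRing K] [Algebra (ZMod 2) K]

/-- The map `1 ⊗ δ : P ⊗ N → (P ⊗ A_K) ⊗ N`. -/
def coact {N : LMod D.I K} (δ : LHom N (Atens N)) (P : RMod D.I K) :
    Bal P N →ₗ[K] Bal (tensA P) N :=
  assoc P N ∘ₗ Bal.map (RHom.id P) δ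

theorem coact_mk {N : LMod D.I K} (δ : LHom N (Atens N)) (P : RMod D.I K) (p : P.carrier)
    (y : N.carrier) :
    coact δ P (Bal.mk p y) = assoc P N (Bal.mk (N := Atens N) p (δ.lin y)) :=
  congrArg (assoc P N) (Bal.map_mk (RHom.id P) δ p y)

theorem Atens_hom_ext {P : RMod D.I K} {N : LMod D.I K} {X : Type u} [AddCommGroup X] [Module K X]
    {f g : Bal P (Atens N) →ₗ[K] X}
    (h : ∀ x a y, f (Bal.mk (N := Atens N) x (Bal.mk (M := algR D K) a y))
      = g (Bal.mk (N := Atens N) x (Bal.mk (M := algR D K) a y))) : f = g :=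
  Bal.hom_ext fun x => LinearMap.congr_fun (Bal.hom_ext (f := f ∘ₗ Bal.mkLin P (Atens N) x)
    (g := g ∘ₗ Bal.mkLin P (Atens N) x) (h x))

theorem tensA_hom_ext {P : RMod D.I K} {N : LMod D.I K} {X : Type u} [AddCommGroup X] [Module K X]
    {f g : Bal (tensA P) N →ₗ[K] X}
    (h : ∀ x a y, f (Bal.mk (M := tensA P) (Bal.mk (N := algL D K) x a) y)
      = g (Bal.mk (M := tensA P) (Bal.mk (N := algL D K) x a) y)) : f = g :=
  Bal.hom_ext fun x y => LinearMap.congr_fun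
    (Bal.hom_ext (f := f ∘ₗ (Bal.mkLin (tensA P) N).flip y)
      (g := g ∘ₗ (Bal.mkLin (tensA P) N).flip y) fun x a => h x a y) x

/-- Naturality of the rebracketing in the left factor. -/
theorem assoc_rmap {P P' : RMod D.I K} (p : RHom P P') (N : LMod D.I K)
    (z : Bal P (Atens N)) :
    rmap (tensAMap p) N (assoc P N z) = assoc P' N (rmap p (Atens N) z) := by
  refine LinearMap.congr_fun (f := rmap (tensAMap p) N ∘ₗ assoc P N)
    (g := assoc P' N ∘ₗ rmap p (Atens N)) (Atens_hom_ext fun x a y => ?_) z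
  rw [LinearMap.comp_apply, LinearMap.comp_apply, rmap_mk, assoc_mk, assoc_mk, rmap_mk]
  exact congrArg (fun w => Bal.mk (M := tensA P') w y)
    (Bal.map_mk p (LHom.id (algL D K)) x a)

/-- The coaction acts on N alone, so it commutes with every map of the left factor. This is what
moves an operation on the first factors past later applications of δ. -/
theorem coact_rmap {N : LMod D.I K} (δ : LHom N (Atens N)) {P P' : RMod D.I K} (p : RHom P P')
    (z : Bal P N) : rmap (tensAMap p) N (coact δ P z) = coact δ P' (rmap p N z) := by
  induction z using Bal.induction with
  | zero => simp
  | add z w hz hw => simp only [map_add, hz, hw]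
  | mk x y => rw [coact_mk, assoc_rmap, rmap_mk, rmap_mk, coact_mk]

/-- The maps `1 ⊗ Δ_k : M ⊗ N → (M ⊗ A_K ⊗ ⋯ ⊗ A_K) ⊗ N`, built one factor at a time. -/
def iterCoact {N : LMod D.I K} (δ : LHom N (Atens N)) (M : RMod D.I K) :
    (k : ℕ) → Bal M N →ₗ[K] Bal (S M k) N
  | 0 => LinearMap.id
  | k + 1 => coact δ (S M k) ∘ₗ iterCoact δ M k

theorem iterCoact_succ {N : LMod D.I K} (δ : LHom N (Atens N)) (M : RMod D.I K) (k : ℕ)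
    (z : Bal M N) : iterCoact δ M (k + 1) z = coact δ (S M k) (iterCoact δ M k z) := rfl

theorem assoc_lmap (P : RMod D.I K) {N N' : LMod D.I K} (f : LHom N N') (z : Bal P (Atens N)) :
    assoc P N' (Bal.map (RHom.id P) (AtensMap f) z)
      = Bal.map (RHom.id (tensA P)) f (assoc P N z) := by
  refine LinearMap.congr_fun (f := assoc P N' ∘ₗ Bal.map (RHom.id P) (AtensMap f))
    (g := Bal.map (RHom.id (tensA P)) f ∘ₗ assoc P N) (Atens_hom_ext fun x a y => ?_) z
  rw [LinearMap.comp_apply, LinearMap.comp_apply, Bal.map_mk, assoc_mk, Bal.map_mk]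
  refine Eq.trans ?_ (assoc_mk P N' x a (f.lin y))
  exact congrArg (fun t => assoc P N' (Bal.mk (N := Atens N') x t))
    (Bal.map_mk (RHom.id (algR D K)) f a y)

/-- `T` grows by replacing N with A ⊗ N, so the induction lets N vary and uses the previous case at
the map 1 ⊗ f. -/
theorem rebracket_TMap (M : RMod D.I K) (k : ℕ) : ∀ {N N' : LMod D.I K} (f : LHom N N')
    (z : Bal M (T k N)), rebracket M k N' (Bal.map (RHom.id M) (TMap k f) z)
      = Bal.map (RHom.id (S M k)) f (rebracket M k N z) := by
  induction k with
  | zero => intro N N' f z; rfl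
  | succ k ih =>
    intro N N' f z
    exact (congrArg (assoc (S M k) N') (ih (AtensMap f) z)).trans (assoc_lmap (S M k) f _)

/-- The box differential first forms all of Δ_k and then rebrackets, whereas `iterCoact` rebrackets
after each δ. The second form is a composite of coactions, to which naturality applies one step at a
time; the later arguments about sums use only that form. -/
theorem rebracket_Delta {N : LMod D.I K} (δ : LHom N (Atens N)) (M : RMod D.I K) (k : ℕ)
    (z : Bal M N) :
    rebracket M k N (Bal.map (RHom.id M) (Delta δ k) z) = iterCoact δ M k z := by
  induction k generalizing z with
  | zero => exact rmap_id z
  | succ k ih =>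
    rw [iterCoact_succ, ← ih]
    exact (congrArg (rebracket M (k + 1) N) (lmap_comp M (TMap k δ) (Delta δ k) z)).trans
      (congrArg (assoc (S M k) N) (rebracket_TMap M k δ _))

/-- The term `(f_{k+1} ⊗ 1) (1 ⊗ Δ_k)`. -/
def boxTerm {M M' : RMod D.I K} (f : Ops M M') {N : LMod D.I K} (δ : LHom N (Atens N)) (k : ℕ) :
    Bal M N →ₗ[K] Bal M' N :=
  rmap (f k) N ∘ₗ iterCoact δ M k

theorem boxTerm_apply {M M' : RMod D.I K} (f : Ops M M') {N : LMod D.I K}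
    (δ : LHom N (Atens N)) (k : ℕ) (z : Bal M N) :
    boxTerm f δ k z = rmap (f k) N (iterCoact δ M k z) := rfl

theorem box_d (M : AData D K) (N : DData D K) :
    (box M N).d = locSum (boxTerm M.m N.δ) := by
  change locSum _ = _
  congr 1
  funext k
  refine LinearMap.ext fun z => ?_
  exact congrArg (rmap (M.m k) N.toLMod) (rebracket_Delta N.δ M.toRMod k z)

/-! ### Pure tensors -/

/-- A pure tensor carries an infinite sequence of which only the first n entries matter, so the rest
may be altered freely. Appending a factor then becomes an update of the sequence at n. -/
theorem pure_congr {M : RMod D.I K} (x : M.carrier) {a b : ℕ → Ext D K} {n : ℕ}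
    (h : ∀ t < n, a t = b t) : pure x a n = pure x b n := by
  induction n with
  | zero => rfl
  | succ n ih =>
    change Bal.mk (M := S M n) (N := algL D K) (pure x a n) (a n)
      = Bal.mk (M := S M n) (N := algL D K) (pure x b n) (b n)
    rw [ih fun t ht => h t (ht.trans n.lt_succ_self), h n n.lt_succ_self]

theorem pure_update {M : RMod D.I K} (x : M.carrier) (a : ℕ → Ext D K) (n : ℕ) (b : Ext D K) :
    pure x (Function.update a n b) (n + 1)
      = Bal.mk (M := S M n) (N := algL D K) (pure x a n) b := by
  change Bal.mk (M := S M n) (N := algL D K) (pure x (Function.update a n b) n)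
    (Function.update a n b n) = _
  rw [Function.update_self, pure_congr x fun t ht => Function.update_of_ne ht.ne b a]

/-- A pure tensor whose entries lie in spans is a combination of pure tensors of the
generators. -/
theorem pure_mem_span {M : RMod D.I K} {X : Set M.carrier} {Y : ℕ → Set (Ext D K)}
    {x : M.carrier} (hx : x ∈ Submodule.span K X) {a : ℕ → Ext D K} {n : ℕ}
    (ha : ∀ t < n, a t ∈ Submodule.span K (Y t)) :
    pure x a n ∈ Submodule.span K
      {p | ∃ x' ∈ X, ∃ b : ℕ → Ext D K, (∀ t < n, b t ∈ Y t) ∧ p = pure x' b n} := by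
  induction n with
  | zero =>
    refine Submodule.span_mono (fun x' hx' => ?_) hx
    exact ⟨x', hx', a, fun t ht => absurd ht t.not_lt_zero, rfl⟩
  | succ n ih =>
    have h1 := ih fun t ht => ha t (ht.trans n.lt_succ_self)
    have h2 := ha n n.lt_succ_self
    change Bal.mkLin (S M n) (algL D K) (pure x a n) (a n) ∈ _
    refine Submodule.span_induction (p := fun p _ => Bal.mkLin (S M n) (algL D K) p (a n) ∈ _)
      ?_ ?_ ?_ ?_ h1
    · rintro p ⟨x', hx', b, hb, rfl⟩
      refine Submodule.span_induction
        (p := fun c _ => Bal.mkLin (S M n) (algL D K) (pure x' b n) c ∈ _) ?_ ?_ ?_ ?_ h2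
      · intro c hc
        refine Submodule.subset_span ⟨x', hx', Function.update b n c, fun t ht => ?_,
          (pure_update x' b n c).symm⟩
        rcases Nat.lt_succ_iff_lt_or_eq.1 ht with ht | rfl
        · rw [Function.update_of_ne ht.ne]; exact hb t ht
        · rw [Function.update_self]; exact hc
      · rw [map_zero]; exact Submodule.zero_mem _
      · intro c c' _ _ h h'; rw [map_add]; exact Submodule.add_mem _ h h'
      · intro r c _ h; rw [map_smul]; exact Submodule.smul_mem _ r h
    · rw [map_zero, LinearMap.zero_apply]; exact Submodule.zero_mem _
    · intro c c' _ _ h h'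
      rw [map_add, LinearMap.add_apply]; exact Submodule.add_mem _ h h'
    · intro r c _ h
      rw [map_smul, LinearMap.smul_apply]; exact Submodule.smul_mem _ r h

/-- Pure tensors of generators generate. -/
theorem span_pure {M : RMod D.I K} {X : Set M.carrier} {Y : Set (Ext D K)}
    (hX : Submodule.span K X = ⊤) (hY : Submodule.span K Y = ⊤) (n : ℕ) :
    Submodule.span K {p : (S M n).carrier |
      ∃ x ∈ X, ∃ a : ℕ → Ext D K, (∀ t < n, a t ∈ Y) ∧ p = pure x a n} = ⊤ := by
  induction n with
  | zero =>
    refine top_unique (hX.symm.le.trans (Submodule.span_mono fun x hx => ?_))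
    exact ⟨x, hx, 0, fun t ht => absurd ht t.not_lt_zero, rfl⟩
  | succ n ih =>
    refine top_unique ((span_mk (P := S M n) (N := algL D K) ih hY).symm.le.trans
      (Submodule.span_mono ?_))
    rintro z ⟨p, ⟨x, hx, a, ha, rfl⟩, c, hc, rfl⟩
    refine ⟨x, hx, Function.update a n c, fun t ht => ?_, (pure_update x a n c).symm⟩
    rcases Nat.lt_succ_iff_lt_or_eq.1 ht with ht | rfl
    · rw [Function.update_of_ne ht.ne]; exact ha t ht
    · rw [Function.update_self]; exact hc

theorem lin_ext_pure {M : RMod D.I K} {X : Type*} [AddCommGroup X] [Module K X] {n : ℕ}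
    {f g : (S M n).carrier →ₗ[K] X} (h : ∀ x a, f (pure x a n) = g (pure x a n)) : f = g := by
  refine LinearMap.ext_on (span_pure (M := M) (X := Set.univ) (Y := Set.univ)
    Submodule.span_univ Submodule.span_univ n) ?_
  rintro _ ⟨x, -, a, -, rfl⟩
  exact h x a

end Coaction

/-! ### Composition of families and the inner terms, as linear maps evaluated on 1 ⊗ Δ_n. -/

section Operations

variable {G : Type v} [AddCommGroupWithOne G] [DecidableEq G] {D : DGAlg.{u} G}
variable {K : Type u} [CommRing K] [Algebra (ZMod 2) K]

theorem add_self_eq_zero_of_algebra (K : Type*) [CommRing K] [Algebra (ZMod 2) K] {X : Type*}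
    [AddCommGroup X] [Module K X] (x : X) : x + x = 0 := by
  have h : (2 : K) = 0 := by
    have := map_ofNat (algebraMap (ZMod 2) K) 2
    rw [← this]
    exact map_zero (algebraMap (ZMod 2) K)
  rw [← two_smul K x, h, zero_smul]

/-- The element `1 ⊗ Δ_n (x ⊗ y)` is a combination of tensors `x ⊗ a₀ ⊗ ⋯ ⊗ a_{n-1} ⊗ y'` that
have any property propagated by `δ`. -/
theorem iterCoact_mem_span {M : RMod D.I K} {N : LMod D.I K} (δ : LHom N (Atens N))
    (Q : ℕ → (ℕ → Ext D K) → N.carrier → Prop)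
    (hQ : ∀ n a y, Q n a y → δ.lin y ∈ Submodule.span K
      {t | ∃ b y', Q (n + 1) (Function.update a n b) y' ∧ t = Bal.mk (M := algR D K) b y'})
    (x : M.carrier) {y : N.carrier} (hy : Q 0 0 y) (n : ℕ) :
    iterCoact δ M n (Bal.mk x y) ∈ Submodule.span K
      {z | ∃ a y', Q n a y' ∧ z = Bal.mk (pure x a n) y'} := by
  induction n with
  | zero => exact Submodule.subset_span ⟨0, y, hy, rfl⟩
  | succ n ih =>
    rw [iterCoact_succ]
    refine Submodule.span_induction (p := fun z _ => coact δ (S M n) z ∈ _) ?_ ?_ ?_ ?_ ih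
    · rintro _ ⟨a, y, h, rfl⟩
      rw [coact_mk]
      change (assoc (S M n) N ∘ₗ Bal.mkLin (S M n) (Atens N) (pure x a n)) (δ.lin y) ∈ _
      refine Submodule.span_induction (p := fun t _ => (assoc (S M n) N ∘ₗ
        Bal.mkLin (S M n) (Atens N) (pure x a n)) t ∈ _) ?_ ?_ ?_ ?_ (hQ n a y h)
      · rintro _ ⟨b, y', h', rfl⟩
        refine Submodule.subset_span ⟨_, y', h', ?_⟩
        rw [pure_update]
        exact assoc_mk (S M n) N (pure x a n) b y'
      · rw [map_zero]; exact Submodule.zero_mem _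
      · intro c c' _ _ h h'; rw [map_add]; exact Submodule.add_mem _ h h'
      · intro r c _ h; rw [map_smul]; exact Submodule.smul_mem _ r h
    · rw [map_zero]; exact Submodule.zero_mem _
    · intro c c' _ _ h h'; rw [map_add]; exact Submodule.add_mem _ h h'
    · intro r c _ h; rw [map_smul]; exact Submodule.smul_mem _ r h

/-- The map `p ⊗ 1 ⊗ ⋯ ⊗ 1`. -/
def shift {M M' : RMod D.I K} {j j' : ℕ} (p : RHom (S M j) (S M' j')) :
    (i : ℕ) → RHom (S M (j + i)) (S M' (j' + i))
  | 0 => p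
  | i + 1 => tensAMap (shift p i)

theorem shift_pure {M M' : RMod D.I K} {j j' : ℕ} {p : RHom (S M j) (S M' j')} {x : M.carrier}
    {x' : M'.carrier} {a a' : ℕ → Ext D K} (h : p.lin (pure x a j) = pure x' a' j')
    (ha : ∀ t, a (j + t) = a' (j' + t)) (i : ℕ) :
    (shift p i).lin (pure x a (j + i)) = pure x' a' (j' + i) := by
  induction i with
  | zero => exact h
  | succ i ih =>
    refine (Bal.map_mk (shift p i) (LHom.id (algL D K)) (pure x a (j + i)) (a (j + i))).trans ?_
    rw [ih, ha i]
    rfl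

/-- An identity valid after j coactions on one side and j' on the other persists under further
coactions, because each of them is natural in the left factor. -/
theorem shift_iterCoact {M M' : RMod D.I K} {N : LMod D.I K} (δ : LHom N (Atens N)) {j j' : ℕ}
    {p : RHom (S M j) (S M' j')} {z : Bal M N} {w : Bal M' N}
    (h : rmap p N (iterCoact δ M j z) = iterCoact δ M' j' w) (i : ℕ) :
    rmap (shift p i) N (iterCoact δ M (j + i) z) = iterCoact δ M' (j' + i) w := by
  induction i with
  | zero => exact h
  | succ i ih =>
    exact (coact_rmap δ (shift p i) (iterCoact δ M (j + i) z)).trans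
      (congrArg (coact δ (S M' (j' + i))) ih)

/-- The same propagation for a relation whose two terms start from different tensor lengths. The
type D equation has this shape, comparing one coaction with two. -/
theorem shift_iterCoact_add {M M' : RMod D.I K} {N : LMod D.I K} (δ : LHom N (Atens N))
    {j l j' : ℕ} {p : RHom (S M j) (S M' j')} {q : RHom (S M l) (S M' j')} {z : Bal M N}
    (h : rmap p N (iterCoact δ M j z) + rmap q N (iterCoact δ M l z) = 0) (i : ℕ) :
    rmap (shift p i) N (iterCoact δ M (j + i) z)
      + rmap (shift q i) N (iterCoact δ M (l + i) z) = 0 := by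
  induction i with
  | zero => exact h
  | succ i ih =>
    refine (congrArg₂ (· + ·) (coact_rmap δ (shift p i) (iterCoact δ M (j + i) z))
      (coact_rmap δ (shift q i) (iterCoact δ M (l + i) z))).trans ?_
    refine (map_add (coact δ (S M' (j' + i))) _ _).symm.trans ?_
    rw [ih]
    exact map_zero _

/-! ### Compositions of families -/

/-- Relations between families are stated on pure tensors, but 1 ⊗ Δ_n takes values in sums of
these. A genuine linear map with the prescribed values on pure tensors is therefore needed. On 1 ⊗
Δ_n the map f_j consumes the first j coactions and leaves n - j of them to g. -/
theorem exists_starOp {M M' M'' : RMod D.I K} (g : Ops M' M'') (f : Ops M M') (n : ℕ) :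
    ∃ Λ : RHom (S M n) M'', (∀ x a, Λ.lin (pure x a n) = star g f n x a) ∧
      ∀ (N : LMod D.I K) (δ : LHom N (Atens N)) (z : Bal M N), rmap Λ N (iterCoact δ M n z)
        = ∑ j ∈ Finset.range (n + 1), boxTerm g δ (n - j) (boxTerm f δ j z) := by
  have key : ∀ j ∈ Finset.range (n + 1), ∃ Λ : RHom (S M n) M'',
      (∀ x a, Λ.lin (pure x a n) = ev g (n - j) (ev f j x a) fun t => a (j + t)) ∧
      ∀ (N : LMod D.I K) (δ : LHom N (Atens N)) (z : Bal M N), rmap Λ N (iterCoact δ M n z)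
        = boxTerm g δ (n - j) (boxTerm f δ j z) := by
    intro j hj
    obtain ⟨i, rfl⟩ := Nat.exists_eq_add_of_le (Nat.lt_succ_iff.1 (Finset.mem_range.1 hj))
    rw [Nat.add_sub_cancel_left]
    -- With f_j viewed as a map into `S M' 0`, its shift lands in `S M' (0 + i)`, and `0 + i` is not
    -- `i` by definition. The index of g is generalised to avoid a cast.
    have h0 : ∀ i', i' = 0 + i → ∃ Λ : RHom (S M (j + i)) M'',
        (∀ x a, Λ.lin (pure x a (j + i)) = ev g i' (ev f j x a) fun t => a (j + t)) ∧
        ∀ (N : LMod D.I K) (δ : LHom N (Atens N)) (z : Bal M N),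
          rmap Λ N (iterCoact δ M (j + i) z) = boxTerm g δ i' (boxTerm f δ j z) := by
      rintro _ rfl
      refine ⟨(g (0 + i)).comp (shift (M' := M') (j' := 0) (f j) i), fun x a => ?_,
        fun N δ z => ?_⟩
      · rw [RHom.comp_lin, shift_pure (M' := M') (j' := 0) (x' := ev f j x a)
          (a' := fun t => a (j + t)) rfl (fun t => by rw [Nat.zero_add]) i]
        rfl
      · rw [rmap_comp, shift_iterCoact (M' := M') (j' := 0) δ (w := boxTerm f δ j z) rfl i]
        rfl
    exact h0 i (Nat.zero_add i).symm
  choose! Λ h1 h2 using key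
  refine ⟨∑ j ∈ Finset.range (n + 1), Λ j, fun x a => ?_, fun N δ z => ?_⟩
  · rw [RHom.sum_lin]
    exact Finset.sum_congr rfl fun j hj => h1 j hj x a
  · rw [rmap_sum]
    exact Finset.sum_congr rfl fun j hj => h2 j hj N δ z

/-- The family of maps `∑ g_i (f_j ⊗ 1 ⊗ ⋯ ⊗ 1)`. -/
def starOp {M M' M'' : RMod D.I K} (g : Ops M' M'') (f : Ops M M') : Ops M M'' :=
  fun n => (exists_starOp g f n).choose

theorem ev_starOp {M M' M'' : RMod D.I K} (g : Ops M' M'') (f : Ops M M') (n : ℕ)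
    (x : M.carrier) (a : ℕ → Ext D K) : ev (starOp g f) n x a = star g f n x a :=
  (exists_starOp g f n).choose_spec.1 x a

theorem boxTerm_starOp {M M' M'' : RMod D.I K} (g : Ops M' M'') (f : Ops M M') {N : LMod D.I K}
    (δ : LHom N (Atens N)) (n : ℕ) (z : Bal M N) : boxTerm (starOp g f) δ n z
      = ∑ j ∈ Finset.range (n + 1), boxTerm g δ (n - j) (boxTerm f δ j z) :=
  (exists_starOp g f n).choose_spec.2 N δ z

/-! ### The operations of the algebra on the factors `A_K` -/

/-- The multiplication `(P ⊗ A_K) ⊗ A_K → P ⊗ A_K`. -/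
def mulLastLin (P : RMod D.I K) : Bal (tensA P) (algL D K) →ₗ[K] Bal P (algL D K) :=
  Bal.lift
    (LinearMap.mk₂ K (fun t b => Bal.map (RHom.id P) (mulR b) t)
      (fun t t' b => map_add _ t t') (fun r t b => map_smul _ r t)
      (fun t b b' => LinearMap.congr_fun (f := Bal.map (RHom.id P) (mulR (b + b')))
        (g := Bal.map (RHom.id P) (mulR b) + Bal.map (RHom.id P) (mulR b'))
        (Bal.hom_ext fun x a => by
          rw [LinearMap.add_apply, Bal.map_mk, Bal.map_mk, Bal.map_mk, mulR_lin, mulR_lin,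
            mulR_lin, mul_add]
          exact Bal.mk_add_right _ _ _) t)
      (fun r t b => LinearMap.congr_fun (f := Bal.map (RHom.id P) (mulR (r • b)))
        (g := r • Bal.map (RHom.id P) (mulR b))
        (Bal.hom_ext fun x a => by
          rw [LinearMap.smul_apply, Bal.map_mk, Bal.map_mk, mulR_lin, mulR_lin,
            mul_smul_comm]
          exact Bal.mk_smul_right _ _ _) t))
    fun t e b => by
      refine LinearMap.congr_fun (f := Bal.map (RHom.id P) (mulR b) ∘ₗ
          Bal.map (RHom.id P) (mulR (inc D K e)))
        (g := Bal.map (RHom.id P) (mulR (inc D K e * b))) (Bal.hom_ext fun x a => ?_) t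
      rw [LinearMap.comp_apply, Bal.map_mk, Bal.map_mk, Bal.map_mk, mulR_lin, mulR_lin, mulR_lin,
        mul_assoc]
      rfl

theorem mulLastLin_mk (P : RMod D.I K) (p : P.carrier) (a b : Ext D K) :
    mulLastLin P (Bal.mk (M := tensA P) (N := algL D K) (Bal.mk (N := algL D K) p a) b)
      = Bal.mk (N := algL D K) p (a * b) := by
  exact Bal.map_mk (RHom.id P) (mulR b) p a

/-- The multiplication `(P ⊗ A_K) ⊗ A_K → P ⊗ A_K` as a map of right modules. -/
def mulLast (P : RMod D.I K) : RHom (tensA (tensA P)) (tensA P) where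
  lin := mulLastLin P
  map_act e z := by
    refine LinearMap.congr_fun (f := mulLastLin P ∘ₗ (tensA (tensA P)).act e)
      (g := (tensA P).act e ∘ₗ mulLastLin P) (tensA_hom_ext (N := algL D K) fun x a b => ?_) z
    refine (congrArg (mulLastLin P) (tensA_act (tensA P) e.unop
      (Bal.mk (N := algL D K) x a : (tensA P).carrier) b)).trans ?_
    refine (mulLastLin_mk P x a (b * inc D K e.unop)).trans (Eq.symm ?_)
    refine (congrArg ((tensA P).act e) (mulLastLin_mk P x a b)).trans ?_
    refine (tensA_act P e.unop x (a * b)).trans ?_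
    rw [mul_assoc]

theorem mulLast_mk (P : RMod D.I K) (p : P.carrier) (a b : Ext D K) :
    (mulLast P).lin (Bal.mk (M := tensA P) (N := algL D K) (Bal.mk (N := algL D K) p a) b)
      = Bal.mk (N := algL D K) p (a * b) := mulLastLin_mk P p a b

theorem mu1_inc_mul (e : D.I) (x : Ext D K) : mu1 D K (inc D K e * x) = inc D K e * mu1 D K x := by
  induction x using TensorProduct.induction_on with
  | zero => simp
  | tmul r a => simp [mu1, inc_apply, D.leibniz, D.d_I e e.2]
  | add x y hx hy => rw [mul_add, map_add, hx, hy, map_add, mul_add]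

/-- The differential `μ₁` as a map of left modules. -/
def mu1L : LHom (algL D K) (algL D K) := ⟨mu1 D K, fun e x => mu1_inc_mul e x⟩

/-- The map `1 ⊗ μ₁` on `P ⊗ A_K`. -/
def mu1Last (P : RMod D.I K) : RHom (tensA P) (tensA P) where
  lin := Bal.map (RHom.id P) mu1L
  map_act e z := by
    refine LinearMap.congr_fun (f := Bal.map (RHom.id P) mu1L ∘ₗ (tensA P).act e)
      (g := (tensA P).act e ∘ₗ Bal.map (RHom.id P) mu1L) (Bal.hom_ext fun x a => ?_) z
    refine (congrArg (Bal.map (RHom.id P) mu1L) (tensA_act P e.unop x a)).trans ?_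
    refine (Bal.map_mk (RHom.id P) mu1L x (a * inc D K e.unop)).trans (Eq.symm ?_)
    refine (congrArg ((tensA P).act e) (Bal.map_mk (RHom.id P) mu1L x a)).trans ?_
    refine (tensA_act P e.unop x (mu1 D K a)).trans ?_
    exact congrArg (fun b => Bal.mk (N := algL D K) x b) (mu1_mul_inc a e.unop).symm

theorem mu1Last_mk (P : RMod D.I K) (p : P.carrier) (a : Ext D K) :
    (mu1Last P).lin (Bal.mk (N := algL D K) p a) = Bal.mk (N := algL D K) p (mu1 D K a) :=
  Bal.map_mk _ _ _ _

/-- The structure equation of a type D structure. -/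
def DRel {N : LMod D.I K} (δ : LHom N (Atens N)) : Prop :=
  ∀ y, mu2N N ((AtensMap δ).lin (δ.lin y)) + Bal.map mu1R (LHom.id N) (δ.lin y) = 0

theorem assoc_mu1R (P : RMod D.I K) (N : LMod D.I K) (p : P.carrier) (t : Bal (algR D K) N) :
    assoc P N (Bal.mk (N := Atens N) p (Bal.map mu1R (LHom.id N) t))
      = rmap (mu1Last P) N (assoc P N (Bal.mk (N := Atens N) p t)) := by
  refine LinearMap.congr_fun
    (f := assoc P N ∘ₗ Bal.mkLin P (Atens N) p ∘ₗ Bal.map mu1R (LHom.id N))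
    (g := rmap (mu1Last P) N ∘ₗ assoc P N ∘ₗ Bal.mkLin P (Atens N) p)
    (Bal.hom_ext fun a y => ?_) t
  refine (congrArg (fun t => assoc P N (Bal.mk (N := Atens N) p t))
    (Bal.map_mk mu1R (LHom.id N) a y)).trans ((assoc_mk P N p _ y).trans (Eq.symm ?_))
  refine (congrArg (rmap (mu1Last P) N) (assoc_mk P N p a y)).trans ?_
  exact (rmap_mk _ _ _).trans (congrArg (fun w => Bal.mk (M := tensA P) w y) (mu1Last_mk P p a))

theorem assoc_mu2N (P : RMod D.I K) (N : LMod D.I K) (p : P.carrier) (a : Ext D K)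
    (s : Bal (algR D K) N) :
    assoc P N (Bal.mk (N := Atens N) p (mu2N N (Bal.mk (M := algR D K) (N := Atens N) a s)))
      = rmap (mulLast P) N (assoc (tensA P) N
        (Bal.mk (M := tensA P) (N := Atens N) (Bal.mk (N := algL D K) p a) s)) := by
  refine LinearMap.congr_fun
    (f := assoc P N ∘ₗ Bal.mkLin P (Atens N) p ∘ₗ mu2N N ∘ₗ Bal.mkLin (algR D K) (Atens N) a)
    (g := rmap (mulLast P) N ∘ₗ assoc (tensA P) N ∘ₗ
      Bal.mkLin (tensA P) (Atens N) (Bal.mk (N := algL D K) p a))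
    (Bal.hom_ext fun b y => ?_) s
  refine (congrArg (fun t => assoc P N (Bal.mk (N := Atens N) p t))
    (mu2N_mk N a b y)).trans ((assoc_mk P N p _ y).trans (Eq.symm ?_))
  refine (congrArg (rmap (mulLast P) N)
    (assoc_mk (tensA P) N (Bal.mk (N := algL D K) p a) b y)).trans ?_
  exact (rmap_mk _ _ _).trans (congrArg (fun w => Bal.mk (M := tensA P) w y) (mulLast_mk P p a b))

/-- Rebracketing carries μ₁ ⊗ 1 and μ₂ ⊗ 1 on the A-side of N to the maps acting on the last algebra
factors of P ⊗ A and P ⊗ A ⊗ A. The type D equation can thus be read inside P ⊗ N for every P. -/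
theorem coact_rel {N : LMod D.I K} {δ : LHom N (Atens N)} (hδ : DRel δ) (P : RMod D.I K)
    (z : Bal P N) : rmap (mu1Last P) N (coact δ P z)
      + rmap (mulLast P) N (coact δ (tensA P) (coact δ P z)) = 0 := by
  have h2 : ∀ p t, assoc P N (Bal.mk (N := Atens N) p (mu2N N ((AtensMap δ).lin t)))
      = rmap (mulLast P) N (coact δ (tensA P) (assoc P N (Bal.mk (N := Atens N) p t))) := by
    intro p t
    refine LinearMap.congr_fun
      (f := assoc P N ∘ₗ Bal.mkLin P (Atens N) p ∘ₗ mu2N N ∘ₗ (AtensMap δ).lin)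
      (g := rmap (mulLast P) N ∘ₗ coact δ (tensA P) ∘ₗ assoc P N ∘ₗ Bal.mkLin P (Atens N) p)
      (Bal.hom_ext fun a y => ?_) t
    refine (congrArg (fun t => assoc P N (Bal.mk (N := Atens N) p (mu2N N t)))
      (Bal.map_mk (RHom.id (algR D K)) δ a y)).trans ((assoc_mu2N P N p a (δ.lin y)).trans ?_)
    refine congrArg (rmap (mulLast P) N) (Eq.symm ?_)
    exact (congrArg (coact δ (tensA P)) (assoc_mk P N p a y)).trans (coact_mk δ (tensA P) _ y)
  refine LinearMap.congr_fun (f := rmap (mu1Last P) N ∘ₗ coact δ P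
    + rmap (mulLast P) N ∘ₗ coact δ (tensA P) ∘ₗ coact δ P) (g := 0)
    (Bal.hom_ext fun p y => ?_) z
  change rmap (mu1Last P) N (coact δ P (Bal.mk p y))
      + rmap (mulLast P) N (coact δ (tensA P) (coact δ P (Bal.mk p y))) = 0
  rw [coact_mk, ← assoc_mu1R, ← h2, ← map_add, ← Bal.mk_add_right, add_comm]
  exact (congrArg (fun t => assoc P N (Bal.mk (N := Atens N) p t)) (hδ y)).trans (by
    rw [Bal.mk_zero_right, map_zero])

/-- The two maps are produced together because their relation is the point. When k is the last
position the relation is `coact_rel` for P = `S M k`; the factors after it are appended by `shift`.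
-/
theorem exists_mu1At (M : RMod D.I K) {n k : ℕ} (hk : k < n) :
    ∃ (U : RHom (S M n) (S M n)) (C : RHom (S M (n + 1)) (S M n)),
      (∀ x a, U.lin (pure x a n) = pure x (Function.update a k (mu1 D K (a k))) n) ∧
      (∀ x a, C.lin (pure x a (n + 1)) = pure x (contract a k) n) ∧
      ∀ (N : LMod D.I K) (δ : LHom N (Atens N)), DRel δ → ∀ z : Bal M N,
        rmap U N (iterCoact δ M n z) + rmap C N (iterCoact δ M (n + 1) z) = 0 := by
  obtain ⟨i, rfl⟩ := Nat.exists_eq_add_of_le (Nat.succ_le_of_lt hk)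
  -- The shifted multiplication has source length `k + 2 + i`, which equals `k + 1 + i + 1` only
  -- propositionally, so this length is generalised.
  have h0 : ∀ m, m = k + 2 + i → ∃ (U : RHom (S M (k + 1 + i)) (S M (k + 1 + i)))
      (C : RHom (S M m) (S M (k + 1 + i))),
      (∀ x a, U.lin (pure x a (k + 1 + i))
        = pure x (Function.update a k (mu1 D K (a k))) (k + 1 + i)) ∧
      (∀ x a, C.lin (pure x a m) = pure x (contract a k) (k + 1 + i)) ∧
      ∀ (N : LMod D.I K) (δ : LHom N (Atens N)), DRel δ → ∀ z : Bal M N,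
        rmap U N (iterCoact δ M (k + 1 + i) z) + rmap C N (iterCoact δ M m z) = 0 := by
    rintro _ rfl
    refine ⟨shift (M := M) (M' := M) (j := k + 1) (j' := k + 1) (mu1Last (S M k)) i,
      shift (M := M) (M' := M) (j := k + 2) (j' := k + 1) (mulLast (S M k)) i, fun x a => ?_,
      fun x a => ?_, fun N δ hδ z => ?_⟩
    · refine shift_pure (M := M) (M' := M) (j := k + 1) (j' := k + 1)
        ((mu1Last_mk (S M k) _ _).trans (pure_update x a k _).symm) (fun t => ?_) i
      rw [Function.update_of_ne (by omega)]
    · refine shift_pure (M := M) (M' := M) (j := k + 2) (j' := k + 1)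
        ((mulLast_mk (S M k) (pure x a k) (a k) (a (k + 1))).trans ?_) (fun t => ?_) i
      · refine Eq.symm ?_
        refine congrArg₂ (fun p b => Bal.mk (M := S M k) (N := algL D K) p b)
          (pure_congr x fun t ht => ?_) ?_
        · exact if_pos ht
        · simp [contract]
      -- Beyond position k the contracted sequence is the original one shifted by one, which matches
      -- source length k + 2 with target length k + 1.
      · rw [contract, if_neg (by omega), if_neg (by omega)]
        congr 1; omega
    · exact shift_iterCoact_add (M := M) (M' := M) (j := k + 1) (l := k + 2) (j' := k + 1) δ
        (coact_rel hδ (S M k) (iterCoact δ M k z)) i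
  exact h0 _ (by omega)

/-- The map applying `μ₁` to the factor at position `k`. -/
def mu1At (M : RMod D.I K) (n k : ℕ) : RHom (S M n) (S M n) :=
  if hk : k < n then (exists_mu1At M hk).choose else 0

theorem mu1At_pure {M : RMod D.I K} {n k : ℕ} (hk : k < n) (x : M.carrier) (a : ℕ → Ext D K) :
    (mu1At M n k).lin (pure x a n) = pure x (Function.update a k (mu1 D K (a k))) n := by
  rw [mu1At, dif_pos hk]
  exact (exists_mu1At M hk).choose_spec.choose_spec.1 x a

/-- The term `∑ f_n (1 ⊗ ⋯ ⊗ μ₁ ⊗ ⋯ ⊗ 1) Δ_n`. -/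
def mu1Term {M M' : RMod D.I K} (f : Ops M M') {N : LMod D.I K} (δ : LHom N (Atens N)) (n : ℕ) :
    Bal M N →ₗ[K] Bal M' N :=
  ∑ k ∈ Finset.range n, rmap ((f n).comp (mu1At M n k)) N ∘ₗ iterCoact δ M n

theorem mu1Term_apply {M M' : RMod D.I K} (f : Ops M M') {N : LMod D.I K}
    (δ : LHom N (Atens N)) (n : ℕ) (z : Bal M N) : mu1Term f δ n z
      = ∑ k ∈ Finset.range n, rmap ((f n).comp (mu1At M n k)) N (iterCoact δ M n z) := by
  rw [mu1Term, LinearMap.sum_apply]; rfl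

/-- In characteristic 2 the relation of `exists_mu1At` trades a product at position k of Δ_n for μ₁
at position k of Δ_{n-1}. The multiplication part at index n thus becomes the μ₁ part at index n -
1, which prepares the telescoping sum. -/
theorem exists_innerOp {M M' : RMod D.I K} (f : Ops M M') (n : ℕ) :
    ∃ Λ : RHom (S M n) M', (∀ x a, Λ.lin (pure x a n) = inner f n x a) ∧
      ∀ (N : LMod D.I K) (δ : LHom N (Atens N)), DRel δ → ∀ z : Bal M N,
        rmap Λ N (iterCoact δ M n z) = mu1Term f δ n z + mu1Term f δ (n - 1) z := by
  have hU : ∃ Λ : RHom (S M n) M', (∀ x a, Λ.lin (pure x a n)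
      = ∑ k ∈ Finset.range n, ev f n x (Function.update a k (mu1 D K (a k)))) ∧
      ∀ (N : LMod D.I K) (δ : LHom N (Atens N)) (z : Bal M N),
        rmap Λ N (iterCoact δ M n z) = mu1Term f δ n z := by
    refine ⟨∑ k ∈ Finset.range n, (f n).comp (mu1At M n k), fun x a => ?_, fun N δ z => ?_⟩
    · rw [RHom.sum_lin]
      refine Finset.sum_congr rfl fun k hk => ?_
      rw [RHom.comp_lin, mu1At_pure (Finset.mem_range.1 hk)]
      rfl
    · rw [rmap_sum, mu1Term_apply]
  have hC : ∃ Λ : RHom (S M n) M', (∀ x a, Λ.lin (pure x a n)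
      = ∑ k ∈ Finset.range (n - 1), ev f (n - 1) x (contract a k)) ∧
      ∀ (N : LMod D.I K) (δ : LHom N (Atens N)), DRel δ → ∀ z : Bal M N,
        rmap Λ N (iterCoact δ M n z) = mu1Term f δ (n - 1) z := by
    cases n with
    -- Here `n - 1` is 0 by truncated subtraction; no products occur and `mu1Term` at 0 is an empty
    -- sum, so both sides vanish.
    | zero =>
      refine ⟨0, fun x a => ?_, fun N δ _ z => ?_⟩
      · exact (RHom.zero_lin _).trans (Finset.sum_empty).symm
      · rw [rmap_zero, mu1Term_apply]; exact (Finset.sum_empty).symm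
    | succ n =>
      rw [Nat.add_sub_cancel]
      have hk : ∀ k ∈ Finset.range n, ∃ C : RHom (S M (n + 1)) (S M n),
          (∀ x a, C.lin (pure x a (n + 1)) = pure x (contract a k) n) ∧
          ∀ (N : LMod D.I K) (δ : LHom N (Atens N)), DRel δ → ∀ z : Bal M N,
          rmap (mu1At M n k) N (iterCoact δ M n z) = rmap C N (iterCoact δ M (n + 1) z) := by
        intro k hk
        have hk' := Finset.mem_range.1 hk
        have h := (exists_mu1At M hk').choose_spec
        refine ⟨h.choose, h.choose_spec.2.1, fun N δ hδ z => ?_⟩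
        have h' := h.choose_spec.2.2 N δ hδ z
        rw [mu1At, dif_pos hk']
        rw [eq_comm, ← sub_eq_zero, ← h', sub_eq_iff_eq_add, add_assoc, add_left_comm,
          add_self_eq_zero_of_algebra K, add_zero]
      choose! C h1 h2 using hk
      refine ⟨∑ k ∈ Finset.range n, (f n).comp (C k), fun x a => ?_, fun N δ hδ z => ?_⟩
      · rw [RHom.sum_lin]
        refine Finset.sum_congr rfl fun k hk => ?_
        rw [RHom.comp_lin, h1 k hk]
        rfl
      · rw [rmap_sum, mu1Term_apply]
        refine Finset.sum_congr rfl fun k hk => ?_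
        rw [rmap_comp, rmap_comp, h2 k hk N δ hδ]
  obtain ⟨Λ₁, h1, h1'⟩ := hU
  obtain ⟨Λ₂, h2, h2'⟩ := hC
  refine ⟨Λ₁ + Λ₂, fun x a => ?_, fun N δ hδ z => ?_⟩
  · rw [RHom.add_lin, h1, h2]; rfl
  · rw [rmap_add, h1', h2' N δ hδ]

/-- The family of maps `∑ f_i (1 ⊗ ⋯ ⊗ μ_j ⊗ ⋯ ⊗ 1)`. -/
def innerOp {M M' : RMod D.I K} (f : Ops M M') : Ops M M' :=
  fun n => (exists_innerOp f n).choose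

theorem ev_innerOp {M M' : RMod D.I K} (f : Ops M M') (n : ℕ) (x : M.carrier)
    (a : ℕ → Ext D K) : ev (innerOp f) n x a = inner f n x a :=
  (exists_innerOp f n).choose_spec.1 x a

theorem boxTerm_innerOp {M M' : RMod D.I K} (f : Ops M M') {N : LMod D.I K}
    {δ : LHom N (Atens N)} (hδ : DRel δ) (n : ℕ) (z : Bal M N) :
    boxTerm (innerOp f) δ n z = mu1Term f δ n z + mu1Term f δ (n - 1) z :=
  (exists_innerOp f n).choose_spec.2 N δ hδ z

/-- Pure tensors generate, so relations verified on them become equalities of families, to which the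
total map can be applied. -/
theorem Ops.ext_ev {M M' : RMod D.I K} {f g : Ops M M'} (h : ∀ n x a, ev f n x a = ev g n x a) :
    f = g :=
  funext fun n => RHom.ext (lin_ext_pure (h n))

end Operations

/-! ### Evaluation of pointwise finite sums. -/

section LocSum

open Filter

variable {K : Type u} [CommRing K]

/-- Finiteness at every vector is needed to exclude the default value 0 of `locSum`; the bound `hT`
concerns the given vector only. -/
theorem locSum_eq_sum {X Y : Type u} [AddCommGroup X] [Module K X] [AddCommGroup Y] [Module K Y]
    {φ : ℕ → X →ₗ[K] Y} (hφ : ∀ x, ∀ᶠ n in atTop, φ n x = 0) {x : X} {T : ℕ}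
    (hT : ∀ n ≥ T, φ n x = 0) : locSum φ x = ∑ n ∈ Finset.range T, φ n x := by
  have h : ∀ x, (Function.support fun k => φ k x).Finite := by
    intro x
    obtain ⟨T, hT⟩ := eventually_atTop.1 (hφ x)
    refine (Finset.range T).finite_toSet.subset fun n hn => ?_
    by_contra hn'
    exact hn (hT n (by simpa using hn'))
  rw [locSum, dif_pos h]
  refine finsum_eq_sum_of_support_subset _ fun n hn => ?_
  by_contra hn'
  exact hn (hT n (by simpa using hn'))

end LocSum

/-! ### Total maps: finiteness, composition, telescoping and degrees. -/

section Totals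

open Filter

variable {G : Type v} [AddCommGroupWithOne G] [DecidableEq G] {D : DGAlg.{u} G}
variable {K : Type u} [CommRing K] [Algebra (ZMod 2) K]

/-- The sum defining the total map of `f` is finite on every `x ⊗ y`. -/
def LocFinite {M M' : RMod D.I K} (f : Ops M M') {N : LMod D.I K} (δ : LHom N (Atens N)) : Prop :=
  ∀ (x : M.carrier) (y : N.carrier), ∃ T : ℕ, ∀ n ≥ T,
    (∀ a, ev f n x a = 0) ∨ iterCoact δ M n (Bal.mk x y) = 0

theorem OpsBounded.locFinite {M M' : RMod D.I K} {f : Ops M M'} (hf : OpsBounded f)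
    {N : LMod D.I K} (δ : LHom N (Atens N)) : LocFinite f δ := fun x _ =>
  (hf x).imp fun _ h n hn => Or.inl (h n hn)

theorem DData.Bounded.locFinite {N : DData D K} (hN : N.Bounded) {M M' : RMod D.I K}
    (f : Ops M M') : LocFinite f N.δ := fun x y =>
  (hN y).imp fun T h n hn => Or.inr (by
    rw [← rebracket_Delta, Bal.map_mk, h n hn, Bal.mk_zero_right, map_zero])

/-- The terms `mu1Term` are included because one of them is the remainder of the telescoping sum in
`LocFinite.boxSum_innerOp`. -/
theorem LocFinite.eventually {M M' : RMod D.I K} {f : Ops M M'} {N : LMod D.I K}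
    {δ : LHom N (Atens N)} (hf : LocFinite f δ) (z : Bal M N) :
    ∀ᶠ n in atTop, boxTerm f δ n z = 0 ∧ mu1Term f δ n z = 0 := by
  induction z using Bal.induction with
  | zero => simp
  | add z w hz hw =>
    filter_upwards [hz, hw] with n h h'
    rw [map_add, map_add, h.1, h.2, h'.1, h'.2, add_zero]
    exact ⟨rfl, rfl⟩
  | mk x y =>
    obtain ⟨T, hT⟩ := hf x y
    filter_upwards [eventually_ge_atTop T] with n hn
    rw [boxTerm_apply, mu1Term_apply]
    rcases hT n hn with h | h
    -- The vanishing of f_{n+1} is known only on pure tensors beginning with x. The element 1 ⊗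
    -- Δ_n(x ⊗ y) is a combination of such tensors, and applying μ₁ to an algebra factor keeps the
    -- entry x.
    · have hmem := iterCoact_mem_span (M := M) δ (fun _ _ _ => True) (fun n a y _ => by
        refine Submodule.span_mono (s := {t | ∃ b y', t = Bal.mk (M := algR D K) b y'})
          (fun t ⟨b, y', ht⟩ => ⟨b, y', trivial, ht⟩) ?_
        induction δ.lin y using Bal.induction with
        | zero => exact Submodule.zero_mem _
        | mk b y' => exact Submodule.subset_span ⟨b, y', rfl⟩
        | add t t' ht ht' => exact Submodule.add_mem _ ht ht') x (y := y) trivial n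
      have key : ∀ p : RHom (S M n) M', (∀ a, p.lin (pure x a n) = 0) →
          rmap p N (iterCoact δ M n (Bal.mk x y)) = 0 := by
        intro p hp
        refine Submodule.span_induction (p := fun z _ => rmap p N z = 0) ?_ ?_ ?_ ?_ hmem
        · rintro _ ⟨a, y', -, rfl⟩
          rw [rmap_mk, hp, Bal.mk_zero_left]
        · exact map_zero _
        · intro z w _ _ h h'; rw [map_add, h, h', add_zero]
        · intro r z _ h; rw [map_smul, h, smul_zero]
      refine ⟨key _ h, Finset.sum_eq_zero fun k hk => key _ fun a => ?_⟩
      rw [RHom.comp_lin, mu1At_pure (Finset.mem_range.1 hk)]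
      exact h _
    · rw [h]
      exact ⟨map_zero _, Finset.sum_eq_zero fun k _ => map_zero _⟩

/-- The total map `∑ₖ (f_{k+1} ⊗ 1) (1 ⊗ Δ_k)`. -/
def boxTotal {M M' : RMod D.I K} (f : Ops M M') {N : LMod D.I K} (δ : LHom N (Atens N)) :
    Bal M N →ₗ[K] Bal M' N :=
  locSum (boxTerm f δ)

theorem LocFinite.boxTotal_eq {M M' : RMod D.I K} {f : Ops M M'} {N : LMod D.I K}
    {δ : LHom N (Atens N)} (hf : LocFinite f δ) {z : Bal M N} {T : ℕ}
    (hT : ∀ n ≥ T, boxTerm f δ n z = 0) :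
    boxTotal f δ z = ∑ n ∈ Finset.range T, boxTerm f δ n z :=
  locSum_eq_sum (fun z => (hf.eventually z).mono fun _ h => h.1) hT

/-- The partial sums of the total map of `f` at `z` are eventually equal to `w`. -/
def BoxSum {M M' : RMod D.I K} (f : Ops M M') {N : LMod D.I K} (δ : LHom N (Atens N))
    (z : Bal M N) (w : Bal M' N) : Prop :=
  ∀ᶠ T in atTop, ∑ n ∈ Finset.range T, boxTerm f δ n z = w

variable {M M' M'' : RMod D.I K} {N : LMod D.I K} {δ : LHom N (Atens N)}

theorem BoxSum.unique {f : Ops M M'} {z : Bal M N} {w w' : Bal M' N} (h : BoxSum f δ z w)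
    (h' : BoxSum f δ z w') : w = w' := by
  obtain ⟨T, hT, hT'⟩ := (h.and h').exists
  exact hT.symm.trans hT'

theorem BoxSum.add {f g : Ops M M'} {z : Bal M N} {w w' : Bal M' N} (h : BoxSum f δ z w)
    (h' : BoxSum g δ z w') : BoxSum (f + g) δ z (w + w') := by
  filter_upwards [h, h'] with T hT hT'
  rw [← hT, ← hT', ← Finset.sum_add_distrib]
  exact Finset.sum_congr rfl fun n _ => rmap_add (f n) (g n) _

theorem boxSum_zero (z : Bal M N) : BoxSum (0 : Ops M M') δ z 0 :=
  Eventually.of_forall fun _ => Finset.sum_eq_zero fun _ _ => rmap_zero _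

theorem boxSum_idOps (z : Bal M N) : BoxSum (idOps M) δ z z := by
  filter_upwards [eventually_ge_atTop 1] with T hT
  obtain ⟨T, rfl⟩ := Nat.exists_eq_add_of_le' hT
  rw [Finset.sum_range_succ', Finset.sum_eq_zero fun n _ => ?_, zero_add]
  · exact rmap_id z
  · exact rmap_zero _

/-- By `boxTerm_starOp` the partial sums run over the triangle i + j < T. For large T it contains a
rectangle outside which every term vanishes, and the sum over the rectangle is the composite. -/
theorem LocFinite.boxSum_starOp {g : Ops M' M''} {f : Ops M M'} (hg : LocFinite g δ)
    (hf : LocFinite f δ) (z : Bal M N) :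
    BoxSum (starOp g f) δ z (boxTotal g δ (boxTotal f δ z)) := by
  obtain ⟨T₁, h₁⟩ := eventually_atTop.1 (hf.eventually z)
  -- The bound for g depends on the vector to which it is applied. Only finitely many j contribute,
  -- so one bound serves all of them.
  have h₂ : ∀ᶠ i in atTop, ∀ j ∈ Finset.range T₁, boxTerm g δ i (boxTerm f δ j z) = 0 :=
    (Filter.eventually_all_finset _).2 fun j _ =>
      (hg.eventually (boxTerm f δ j z)).mono fun _ h => h.1
  obtain ⟨T₂, h₂⟩ := eventually_atTop.1 h₂
  have e1 : boxTotal g δ (boxTotal f δ z)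
      = ∑ j ∈ Finset.range T₁, ∑ i ∈ Finset.range T₂, boxTerm g δ i (boxTerm f δ j z) := by
    rw [hf.boxTotal_eq fun n hn => (h₁ n hn).1, map_sum]
    exact Finset.sum_congr rfl fun j hj => hg.boxTotal_eq fun i hi => h₂ i hi j hj
  filter_upwards [eventually_ge_atTop (T₁ + T₂)] with T hT
  rw [e1]
  simp only [boxTerm_starOp]
  rw [Finset.sum_range_diag_flip T fun j i => boxTerm g δ i (boxTerm f δ j z)]
  refine (Finset.sum_subset (Finset.range_mono (by omega)) fun j _ hj => ?_).symm.trans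
    (Finset.sum_congr rfl fun j hj => ?_)
  · refine Finset.sum_eq_zero fun i _ => ?_
    rw [(h₁ j (by simpa using hj)).1, map_zero]
  · have hj' := Finset.mem_range.1 hj
    refine (Finset.sum_subset (Finset.range_mono (by omega)) fun i _ hi => ?_).symm
    exact h₂ i (by simpa using hi) j hj

/-- Consecutive terms share a `mu1Term`, which cancels modulo 2. A partial sum therefore equals its
last `mu1Term`, and finiteness makes this vanish eventually. -/
theorem LocFinite.boxSum_innerOp {f : Ops M M'} (hf : LocFinite f δ) (hδ : DRel δ)
    (z : Bal M N) : BoxSum (innerOp f) δ z 0 := by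
  have h : ∀ T, ∑ n ∈ Finset.range (T + 1), boxTerm (innerOp f) δ n z = mu1Term f δ T z := by
    intro T
    induction T with
    | zero =>
      -- At n = 0 the index n - 1 is again 0, so the same term occurs twice; it is an empty sum.
      have h0 : mu1Term f δ 0 z = 0 := by rw [mu1Term_apply]; exact Finset.sum_empty
      rw [Finset.sum_range_one, boxTerm_innerOp f hδ, h0, add_zero]
    | succ T ih =>
      rw [Finset.sum_range_succ, ih, boxTerm_innerOp f hδ, Nat.add_sub_cancel, add_left_comm,
        add_self_eq_zero_of_algebra K, add_zero]
  have h' : ∀ᶠ T in atTop, ∑ n ∈ Finset.range (T + 1), boxTerm (innerOp f) δ n z = 0 := by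
    filter_upwards [hf.eventually z] with T hT
    rw [h, hT.2]
  obtain ⟨T₀, hT₀⟩ := eventually_atTop.1 h'
  filter_upwards [eventually_ge_atTop (T₀ + 1)] with T hT
  obtain ⟨T, rfl⟩ := Nat.exists_eq_add_of_le' (le_of_add_le_right hT)
  exact hT₀ T (by omega)

/-- `boxTotal` turns the morphism differential into the differential of the morphism complex. -/
theorem boxTotal_rel {m : Ops M M} {m' : Ops M' M'} {f c : Ops M M'} (hδ : DRel δ)
    (hm : LocFinite m δ) (hm' : LocFinite m' δ) (hf : LocFinite f δ)
    (h : ∀ n x a, ev c n x a = star m' f n x a + star f m n x a + inner f n x a)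
    {z : Bal M N} {w : Bal M' N} (hc : BoxSum c δ z w) :
    w = boxTotal m' δ (boxTotal f δ z) + boxTotal f δ (boxTotal m δ z) := by
  -- Agreement on pure tensors gives an equality of families. Both sides can then be summed over 1 ⊗
  -- Δ_n, and the inner family contributes 0.
  have e : c = starOp m' f + starOp f m + innerOp f := Ops.ext_ev fun n x a => by
    rw [h, ← ev_starOp, ← ev_starOp, ← ev_innerOp]; rfl
  rw [e] at hc
  exact hc.unique (by
    simpa using ((hm'.boxSum_starOp hf z).add (hf.boxSum_starOp hm z)).add
      (hf.boxSum_innerOp hδ z))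

/-- Taking f = m in `boxTotal_rel` would count the square twice and say nothing modulo 2. The
A-infinity relation contains it once, hence the separate argument. -/
theorem boxTotal_boxTotal {m : Ops M M} (hδ : DRel δ) (hm : LocFinite m δ)
    (h : ∀ n x a, star m m n x a + inner m n x a = 0) (z : Bal M N) :
    boxTotal m δ (boxTotal m δ z) = 0 := by
  have e : (0 : Ops M M) = starOp m m + innerOp m := Ops.ext_ev fun n x a => by
    refine (h n x a).symm.trans ?_
    rw [← ev_starOp, ← ev_innerOp]; rfl
  have h0 := boxSum_zero (M' := M) (δ := δ) z
  rw [e] at h0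
  simpa using ((hm.boxSum_starOp hm z).add (hm.boxSum_innerOp hδ z)).unique h0

/-! ### Degrees -/

/-- The map `δ` has degree `-1`. -/
def DDegree (grN : G → Submodule K N.carrier) (δ : LHom N (Atens N)) : Prop :=
  ∀ g, ∀ y ∈ grN g, δ.lin y ∈ grBal (M := algR D K) (grExt D K) grN (g - 1)

/-- Each δ lowers the degree by one, so Δ_n contributes -n while f_{n+1} contributes n + s. The
resulting shift s does not depend on n, so the terms can be added. -/
theorem boxTerm_mem {grM : G → Submodule K M.carrier} {grM' : G → Submodule K M'.carrier}
    {grN : G → Submodule K N.carrier} (hδ : DDegree grN δ) {f : Ops M M'} {s : ℤ}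
    (hf : OpsDegree grM grM' f s) (n : ℕ) {g : G} {z : Bal M N} (hz : z ∈ grBal grM grN g) :
    boxTerm f δ n z ∈ grBal grM' grN (g + (s : G)) := by
  refine Submodule.span_induction (p := fun z _ => boxTerm f δ n z ∈ _) ?_ ?_ ?_ ?_ hz
  · rintro _ ⟨p, q, x, y, hx, hy, rfl, rfl⟩
    -- The propagated property records degrees c of the algebra entries and r of the module entry,
    -- with total q - n after n applications of δ.
    have hmem := iterCoact_mem_span (M := M) δ
      (fun n a y => ∃ (c : ℕ → G) (r : G), (∀ t < n, a t ∈ grExt D K (c t)) ∧ y ∈ grN r ∧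
        r + ∑ t ∈ Finset.range n, c t = q - (n : G)) (fun n a y => by
      rintro ⟨c, r, ha, hy, hr⟩
      refine Submodule.span_mono ?_ (hδ r y hy)
      rintro _ ⟨p', q', b, y', hb, hy', hpq, rfl⟩
      refine ⟨b, y', ⟨Function.update c n p', q', fun t ht => ?_, hy', ?_⟩, rfl⟩
      · rcases Nat.lt_succ_iff_lt_or_eq.1 ht with ht | rfl
        · rw [Function.update_of_ne ht.ne, Function.update_of_ne ht.ne]; exact ha t ht
        · rw [Function.update_self, Function.update_self]; exact hb
      · rw [Finset.sum_range_succ, Function.update_self, Finset.sum_congr rfl fun t ht =>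
          Function.update_of_ne (Finset.mem_range.1 ht).ne p' c]
        rw [add_comm (Finset.sum _ _), ← add_assoc, add_comm q', hpq, sub_add_eq_add_sub, hr]
        push_cast; abel) x (y := y) ⟨0, q, by simp, hy, by simp⟩ n
    rw [boxTerm_apply]
    refine Submodule.span_induction (p := fun z _ => rmap (f n) N z ∈ _) ?_ ?_ ?_ ?_ hmem
    · rintro _ ⟨a, y', ⟨c, r, ha, hy', hr⟩, rfl⟩
      rw [rmap_mk]
      refine Submodule.subset_span ⟨_, r, _, y', hf n x a p c hx ha, hy', ?_, rfl⟩
      have : p + ∑ t ∈ Finset.range n, c t + ((n + s : ℤ) : G) + r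
          = p + (r + ∑ t ∈ Finset.range n, c t) + (n + s) := by push_cast; abel
      rw [this, hr]; abel
    · rw [map_zero]; exact Submodule.zero_mem _
    · intro c c' _ _ h h'; rw [map_add]; exact Submodule.add_mem _ h h'
    · intro r c _ h; rw [map_smul]; exact Submodule.smul_mem _ r h
  · rw [map_zero]; exact Submodule.zero_mem _
  · intro c c' _ _ h h'; rw [map_add]; exact Submodule.add_mem _ h h'
  · intro r c _ h; rw [map_smul]; exact Submodule.smul_mem _ r h

theorem boxTotal_mem {grM : G → Submodule K M.carrier} {grM' : G → Submodule K M'.carrier}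
    {grN : G → Submodule K N.carrier} (hδ : DDegree grN δ) {f : Ops M M'} (hl : LocFinite f δ)
    {s : ℤ} (hf : OpsDegree grM grM' f s) {g : G} {z : Bal M N} (hz : z ∈ grBal grM grN g) :
    boxTotal f δ z ∈ grBal grM' grN (g + (s : G)) := by
  obtain ⟨T, hT⟩ := eventually_atTop.1 (hl.eventually z)
  rw [hl.boxTotal_eq fun n hn => (hT n hn).1]
  exact Submodule.sum_mem _ fun n _ => boxTerm_mem hδ hf n hz

end Totals

/-! ### The box product over one fixed coefficient ring. -/

section BoxTheorem

variable {G : Type v} [AddCommGroupWithOne G] [DecidableEq G] {D : DGAlg.{u} G}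
variable {K : Type u} [CommRing K] [Algebra (ZMod 2) K]

/-- Degrees and structure equations of an A-infinity module. -/
structure AData.Laws (M : AData D K) : Prop where
  degree : OpsDegree M.gr M.gr M.m (-1)
  rel : ∀ n x a, star M.m M.m n x a + inner M.m n x a = 0

/-- Degrees and structure equation of a type D structure. -/
structure DData.Laws (N : DData D K) : Prop where
  degree : DDegree N.gr N.δ
  rel : DRel N.δ

theorem box_isComplex {M : AData D K} {N : DData D K} (hM : M.Laws) (hN : N.Laws)
    (hl : LocFinite M.m N.δ) : (box M N).IsComplex where
  d_mem g z hz := by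
    rw [box_d]
    have := boxTotal_mem hN.degree hl hM.degree hz
    rwa [Int.cast_neg, Int.cast_one, ← sub_eq_add_neg] at this
  d_d z := by
    rw [box_d]
    exact boxTotal_boxTotal hN.rel hl hM.rel z

/-- The total maps of the four families in e are the required chain maps and homotopies. Each of
their identities is `boxTotal_rel` applied to one defining relation, with signs irrelevant in
characteristic 2. -/
theorem box_chainHomotopic {M M' : AData D K} {N : DData D K} (hN : N.Laws) (e : AEquiv M M')
    (hm : LocFinite M.m N.δ) (hm' : LocFinite M'.m N.δ) (hf : LocFinite e.f N.δ)
    (hg : LocFinite e.g N.δ) (hh : LocFinite e.h N.δ) (hh' : LocFinite e.h' N.δ) :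
    ChainHomotopic (box M N) (box M' N) := by
  have hom : ∀ {M M' : AData D K} {ψ : Ops M.toRMod M'.toRMod}, IsAHom M M' ψ →
      LocFinite M.m N.δ → LocFinite M'.m N.δ → LocFinite ψ N.δ →
      ∀ z, boxTotal ψ N.δ (boxTotal M.m N.δ z) = boxTotal M'.m N.δ (boxTotal ψ N.δ z) := by
    intro M M' ψ hψ hm hm' hl z
    -- A homomorphism is a family whose morphism differential is c = 0, with total 0. The two
    -- remaining terms are equal modulo 2.
    have h := boxTotal_rel hN.rel hm hm' hl (c := 0) (fun n x a => (hψ.rel n x a).symm)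
      (boxSum_zero z)
    rw [← sub_eq_zero, h, sub_eq_iff_eq_add, add_right_comm, add_self_eq_zero_of_algebra K,
      zero_add]
  have hty : ∀ {M M' : AData D K} {f : Ops M.toRMod M'.toRMod} {g : Ops M'.toRMod M.toRMod}
      {h : Ops M.toRMod M.toRMod}, IsAHomotopy M M (star g f) (ev (idOps M.toRMod)) h →
      LocFinite M.m N.δ → LocFinite f N.δ → LocFinite g N.δ → LocFinite h N.δ →
      ∀ z, boxTotal g N.δ (boxTotal f N.δ z) - z
        = boxTotal M.m N.δ (boxTotal h N.δ z) + boxTotal h N.δ (boxTotal M.m N.δ z) := by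
    intro M M' f g h hh hm hf hg hl z
    -- Here c is the family g∗f + id, whose total is g^⊠ f^⊠ + 1; the difference in the goal agrees
    -- with this sum modulo 2.
    rw [← boxTotal_rel hN.rel hm hm hl (c := starOp g f + idOps M.toRMod) (fun n x a => by
      rw [← hh.rel n x a, ← ev_starOp]; rfl) ((hg.boxSum_starOp hf z).add (boxSum_idOps z)),
      sub_eq_iff_eq_add, add_assoc, add_self_eq_zero_of_algebra K, add_zero]
  have h0 : ∀ g : G, g + ((0 : ℤ) : G) = g := fun g => by rw [Int.cast_zero, add_zero]
  have h1 : ∀ g : G, g + ((1 : ℤ) : G) = g + 1 := fun g => by rw [Int.cast_one]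
  refine ⟨boxTotal e.f N.δ, boxTotal e.g N.δ, boxTotal e.h N.δ, boxTotal e.h' N.δ,
    fun g z hz => ?_, fun g z hz => ?_, fun g z hz => ?_, fun g z hz => ?_, fun z => ?_,
    fun z => ?_, fun z => ?_, fun z => ?_⟩
  · exact h0 g ▸ boxTotal_mem hN.degree hf e.hom_f.degree hz
  · exact h0 g ▸ boxTotal_mem hN.degree hg e.hom_g.degree hz
  · exact h1 g ▸ boxTotal_mem hN.degree hh e.homotopy_h.degree hz
  · exact h1 g ▸ boxTotal_mem hN.degree hh' e.homotopy_h'.degree hz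
  · rw [box_d, box_d]; exact hom e.hom_f hm hm' hf z
  · rw [box_d, box_d]; exact hom e.hom_g hm' hm hg z
  · rw [box_d]; exact hty e.homotopy_h hm hf hg hh z
  · rw [box_d]; exact hty e.homotopy_h' hm' hg hf hh' z

end BoxTheorem

/-! ### Generators of an extension of scalars. -/

section BaseChangeExt

variable {K : Type*} [CommRing K] {L : Type*} [CommRing L] [Algebra K L]

theorem bc_hom_ext {Y X : Type*} [AddCommGroup Y] [Module K Y] [AddCommGroup X] [Module L X]
    {f g : L ⊗[K] Y →ₗ[L] X} (h : ∀ y, f (1 ⊗ₜ y) = g (1 ⊗ₜ y)) : f = g := by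
  refine LinearMap.ext fun z => ?_
  induction z using TensorProduct.induction_on with
  | zero => rw [map_zero, map_zero]
  | add z w hz hw => rw [map_add, map_add, hz, hw]
  | tmul r y =>
    have e : r ⊗ₜ[K] y = r • ((1 : L) ⊗ₜ[K] y) := by
      rw [TensorProduct.smul_tmul', smul_eq_mul, mul_one]
    rw [e, map_smul, map_smul, h]

theorem span_one_tmul {Y : Type*} [AddCommGroup Y] [Module K Y] {X : Set Y}
    (hX : Submodule.span K X = ⊤) :
    Submodule.span L {z : L ⊗[K] Y | ∃ y ∈ X, z = 1 ⊗ₜ y} = ⊤ := by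
  have h := Submodule.baseChange_span (R := K) (A := L) X
  rw [hX, Submodule.baseChange_top] at h
  rw [h]
  congr 1
  ext z
  exact ⟨fun ⟨y, hy, e⟩ => ⟨y, hy, e.symm⟩, fun ⟨y, hy, e⟩ => ⟨y, hy, e.symm⟩⟩

theorem mem_baseChange_span {Y : Type*} [AddCommGroup Y] [Module K Y] {p : Submodule K Y}
    {z : L ⊗[K] Y} (hz : z ∈ p.baseChange L) :
    z ∈ Submodule.span L {z : L ⊗[K] Y | ∃ y ∈ p, z = 1 ⊗ₜ y} := by
  rw [Submodule.baseChange_eq_span] at hz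
  refine Submodule.span_mono ?_ hz
  rintro _ ⟨y, hy, rfl⟩
  exact ⟨y, hy, rfl⟩

end BaseChangeExt

theorem Bal.bc_hom_ext {R : Type u} [Ring R] {K : Type u} [CommRing K]
    {L : Type*} [CommRing L] [Algebra K L] {M : RMod R K} {N : LMod R K}
    {X : Type*} [AddCommGroup X] [Module L X] {f g : L ⊗[K] Bal M N →ₗ[L] X}
    (h : ∀ x y, f (1 ⊗ₜ Bal.mk x y) = g (1 ⊗ₜ Bal.mk x y)) : f = g := by
  refine StableBox.bc_hom_ext fun z => ?_
  induction z using Bal.induction with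
  | zero => rw [TensorProduct.tmul_zero, map_zero, map_zero]
  | add z w hz hw => rw [TensorProduct.tmul_add, map_add, map_add, hz, hw]
  | mk x y => exact h x y

/-! ### Extension of scalars of families of operations. -/

section BaseChangeOps

variable {G : Type v} [AddCommGroupWithOne G] [DecidableEq G] {D : DGAlg.{u} G}
variable {K : Type u} [CommRing K] [Algebra (ZMod 2) K]
variable (L : Type u) [CommRing L] [Algebra (ZMod 2) L] [Algebra K L] [IsScalarTower (ZMod 2) K L]

/-- The canonical map `A_K → A_L`. -/
def extMap : Ext D K →ₐ[ZMod 2] Ext D L :=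
  Algebra.TensorProduct.map (IsScalarTower.toAlgHom (ZMod 2) K L) (AlgHom.id (ZMod 2) D.A)

theorem extMap_tmul (r : K) (a : D.A) :
    extMap L (r ⊗ₜ[ZMod 2] a : Ext D K) = algebraMap K L r ⊗ₜ[ZMod 2] a := rfl

theorem cancel_one_tmul (b : Ext D K) : cancel D K L (1 ⊗ₜ[K] b) = extMap L b := by
  induction b using TensorProduct.induction_on with
  | zero => rw [TensorProduct.tmul_zero, map_zero, map_zero]
  | add b c hb hc => rw [TensorProduct.tmul_add, map_add, hb, hc, map_add]
  | tmul r a =>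
    rw [extMap_tmul]
    simp [cancel, Algebra.smul_def]

theorem cancel_symm_extMap (b : Ext D K) : (cancel D K L).symm (extMap L b) = 1 ⊗ₜ[K] b := by
  rw [← cancel_one_tmul, LinearEquiv.symm_apply_apply]

theorem extMap_mu1 (b : Ext D K) : extMap L (mu1 D K b) = mu1 D L (extMap L b) := by
  induction b using TensorProduct.induction_on with
  | zero => simp only [map_zero]
  | add b c hb hc => simp only [map_add, hb, hc]
  | tmul r a => rfl

theorem mem_grExt_span {g : G} {b : Ext D L} (hb : b ∈ grExt D L g) :
    b ∈ Submodule.span L {b | ∃ a ∈ grExt D K g, b = extMap L a} := by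
  refine Submodule.span_mono ?_ (mem_baseChange_span (p := D.gr g) hb)
  rintro _ ⟨a, ha, rfl⟩
  exact ⟨(1 : K) ⊗ₜ[ZMod 2] a, Submodule.tmul_mem_baseChange_of_mem (1 : K) ha, by
    rw [extMap_tmul, map_one]⟩

theorem extMap_mem {g : G} {a : Ext D K} (ha : a ∈ grExt D K g) : extMap L a ∈ grExt D L g := by
  refine Submodule.span_induction (p := fun a _ => extMap L a ∈ grExt D L g) ?_ ?_ ?_ ?_
    (mem_baseChange_span (p := D.gr g) ha)
  · rintro _ ⟨a, ha, rfl⟩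
    exact Submodule.tmul_mem_baseChange_of_mem (algebraMap K L 1) ha
  · rw [map_zero]; exact Submodule.zero_mem _
  · intro a b _ _ ha hb; rw [map_add]; exact Submodule.add_mem _ ha hb
  · intro r a _ ha
    -- `extMap` is bundled as linear over `ZMod 2` only; its compatibility with scalars of K is read
    -- off from the isomorphism `cancel`.
    have e : extMap L (r • a) = algebraMap K L r • extMap L a := by
      rw [← cancel_one_tmul, ← cancel_one_tmul, TensorProduct.tmul_smul, ← map_smul,
        algebraMap_smul]
    rw [e]; exact Submodule.smul_mem _ _ ha

theorem span_range_extMap : Submodule.span L (Set.range (extMap (D := D) (K := K) L)) = ⊤ := by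
  refine Submodule.eq_top_iff'.2 fun b => ?_
  induction b using TensorProduct.induction_on with
  | zero => exact Submodule.zero_mem _
  | add b c hb hc => exact Submodule.add_mem _ hb hc
  | tmul r a =>
    have e : r ⊗ₜ[ZMod 2] a = r • (extMap L (1 ⊗ₜ a : Ext D K) : Ext D L) := by
      rw [extMap_tmul, map_one, TensorProduct.smul_tmul', smul_eq_mul, mul_one]
    rw [e]
    exact Submodule.smul_mem _ _ (Submodule.subset_span ⟨_, rfl⟩)

/-- `SOfBC` collects the scalars of all factors in front, and entries defined over K contribute the
scalar 1. This computation makes an extended operation agree with the original one on elements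
defined over K. -/
theorem SOfBC_pure (M : RMod D.I K) (x : M.carrier) (a : ℕ → Ext D K) (n : ℕ) :
    (SOfBC L M n).lin (pure (M := M.bc L) (1 ⊗ₜ x) (fun t => extMap L (a t)) n)
      = 1 ⊗ₜ pure x a n := by
  induction n with
  | zero => rfl
  | succ n ih =>
    have h : (SOfBC L M (n + 1)).lin
          (pure (M := M.bc L) (1 ⊗ₜ x) (fun t => extMap L (a t)) (n + 1))
        = Bal.ofBC L (S M n) (algL D K) (Bal.mk (M := (S M n).bc L) (N := (algL D K).bc L)
          ((SOfBC L M n).lin (pure (M := M.bc L) (1 ⊗ₜ x) (fun t => extMap L (a t)) n))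
          ((cancel D K L).symm (extMap L (a n)))) := rfl
    rw [h, ih, cancel_symm_extMap]
    refine (Bal.ofBC_mk L (S M n) (algL D K) 1 1 (pure x a n) (a n)).trans ?_
    rw [mul_one]
    rfl

variable {M M' M'' : RMod D.I K}

theorem ev_bc (f : Ops M M') (n : ℕ) (x : M.carrier) (a : ℕ → Ext D K) :
    ev (Ops.bc L f) n (1 ⊗ₜ x) (fun t => extMap L (a t)) = 1 ⊗ₜ ev f n x a :=
  congrArg ((f n).bc L).lin (SOfBC_pure L M x a n)

theorem star_bc (g : Ops M' M'') (f : Ops M M') (n : ℕ) (x : M.carrier) (a : ℕ → Ext D K) :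
    star (Ops.bc L g) (Ops.bc L f) n (1 ⊗ₜ x) (fun t => extMap L (a t))
      = 1 ⊗ₜ star g f n x a := by
  rw [star, star, TensorProduct.tmul_sum]
  refine Finset.sum_congr rfl fun j _ => ?_
  rw [ev_bc]
  exact ev_bc L g (n - j) _ fun t => a (j + t)

theorem inner_bc (f : Ops M M') (n : ℕ) (x : M.carrier) (a : ℕ → Ext D K) :
    inner (Ops.bc L f) n (1 ⊗ₜ x) (fun t => extMap L (a t)) = 1 ⊗ₜ inner f n x a := by
  rw [inner, inner, TensorProduct.tmul_add, TensorProduct.tmul_sum, TensorProduct.tmul_sum]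
  refine congrArg₂ (· + ·) (Finset.sum_congr rfl fun k _ => ?_)
    (Finset.sum_congr rfl fun k _ => ?_)
  · rw [← ev_bc, ← extMap_mu1]
    congr 1
    funext t
    rcases eq_or_ne t k with rfl | h
    · rw [Function.update_self, Function.update_self]
    · rw [Function.update_of_ne h, Function.update_of_ne h]
  · rw [← ev_bc]
    congr 1
    funext t
    simp only [contract]
    split_ifs
    · rfl
    · rw [map_mul]
    · rfl

theorem idOps_bc (n : ℕ) (x : M.carrier) (a : ℕ → Ext D K) :
    ev (idOps (M.bc L)) n (1 ⊗ₜ x) (fun t => extMap L (a t)) = 1 ⊗ₜ ev (idOps M) n x a := by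
  cases n with
  | zero => rfl
  | succ n => exact (TensorProduct.tmul_zero _ _).symm

/-- The elements 1 ⊗ x generate L ⊗ M and the image of A_K generates A_L, so pure tensors defined
over K generate every tensor power over L. -/
theorem lin_ext_bc {X : Type*} [AddCommGroup X] [Module L X] {n : ℕ}
    {f g : (S (M.bc L) n).carrier →ₗ[L] X}
    (h : ∀ (x : M.carrier) (a : ℕ → Ext D K),
      f (pure (M := M.bc L) (1 ⊗ₜ x) (fun t => extMap L (a t)) n)
        = g (pure (M := M.bc L) (1 ⊗ₜ x) (fun t => extMap L (a t)) n)) : f = g := by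
  refine LinearMap.ext_on (span_pure (M := M.bc L) (span_one_tmul (L := L) (Submodule.span_univ))
    (span_range_extMap (D := D) (K := K) L) n) ?_
  rintro _ ⟨_, ⟨x, -, rfl⟩, b, hb, rfl⟩
  choose! a ha using hb
  rw [pure_congr (M := M.bc L) (1 ⊗ₜ x) fun t ht => (ha t ht).symm]
  exact h x a

theorem Ops.ext_bc {P : RMod D.I L} {f g : Ops (M.bc L) P}
    (h : ∀ n (x : M.carrier) (a : ℕ → Ext D K), ev f n (1 ⊗ₜ x) (fun t => extMap L (a t))
      = ev g n (1 ⊗ₜ x) (fun t => extMap L (a t))) : f = g :=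
  funext fun n => RHom.ext (lin_ext_bc L (h n))

/-- A pure tensor over L need not be defined over K. Written with `starOp` and `innerOp`, the
relation is an equality of linear maps, and it suffices to test it on generators defined over K. The
relations for homomorphisms and homotopies are handled in the same way. -/
theorem structure_rel_bc {m : Ops M M} (h : ∀ n x a, star m m n x a + inner m n x a = 0) :
    ∀ n x a, star (Ops.bc L m) (Ops.bc L m) n x a + inner (Ops.bc L m) n x a = 0 := by
  have e : starOp (Ops.bc L m) (Ops.bc L m) + innerOp (Ops.bc L m) = 0 :=
    Ops.ext_bc L fun n x a => by
      refine (congrArg₂ (· + ·) (ev_starOp (Ops.bc L m) (Ops.bc L m) n _ _)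
        (ev_innerOp (Ops.bc L m) n _ _)).trans ?_
      rw [star_bc, inner_bc, ← TensorProduct.tmul_add, h, TensorProduct.tmul_zero]
      rfl
  intro n x a
  rw [← ev_starOp, ← ev_innerOp]
  exact congrArg (fun f : Ops (M.bc L) (M.bc L) => ev f n x a) e

theorem hom_rel_bc {m : Ops M M} {m' : Ops M' M'} {f : Ops M M'}
    (h : ∀ n x a, star m' f n x a + star f m n x a + inner f n x a = 0) :
    ∀ n x a, star (Ops.bc L m') (Ops.bc L f) n x a + star (Ops.bc L f) (Ops.bc L m) n x a
      + inner (Ops.bc L f) n x a = 0 := by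
  have e : starOp (Ops.bc L m') (Ops.bc L f) + starOp (Ops.bc L f) (Ops.bc L m)
      + innerOp (Ops.bc L f) = 0 :=
    Ops.ext_bc L fun n x a => by
      refine (congrArg₂ (· + ·) (congrArg₂ (· + ·) (ev_starOp (Ops.bc L m') (Ops.bc L f) n _ _)
        (ev_starOp (Ops.bc L f) (Ops.bc L m) n _ _)) (ev_innerOp (Ops.bc L f) n _ _)).trans ?_
      rw [star_bc, star_bc, inner_bc, ← TensorProduct.tmul_add, ← TensorProduct.tmul_add, h,
        TensorProduct.tmul_zero]
      rfl
  intro n x a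
  rw [← ev_starOp, ← ev_starOp, ← ev_innerOp]
  exact congrArg (fun f : Ops (M.bc L) (M'.bc L) => ev f n x a) e

theorem homotopy_rel_bc {m h : Ops M M} {f : Ops M M'} {g : Ops M' M}
    (hh : ∀ n x a, star g f n x a + ev (idOps M) n x a
      = star m h n x a + star h m n x a + inner h n x a) :
    ∀ n x a, star (Ops.bc L g) (Ops.bc L f) n x a + ev (idOps (M.bc L)) n x a
      = star (Ops.bc L m) (Ops.bc L h) n x a + star (Ops.bc L h) (Ops.bc L m) n x a
        + inner (Ops.bc L h) n x a := by
  have e : starOp (Ops.bc L g) (Ops.bc L f) + idOps (M.bc L)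
      = starOp (Ops.bc L m) (Ops.bc L h) + starOp (Ops.bc L h) (Ops.bc L m)
        + innerOp (Ops.bc L h) :=
    Ops.ext_bc L fun n x a => by
      refine (congrArg₂ (· + ·) (ev_starOp (Ops.bc L g) (Ops.bc L f) n _ _)
        (idOps_bc L n x a)).trans (Eq.trans ?_ (congrArg₂ (· + ·)
        (congrArg₂ (· + ·) (ev_starOp (Ops.bc L m) (Ops.bc L h) n _ _)
          (ev_starOp (Ops.bc L h) (Ops.bc L m) n _ _)) (ev_innerOp (Ops.bc L h) n _ _)).symm)
      rw [star_bc, star_bc, star_bc, inner_bc, ← TensorProduct.tmul_add,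
        ← TensorProduct.tmul_add, ← TensorProduct.tmul_add, hh]
  intro n x a
  rw [← ev_starOp, ← ev_starOp, ← ev_starOp, ← ev_innerOp]
  exact congrArg (fun f : Ops (M.bc L) (M.bc L) => ev f n x a) e

theorem OpsDegree.bc {grM : G → Submodule K M.carrier} {grM' : G → Submodule K M'.carrier}
    {f : Ops M M'} {s : ℤ} (hf : OpsDegree grM grM' f s) :
    OpsDegree (M := M.bc L) (M' := M'.bc L) (fun g => (grM g).baseChange L)
      (fun g => (grM' g).baseChange L) (Ops.bc L f) s := by
  intro n x a p q hx ha
  have hmem := pure_mem_span (M := M.bc L) (mem_baseChange_span hx)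
    fun t ht => mem_grExt_span (K := K) L (ha t ht)
  refine Submodule.span_induction (p := fun w _ => (Ops.bc L f n).lin w ∈ _) ?_ ?_ ?_ ?_ hmem
  · rintro _ ⟨_, ⟨x, hx, rfl⟩, b, hb, rfl⟩
    choose! c hc hb using hb
    rw [pure_congr (M := M.bc L) (1 ⊗ₜ x) hb]
    have e := ev_bc L f n x c
    rw [ev] at e
    rw [e]
    exact Submodule.tmul_mem_baseChange_of_mem _ (hf n x c p q hx hc)
  · rw [map_zero]; exact Submodule.zero_mem _
  · intro a b _ _ ha hb; rw [map_add]; exact Submodule.add_mem _ ha hb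
  · intro r a _ ha; rw [map_smul]; exact Submodule.smul_mem _ r ha

theorem OpsBounded.bc {f : Ops M M'} (hf : OpsBounded f) : OpsBounded (Ops.bc L f) := by
  intro x
  suffices h : ∃ n₀ : ℕ, ∀ n ≥ n₀, ∀ a : ℕ → Ext D L, (Ops.bc L f n).lin (pure x a n) = 0 from h
  have hx : x ∈ Submodule.span L {z : L ⊗[K] M.carrier | ∃ y ∈ Set.univ, z = 1 ⊗ₜ y} :=
    span_one_tmul (L := L) (Submodule.span_univ (R := K) (M := M.carrier)) ▸ Submodule.mem_top
  -- With the algebra entries fixed, a pure tensor is linear in x. This allows an induction over a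
  -- span in x, with a bound independent of the entries.
  have key : ∀ n (a : ℕ → Ext D L), ∃ Λ : L ⊗[K] M.carrier →ₗ[L] L ⊗[K] M'.carrier,
      ∀ x, Λ x = (Ops.bc L f n).lin (pure (M := M.bc L) x a n) := by
    intro n a
    suffices h : ∃ Λ : L ⊗[K] M.carrier →ₗ[L] (S (M.bc L) n).carrier,
        ∀ x, Λ x = pure (M := M.bc L) x a n by
      obtain ⟨Λ, hΛ⟩ := h
      exact ⟨(Ops.bc L f n).lin ∘ₗ Λ, fun x => congrArg (Ops.bc L f n).lin (hΛ x)⟩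
    induction n with
    | zero => exact ⟨LinearMap.id, fun _ => rfl⟩
    | succ n ih =>
      obtain ⟨Λ, hΛ⟩ := ih
      exact ⟨(Bal.mkLin (S (M.bc L) n) (algL D L)).flip (a n) ∘ₗ Λ,
        fun x => congrArg (fun p => Bal.mkLin (S (M.bc L) n) (algL D L) p (a n)) (hΛ x)⟩
  choose Λ hΛ using key
  simp only [← hΛ]
  refine Submodule.span_induction
    (p := fun x _ => ∃ n₀ : ℕ, ∀ n ≥ n₀, ∀ a : ℕ → Ext D L, Λ n a x = 0) ?_ ?_ ?_ ?_ hx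
  · rintro _ ⟨x, -, rfl⟩
    refine (hf x).imp fun n₀ h n hn a => ?_
    rw [hΛ]
    -- The bound for x over K concerns entries in A_K. Entries in A_L are combinations of these, so
    -- the same bound works.
    have hmem := pure_mem_span (M := M.bc L) (x := 1 ⊗ₜ x) (a := a) (n := n)
      (Submodule.subset_span (Set.mem_singleton _)) (Y := fun _ => Set.range (extMap (K := K) L))
      fun t _ => by rw [span_range_extMap]; exact Submodule.mem_top
    refine Submodule.span_induction (p := fun w _ => (Ops.bc L f n).lin w = 0) ?_ ?_ ?_ ?_ hmem
    · rintro _ ⟨_, rfl, b, hb, rfl⟩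
      choose! c hb using hb
      rw [pure_congr (M := M.bc L) (1 ⊗ₜ x) fun t ht => (hb t ht).symm]
      refine (ev_bc L f n x c).trans ?_
      rw [h n hn, TensorProduct.tmul_zero]
    · rw [map_zero]
    · intro a b _ _ ha hb; rw [map_add, ha, hb, add_zero]
    · intro r a _ ha; rw [map_smul, ha, smul_zero]
  · exact ⟨0, fun n _ a => map_zero _⟩
  · rintro x y _ _ ⟨n₀, h⟩ ⟨n₁, h'⟩
    refine ⟨max n₀ n₁, fun n hn a => ?_⟩
    rw [map_add, h n (le_of_max_le_left hn), h' n (le_of_max_le_right hn), add_zero]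
  · rintro r x _ ⟨n₀, h⟩
    refine ⟨n₀, fun n hn a => ?_⟩
    rw [map_smul, h n hn, smul_zero]

end BaseChangeOps

/-! ### Extension of scalars of A-infinity modules and homotopy equivalences. -/

section BaseChangeA

variable {G : Type v} [AddCommGroupWithOne G] [DecidableEq G] {D : DGAlg.{u} G}
variable {K : Type u} [CommRing K] [Algebra (ZMod 2) K]
variable (L : Type u) [CommRing L] [Algebra (ZMod 2) L] [Algebra K L] [IsScalarTower (ZMod 2) K L]

theorem AData.IsAInf.laws {M : AData D K} (hM : M.IsAInf) : M.Laws := ⟨hM.degree, hM.rel⟩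

theorem AData.Laws.bc {M : AData D K} (hM : M.Laws) : (M.bc L).Laws where
  degree := hM.degree.bc L
  rel := structure_rel_bc L hM.rel

theorem IsAHom.bc {M M' : AData D K} {ψ : Ops M.toRMod M'.toRMod} (h : IsAHom M M' ψ) :
    IsAHom (M.bc L) (M'.bc L) (Ops.bc L ψ) where
  degree := h.degree.bc L
  rel := hom_rel_bc L h.rel

theorem IsAHomotopy.bc {M M' : AData D K} {f : Ops M.toRMod M'.toRMod}
    {g : Ops M'.toRMod M.toRMod} {h : Ops M.toRMod M.toRMod}
    (hh : IsAHomotopy M M (star g f) (ev (idOps M.toRMod)) h) :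
    IsAHomotopy (M.bc L) (M.bc L) (star (Ops.bc L g) (Ops.bc L f))
      (ev (idOps (M.bc L).toRMod)) (Ops.bc L h) where
  degree := hh.degree.bc L
  rel := homotopy_rel_bc L hh.rel

/-- Extension of scalars of a homotopy equivalence. -/
def AEquiv.bc {M M' : AData D K} (e : AEquiv M M') : AEquiv (M.bc L) (M'.bc L) where
  f := Ops.bc L e.f
  g := Ops.bc L e.g
  h := Ops.bc L e.h
  h' := Ops.bc L e.h'
  hom_f := e.hom_f.bc L
  hom_g := e.hom_g.bc L
  homotopy_h := e.homotopy_h.bc L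
  homotopy_h' := e.homotopy_h'.bc L

end BaseChangeA

/-! ### Extension of scalars of type D structures. -/

section BaseChangeD

variable {G : Type v} [AddCommGroupWithOne G] [DecidableEq G] {D : DGAlg.{u} G}
variable {K : Type u} [CommRing K] [Algebra (ZMod 2) K]
variable (L : Type u) [CommRing L] [Algebra (ZMod 2) L] [Algebra K L] [IsScalarTower (ZMod 2) K L]

theorem AtensToBC_mk (N : LMod D.I K) (b : Ext D K) (y : N.carrier) :
    (AtensToBC L N).lin (1 ⊗ₜ[K] (Bal.mk (M := algR D K) b y))
      = Bal.mk (M := algR D L) (N := N.bc L) (extMap L b) (1 ⊗ₜ[K] y) := by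
  refine (congrArg (Bal.map (cancelR L) (LHom.id (N.bc L)))
    (Bal.toBC_tmul L (algR D K) N 1 b y)).trans ?_
  rw [one_smul]
  refine (Bal.map_mk (cancelR L) (LHom.id (N.bc L)) _ _).trans ?_
  exact congrArg (fun c => Bal.mk (M := algR D L) (N := N.bc L) c (1 ⊗ₜ[K] y))
    (cancel_one_tmul L b)

theorem DData.bc_δ (N : DData D K) (y : N.carrier) :
    (N.bc L).δ.lin (1 ⊗ₜ[K] y) = (AtensToBC L N.toLMod).lin (1 ⊗ₜ[K] N.δ.lin y) := rfl

theorem mu2N_AtensToBC (N : LMod D.I K) (b : Ext D K) (s : Bal (algR D K) N) :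
    mu2N (N.bc L) (Bal.mk (M := algR D L) (N := Atens (N.bc L)) (extMap L b)
        ((AtensToBC L N).lin (1 ⊗ₜ[K] s)))
      = (AtensToBC L N).lin
        (1 ⊗ₜ[K] mu2N N (Bal.mk (M := algR D K) (N := Atens N) b s)) := by
  refine LinearMap.congr_fun
    (f := mu2N (N.bc L) ∘ₗ Bal.mkLin (algR D L) (Atens (N.bc L)) (extMap L b) ∘ₗ
      (AtensToBC L N).lin)
    (g := (AtensToBC L N).lin ∘ₗ (mu2N N ∘ₗ Bal.mkLin (algR D K) (Atens N) b).baseChange L)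
    (Bal.bc_hom_ext fun c y => ?_) (1 ⊗ₜ[K] s)
  refine (congrArg (fun t => mu2N (N.bc L) (Bal.mk (M := algR D L) (N := Atens (N.bc L))
    (extMap L b) t)) (AtensToBC_mk L N c y)).trans ?_
  refine (mu2N_mk (N.bc L) _ _ _).trans (Eq.symm ?_)
  refine (congrArg (fun t => (AtensToBC L N).lin (1 ⊗ₜ[K] t)) (mu2N_mk N b c y)).trans ?_
  rw [← map_mul]
  exact AtensToBC_mk L N (b * c) y

/-- The map A_K → A_L respects products and μ₁, so both terms of the equation at 1 ⊗ y are images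
under `AtensToBC` of the corresponding terms at y. -/
theorem DRel.bc {N : DData D K} (h : DRel N.δ) : DRel (N.bc L).δ := by
  have h2 : ∀ t : Bal (algR D K) N.toLMod,
      mu2N (N.bc L).toLMod ((AtensMap (N.bc L).δ).lin ((AtensToBC L N.toLMod).lin (1 ⊗ₜ[K] t)))
        = (AtensToBC L N.toLMod).lin (1 ⊗ₜ[K] mu2N N.toLMod ((AtensMap N.δ).lin t)) := by
    intro t
    refine LinearMap.congr_fun
      (f := mu2N (N.bc L).toLMod ∘ₗ (AtensMap (N.bc L).δ).lin ∘ₗ (AtensToBC L N.toLMod).lin)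
      (g := (AtensToBC L N.toLMod).lin ∘ₗ (mu2N N.toLMod ∘ₗ (AtensMap N.δ).lin).baseChange L)
      (Bal.bc_hom_ext fun b y => ?_) (1 ⊗ₜ[K] t)
    refine (congrArg (fun t => mu2N (N.bc L).toLMod ((AtensMap (N.bc L).δ).lin t))
      (AtensToBC_mk L N.toLMod b y)).trans ?_
    refine (congrArg (mu2N (N.bc L).toLMod) (Bal.map_mk (RHom.id (algR D L)) (N.bc L).δ
      (extMap L b) (1 ⊗ₜ[K] y))).trans ?_
    refine (mu2N_AtensToBC L N.toLMod b (N.δ.lin y)).trans (Eq.symm ?_)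
    exact congrArg (fun t => (AtensToBC L N.toLMod).lin (1 ⊗ₜ[K] mu2N N.toLMod t))
      (Bal.map_mk (RHom.id (algR D K)) N.δ b y)
  have h1 : ∀ t : Bal (algR D K) N.toLMod,
      Bal.map mu1R (LHom.id (N.bc L).toLMod) ((AtensToBC L N.toLMod).lin (1 ⊗ₜ[K] t))
        = (AtensToBC L N.toLMod).lin (1 ⊗ₜ[K] Bal.map mu1R (LHom.id N.toLMod) t) := by
    intro t
    refine LinearMap.congr_fun
      (f := Bal.map mu1R (LHom.id (N.bc L).toLMod) ∘ₗ (AtensToBC L N.toLMod).lin)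
      (g := (AtensToBC L N.toLMod).lin ∘ₗ (Bal.map mu1R (LHom.id N.toLMod)).baseChange L)
      (Bal.bc_hom_ext fun b y => ?_) (1 ⊗ₜ[K] t)
    refine (congrArg (Bal.map mu1R (LHom.id (N.bc L).toLMod))
      (AtensToBC_mk L N.toLMod b y)).trans ?_
    refine (Bal.map_mk mu1R (LHom.id (N.bc L).toLMod) _ _).trans (Eq.symm ?_)
    refine (congrArg (fun t => (AtensToBC L N.toLMod).lin (1 ⊗ₜ[K] t))
      (Bal.map_mk mu1R (LHom.id N.toLMod) b y)).trans ((AtensToBC_mk L N.toLMod _ _).trans ?_)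
    exact congrArg (fun c => Bal.mk (M := algR D L) (N := (N.bc L).toLMod) c (1 ⊗ₜ[K] y))
      (extMap_mu1 L b)
  intro y
  refine LinearMap.congr_fun
    (f := mu2N (N.bc L).toLMod ∘ₗ (AtensMap (N.bc L).δ).lin ∘ₗ (N.bc L).δ.lin
      + Bal.map mu1R (LHom.id (N.bc L).toLMod) ∘ₗ (N.bc L).δ.lin) (g := 0)
    (bc_hom_ext fun y => ?_) y
  refine (congrArg₂ (· + ·) (h2 (N.δ.lin y)) (h1 (N.δ.lin y))).trans ?_
  refine (map_add (AtensToBC L N.toLMod).lin _ _).symm.trans ?_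
  rw [← TensorProduct.tmul_add, h y, TensorProduct.tmul_zero]
  exact map_zero _

theorem DData.IsTypeD.laws {N : DData D K} (hN : N.IsTypeD) : N.Laws := ⟨hN.degree, hN.rel⟩

theorem DDegree.bc {N : DData D K} (h : DDegree N.gr N.δ) : DDegree (N.bc L).gr (N.bc L).δ := by
  intro g y hy
  refine Submodule.span_induction (p := fun y _ => (N.bc L).δ.lin y ∈
    grBal (M := algR D L) (grExt D L) (N.bc L).gr (g - 1)) ?_ ?_ ?_ ?_
    (mem_baseChange_span (p := N.gr g) hy)
  · rintro _ ⟨y, hy, rfl⟩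
    rw [DData.bc_δ]
    refine Submodule.span_induction (p := fun t _ => (AtensToBC L N.toLMod).lin (1 ⊗ₜ[K] t) ∈
      grBal (M := algR D L) (grExt D L) (N.bc L).gr (g - 1)) ?_ ?_ ?_ ?_ (h g y hy)
    · rintro _ ⟨p, q, b, y', hb, hy', hpq, rfl⟩
      refine Submodule.subset_span ⟨p, q, extMap L b, 1 ⊗ₜ[K] y', extMap_mem L hb,
        Submodule.tmul_mem_baseChange_of_mem 1 hy', hpq, AtensToBC_mk L N.toLMod b y'⟩
    · rw [TensorProduct.tmul_zero, map_zero]; exact Submodule.zero_mem _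
    · intro a b _ _ ha hb
      rw [TensorProduct.tmul_add, map_add]; exact Submodule.add_mem _ ha hb
    · intro r a _ ha
      rw [TensorProduct.tmul_smul, ← algebraMap_smul L r, map_smul]
      exact Submodule.smul_mem _ _ ha
  · rw [map_zero]; exact Submodule.zero_mem _
  · intro a b _ _ ha hb; rw [map_add]; exact Submodule.add_mem _ ha hb
  · intro r a _ ha; rw [map_smul]; exact Submodule.smul_mem _ r ha

theorem DData.Laws.bc {N : DData D K} (hN : N.Laws) : (N.bc L).Laws :=
  ⟨hN.degree.bc L, hN.rel.bc L⟩

/-- The map `L ⊗ (A_K ⊗ ⋯ ⊗ A_K ⊗ N) → A_L ⊗ ⋯ ⊗ A_L ⊗ N'` induced by `L ⊗ N → N'`. -/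
def TToBC : (k : ℕ) → {N : LMod D.I K} → {N' : LMod D.I L} → LHom (N.bc L) N' →
    LHom ((T k N).bc L) (T k N')
  | 0, _, _, η => η
  | k + 1, N, _, η => TToBC k ((AtensMap η).comp (AtensToBC L N))

/-- Tensoring a commutative square with A on the left gives another one; this is the inductive step
for `TMap_TToBC`, in which N changes at every stage. -/
theorem AtensToBC_natural {N X : LMod D.I K} {N' X' : LMod D.I L} {f : LHom N X}
    {f' : LHom N' X'} {η : LHom (N.bc L) N'} {ξ : LHom (X.bc L) X'}
    (h : f'.comp η = ξ.comp (f.bc L)) :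
    (AtensMap f').comp ((AtensMap η).comp (AtensToBC L N))
      = ((AtensMap ξ).comp (AtensToBC L X)).comp ((AtensMap f).bc L) := by
  refine LHom.ext (Bal.bc_hom_ext fun b y => ?_)
  refine (congrArg (fun t => (AtensMap f').lin ((AtensMap η).lin t))
    (AtensToBC_mk L N b y)).trans ?_
  refine (congrArg (AtensMap f').lin (Bal.map_mk (RHom.id (algR D L)) η _ _)).trans ?_
  refine (Bal.map_mk (RHom.id (algR D L)) f' _ _).trans (Eq.symm ?_)
  refine (congrArg (fun t => (AtensMap ξ).lin ((AtensToBC L X).lin (1 ⊗ₜ[K] t)))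
    (Bal.map_mk (RHom.id (algR D K)) f b y)).trans ?_
  refine (congrArg (AtensMap ξ).lin (AtensToBC_mk L X b (f.lin y))).trans ?_
  refine (Bal.map_mk (RHom.id (algR D L)) ξ _ _).trans ?_
  exact congrArg (fun w => Bal.mk (M := algR D L) (N := X') (extMap L b) w)
    (congrArg (fun p : LHom (N.bc L) X' => p.lin (1 ⊗ₜ[K] y)) h).symm

theorem TMap_TToBC (k : ℕ) : ∀ {N X : LMod D.I K} {N' X' : LMod D.I L} {f : LHom N X}
    {f' : LHom N' X'} {η : LHom (N.bc L) N'} {ξ : LHom (X.bc L) X'},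
    f'.comp η = ξ.comp (f.bc L) →
    (TMap k f').comp (TToBC L k η) = (TToBC L k ξ).comp ((TMap k f).bc L) := by
  induction k with
  | zero => intro N X N' X' f f' η ξ h; exact h
  | succ k ih => intro N X N' X' f f' η ξ h; exact ih (AtensToBC_natural L h)

/-- This is how boundedness passes to L ⊗ N: Δ_k(1 ⊗ y) is an image of Δ_k(y) and vanishes with it.
-/
theorem Delta_bc (N : DData D K) (k : ℕ) (y : N.carrier) :
    (Delta (N.bc L).δ k).lin (1 ⊗ₜ[K] y)
      = (TToBC L k (LHom.id (N.bc L).toLMod)).lin (1 ⊗ₜ[K] (Delta N.δ k).lin y) := by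
  induction k with
  | zero => rfl
  | succ k ih =>
    have h : (TMap k (N.bc L).δ).comp (TToBC L k (LHom.id (N.bc L).toLMod))
        = (TToBC L k (AtensToBC L N.toLMod)).comp ((TMap k N.δ).bc L) :=
      TMap_TToBC L k (LHom.ext (LinearMap.ext fun z => rfl))
    -- Unfolding `TToBC` at k + 1 starts from the identity tensored with A, composed with
    -- `AtensToBC`; the first factor has to be removed to match the square `h`.
    have h' : (AtensMap (LHom.id (N.bc L).toLMod)).comp (AtensToBC L N.toLMod)
        = AtensToBC L N.toLMod := by
      refine LHom.ext (LinearMap.ext fun z => ?_)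
      exact rmap_id (M := algR D L) _
    refine (congrArg (TMap k (N.bc L).δ).lin ih).trans ?_
    refine (congrArg (fun p : LHom ((T k N.toLMod).bc L) (T k (Atens (N.bc L).toLMod)) =>
      p.lin (1 ⊗ₜ[K] (Delta N.δ k).lin y)) h).trans ?_
    exact congrArg (fun p : LHom ((Atens N.toLMod).bc L) (Atens (N.bc L).toLMod) =>
      (TToBC L k p).lin (1 ⊗ₜ[K] (Delta N.δ (k + 1)).lin y)) h'.symm

theorem DData.Bounded.bc {N : DData D K} (hN : N.Bounded) : (N.bc L).Bounded := by
  intro (y : L ⊗[K] N.carrier)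
  refine Submodule.span_induction
    (p := fun y _ => ∃ k₀ : ℕ, ∀ k ≥ k₀, (Delta (N.bc L).δ k).lin y = 0) ?_ ?_ ?_ ?_
    (span_one_tmul (L := L) (Submodule.span_univ (R := K) (M := N.carrier)) ▸
      Submodule.mem_top : y ∈ Submodule.span L
        {z : L ⊗[K] N.carrier | ∃ y ∈ Set.univ, z = 1 ⊗ₜ y})
  · rintro _ ⟨y, -, rfl⟩
    refine (hN y).imp fun k₀ h k hk => ?_
    rw [Delta_bc, h k hk, TensorProduct.tmul_zero, map_zero]
  · exact ⟨0, fun k _ => map_zero _⟩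
  · rintro x y _ _ ⟨n₀, h⟩ ⟨n₁, h'⟩
    refine ⟨max n₀ n₁, fun n hn => ?_⟩
    rw [map_add, h n (le_of_max_le_left hn), h' n (le_of_max_le_right hn), add_zero]
  · rintro r x _ ⟨n₀, h⟩
    refine ⟨n₀, fun n hn => ?_⟩
    rw [map_smul, h n hn, smul_zero]

end BaseChangeD

/-! ### Transport of homotopy equivalences along isomorphisms of complexes. -/

section DiffIso

variable {G : Type v} [AddCommGroupWithOne G] {K : Type u} [CommRing K]

/-- Isomorphism of graded differential spaces. -/
def DiffIso (C C' : DiffSpace G K) : Prop :=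
  ∃ Φ : C.carrier ≃ₗ[K] C'.carrier, (∀ z, Φ (C.d z) = C'.d (Φ z)) ∧
    ∀ g z, z ∈ C.gr g ↔ Φ z ∈ C'.gr g

theorem ChainHomotopic.congr {C₁ C₂ C₁' C₂' : DiffSpace G K} (h : ChainHomotopic C₂ C₂')
    (i : DiffIso C₁ C₂) (i' : DiffIso C₁' C₂') : ChainHomotopic C₁ C₁' := by
  obtain ⟨f, g, k, k', hf, hg, hk, hk', cf, cg, e, e'⟩ := h
  obtain ⟨Φ, hd, hgr⟩ := i
  obtain ⟨Ψ, hd', hgr'⟩ := i'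
  have sd : ∀ z, Φ.symm (C₂.d z) = C₁.d (Φ.symm z) := fun z => by
    rw [LinearEquiv.symm_apply_eq, hd, LinearEquiv.apply_symm_apply]
  have sd' : ∀ z, Ψ.symm (C₂'.d z) = C₁'.d (Ψ.symm z) := fun z => by
    rw [LinearEquiv.symm_apply_eq, hd', LinearEquiv.apply_symm_apply]
  refine ⟨Ψ.symm.toLinearMap ∘ₗ f ∘ₗ Φ.toLinearMap, Φ.symm.toLinearMap ∘ₗ g ∘ₗ Ψ.toLinearMap,
    Φ.symm.toLinearMap ∘ₗ k ∘ₗ Φ.toLinearMap, Ψ.symm.toLinearMap ∘ₗ k' ∘ₗ Ψ.toLinearMap,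
    fun a z hz => ?_, fun a z hz => ?_, fun a z hz => ?_, fun a z hz => ?_, fun z => ?_,
    fun z => ?_, fun z => ?_, fun z => ?_⟩
  · simpa [hgr'] using hf a _ ((hgr a z).1 hz)
  · simpa [hgr] using hg a _ ((hgr' a z).1 hz)
  · simpa [hgr] using hk a _ ((hgr a z).1 hz)
  · simpa [hgr'] using hk' a _ ((hgr' a z).1 hz)
  · simp [hd, cf, sd']
  · simp [hd', cg, sd]
  · apply Φ.injective; simp [hd, e]
  · apply Ψ.injective; simp [hd', e']

end DiffIso

/-! ### Extension of scalars commutes with tensor products over the ground ring. -/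

section Comparison

variable {R : Type u} [Ring R] {K : Type u} [CommRing K] {L : Type u} [CommRing L] [Algebra K L]

/-- The map `L ⊗ (Q ⊗ Y) → Q' ⊗ Y'` induced by `L ⊗ Q → Q'` and `L ⊗ Y → Y'`. -/
def compar {Q : RMod R K} {Q' : RMod R L} {Y : LMod R K} {Y' : LMod R L}
    (α : RHom (Q.bc L) Q') (β : LHom (Y.bc L) Y') : L ⊗[K] Bal Q Y →ₗ[L] Bal Q' Y' :=
  Bal.map α β ∘ₗ Bal.toBC L Q Y

theorem compar_mk {Q : RMod R K} {Q' : RMod R L} {Y : LMod R K} {Y' : LMod R L}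
    (α : RHom (Q.bc L) Q') (β : LHom (Y.bc L) Y') (q : Q.carrier) (y : Y.carrier) :
    compar α β (1 ⊗ₜ[K] Bal.mk q y) = Bal.mk (α.lin (1 ⊗ₜ[K] q)) (β.lin (1 ⊗ₜ[K] y)) := by
  refine (congrArg (Bal.map α β) (Bal.toBC_tmul L Q Y 1 q y)).trans ?_
  rw [one_smul]
  exact Bal.map_mk α β _ _

theorem toBC_ofBC (Q : RMod R K) (Y : LMod R K) (z : Bal (Q.bc L) (Y.bc L)) :
    Bal.toBC L Q Y (Bal.ofBC L Q Y z) = z := by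
  refine LinearMap.congr_fun (f := Bal.toBC L Q Y ∘ₗ Bal.ofBC L Q Y) (g := LinearMap.id)
    (Bal.hom_ext fun x y => ?_) z
  refine LinearMap.congr_fun
    (f := (Bal.toBC L Q Y ∘ₗ Bal.ofBC L Q Y) ∘ₗ (Bal.mkLin (Q.bc L) (Y.bc L)).flip y)
    (g := (Bal.mkLin (Q.bc L) (Y.bc L)).flip y) (bc_hom_ext fun x => ?_) x
  refine LinearMap.congr_fun
    (f := (Bal.toBC L Q Y ∘ₗ Bal.ofBC L Q Y) ∘ₗ Bal.mkLin (Q.bc L) (Y.bc L) (1 ⊗ₜ[K] x))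
    (g := Bal.mkLin (Q.bc L) (Y.bc L) (1 ⊗ₜ[K] x)) (bc_hom_ext fun y => ?_) y
  refine (congrArg (Bal.toBC L Q Y) (Bal.ofBC_mk L Q Y 1 1 x y)).trans ?_
  refine (Bal.toBC_tmul L Q Y _ x y).trans ?_
  rw [mul_one, one_smul]
  rfl

/-- The inverse of a bijective homomorphism. -/
def RHom.inverse {M M' : RMod R K} (f : RHom M M') (e : M.carrier ≃ₗ[K] M'.carrier)
    (he : ∀ x, e x = f.lin x) : RHom M' M :=
  ⟨e.symm.toLinearMap, fun r x => by
    apply e.injective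
    change e (e.symm _) = e (_)
    rw [LinearEquiv.apply_symm_apply, he, f.map_act, ← he]
    exact congrArg _ (e.apply_symm_apply x).symm⟩

/-- The inverse of a bijective homomorphism. -/
def LHom.inverse {M M' : LMod R K} (f : LHom M M') (e : M.carrier ≃ₗ[K] M'.carrier)
    (he : ∀ x, e x = f.lin x) : LHom M' M :=
  ⟨e.symm.toLinearMap, fun r x => by
    apply e.injective
    change e (e.symm _) = e (_)
    rw [LinearEquiv.apply_symm_apply, he, f.map_act, ← he]
    exact congrArg _ (e.apply_symm_apply x).symm⟩

/-- The comparison map as an isomorphism. -/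
def comparEquiv {Q : RMod R K} {Q' : RMod R L} {Y : LMod R K} {Y' : LMod R L}
    (α : RHom (Q.bc L) Q') (β : LHom (Y.bc L) Y')
    (a : L ⊗[K] Q.carrier ≃ₗ[L] Q'.carrier) (ha : ∀ x, a x = α.lin x)
    (b : L ⊗[K] Y.carrier ≃ₗ[L] Y'.carrier) (hb : ∀ x, b x = β.lin x) :
    L ⊗[K] Bal Q Y ≃ₗ[L] Bal Q' Y' :=
  LinearEquiv.ofLinearMap (compar α β)
    (Bal.ofBC L Q Y ∘ₗ Bal.map (α.inverse a ha) (β.inverse b hb))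
    (by
      refine Bal.hom_ext fun x y => ?_
      refine (congrArg (fun z => Bal.map α β (Bal.toBC L Q Y (Bal.ofBC L Q Y z)))
        (Bal.map_mk (α.inverse a ha) (β.inverse b hb) x y)).trans ?_
      refine (congrArg (Bal.map α β) (toBC_ofBC Q Y _)).trans ((Bal.map_mk α β _ _).trans ?_)
      exact congrArg₂ (fun x y => (Bal.mk x y : Bal Q' Y'))
        ((ha _).symm.trans (a.apply_symm_apply x))
        ((hb _).symm.trans (b.apply_symm_apply y)))
    (by
      refine Bal.bc_hom_ext fun x y => ?_
      refine (congrArg (fun z => Bal.ofBC L Q Y (Bal.map (α.inverse a ha) (β.inverse b hb) z))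
        (compar_mk α β x y)).trans ?_
      refine (congrArg (Bal.ofBC L Q Y)
        (Bal.map_mk (α.inverse a ha) (β.inverse b hb) _ _)).trans ?_
      refine (congrArg (Bal.ofBC L Q Y) (congrArg₂
        (fun x y => (Bal.mk x y : Bal (Q.bc L) (Y.bc L)))
        ((congrArg a.symm (ha _).symm).trans (a.symm_apply_apply (1 ⊗ₜ[K] x)))
        ((congrArg b.symm (hb _).symm).trans (b.symm_apply_apply (1 ⊗ₜ[K] y))))).trans ?_
      refine (Bal.ofBC_mk L Q Y 1 1 x y).trans ?_
      rw [mul_one]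
      rfl)

end Comparison

/-! ### Extension of scalars commutes with the box product. -/

section BoxComparison

variable {G : Type v} [AddCommGroupWithOne G] [DecidableEq G] {D : DGAlg.{u} G}
variable {K : Type u} [CommRing K] [Algebra (ZMod 2) K]
variable {L : Type u} [CommRing L] [Algebra (ZMod 2) L] [Algebra K L] [IsScalarTower (ZMod 2) K L]

/-- The isomorphism `L ⊗ A_K ≅ A_L` as a map of left modules. -/
def cancelL (D : DGAlg.{u} G) (K L : Type u) [CommRing K] [Algebra (ZMod 2) K] [CommRing L]
    [Algebra (ZMod 2) L] [Algebra K L] [IsScalarTower (ZMod 2) K L] :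
    LHom ((algL D K).bc L) (algL D L) :=
  ⟨(cancel D K L).toLinearMap, fun e z => cancel_act_left L e z⟩

theorem compar_cancelL_mk {Q : RMod D.I K} {Q' : RMod D.I L} (P : RHom (Q.bc L) Q')
    (q : Q.carrier) (b : Ext D K) :
    compar P (cancelL D K L) (1 ⊗ₜ[K] (Bal.mk (N := algL D K) q b))
      = Bal.mk (N := algL D L) (P.lin (1 ⊗ₜ[K] q)) (extMap L b) :=
  (compar_mk P (cancelL D K L) q b).trans (congrArg (fun c => Bal.mk (M := Q') (N := algL D L)
    (P.lin (1 ⊗ₜ[K] q)) c) (cancel_one_tmul L b))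

/-- The map `L ⊗ (Q ⊗ A_K) → Q' ⊗ A_L` induced by `L ⊗ Q → Q'`. -/
def tensACompar {Q : RMod D.I K} {Q' : RMod D.I L} (P : RHom (Q.bc L) Q') :
    RHom ((tensA Q).bc L) (tensA Q') where
  lin := compar P (cancelL D K L)
  map_act e z := by
    refine LinearMap.congr_fun (f := compar P (cancelL D K L) ∘ₗ ((tensA Q).bc L).act e)
      (g := (tensA Q').act e ∘ₗ compar P (cancelL D K L)) (Bal.bc_hom_ext fun q b => ?_) z
    refine (congrArg (fun t => compar P (cancelL D K L) (1 ⊗ₜ[K] t))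
      (tensA_act Q e.unop q b)).trans ?_
    refine (compar_cancelL_mk P q (b * inc D K e.unop)).trans (Eq.symm ?_)
    refine (congrArg ((tensA Q').act e) (compar_cancelL_mk P q b)).trans ?_
    refine (tensA_act Q' e.unop _ _).trans ?_
    refine congrArg (fun c => Bal.mk (M := Q') (N := algL D L) (P.lin (1 ⊗ₜ[K] q)) c) ?_
    rw [map_mul, inc_apply, inc_apply, extMap_tmul, map_one]

theorem tensACompar_mk {Q : RMod D.I K} {Q' : RMod D.I L} (P : RHom (Q.bc L) Q')
    (q : Q.carrier) (b : Ext D K) :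
    (tensACompar P).lin (1 ⊗ₜ[K] (Bal.mk (N := algL D K) q b))
      = Bal.mk (N := algL D L) (P.lin (1 ⊗ₜ[K] q)) (extMap L b) :=
  compar_cancelL_mk P q b

/-- The map `L ⊗ (X ⊗ A_K ⊗ ⋯ ⊗ A_K) → X' ⊗ A_L ⊗ ⋯ ⊗ A_L` induced by `L ⊗ X → X'`. -/
def SCompar {X : RMod D.I K} {X' : RMod D.I L} (α : RHom (X.bc L) X') :
    (k : ℕ) → RHom ((S X k).bc L) (S X' k)
  | 0 => α
  | k + 1 => tensACompar (SCompar α k)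

theorem SCompar_pure {X : RMod D.I K} {X' : RMod D.I L} (α : RHom (X.bc L) X') (k : ℕ)
    (x : X.carrier) (a : ℕ → Ext D K) : (SCompar α k).lin (1 ⊗ₜ[K] pure x a k)
      = pure (α.lin (1 ⊗ₜ[K] x)) (fun t => extMap L (a t)) k := by
  induction k with
  | zero => rfl
  | succ k ih =>
    refine (tensACompar_mk (SCompar α k) (pure x a k) (a k)).trans ?_
    exact congrArg (fun p => Bal.mk (M := S X' k) (N := algL D L) p (extMap L (a k))) ih

variable {X : RMod D.I K} {X' : RMod D.I L} {Y : LMod D.I K} {Y' : LMod D.I L}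
variable {δ : LHom Y (Atens Y)} {δ' : LHom Y' (Atens Y')} {β : LHom (Y.bc L) Y'}

/-- The hypothesis `hβ` says that β intertwines the two maps δ. One coaction then replaces the
comparison P by its tensor product with A, so the statement can be iterated. -/
theorem coact_compar (hβ : ∀ y, δ'.lin (β.lin (1 ⊗ₜ[K] y))
      = (AtensMap β).lin ((AtensToBC L Y).lin (1 ⊗ₜ[K] δ.lin y)))
    {Q : RMod D.I K} {Q' : RMod D.I L} (P : RHom (Q.bc L) Q') (z : L ⊗[K] Bal Q Y) :
    coact δ' Q' (compar P β z) = compar (tensACompar P) β ((coact δ Q).baseChange L z) := by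
  refine LinearMap.congr_fun (f := coact δ' Q' ∘ₗ compar P β)
    (g := compar (tensACompar P) β ∘ₗ (coact δ Q).baseChange L)
    (Bal.bc_hom_ext fun q y => ?_) z
  refine (congrArg (coact δ' Q') (compar_mk P β q y)).trans ?_
  refine (coact_mk δ' Q' _ _).trans ?_
  rw [hβ]
  refine Eq.trans ?_
    (congrArg (fun w => compar (tensACompar P) β (1 ⊗ₜ[K] w)) (coact_mk δ Q q y)).symm
  refine LinearMap.congr_fun
    (f := assoc Q' Y' ∘ₗ Bal.mkLin Q' (Atens Y') (P.lin (1 ⊗ₜ[K] q)) ∘ₗ (AtensMap β).lin ∘ₗ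
      (AtensToBC L Y).lin)
    (g := compar (tensACompar P) β ∘ₗ (assoc Q Y ∘ₗ Bal.mkLin Q (Atens Y) q).baseChange L)
    (Bal.bc_hom_ext fun b y => ?_) (1 ⊗ₜ[K] δ.lin y)
  refine (congrArg (fun t => assoc Q' Y' (Bal.mk (N := Atens Y') (P.lin (1 ⊗ₜ[K] q))
    ((AtensMap β).lin t))) (AtensToBC_mk L Y b y)).trans ?_
  refine (congrArg (fun t => assoc Q' Y' (Bal.mk (N := Atens Y') (P.lin (1 ⊗ₜ[K] q)) t))
    (Bal.map_mk (RHom.id (algR D L)) β _ _)).trans ((assoc_mk Q' Y' _ _ _).trans (Eq.symm ?_))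
  refine (congrArg (fun w => compar (tensACompar P) β (1 ⊗ₜ[K] w)) (assoc_mk Q Y q b y)).trans ?_
  refine (compar_mk (tensACompar P) β _ _).trans ?_
  exact congrArg (fun p => Bal.mk (M := tensA Q') (N := Y') p (β.lin (1 ⊗ₜ[K] y)))
    (tensACompar_mk P q b)

theorem iterCoact_compar (hβ : ∀ y, δ'.lin (β.lin (1 ⊗ₜ[K] y))
      = (AtensMap β).lin ((AtensToBC L Y).lin (1 ⊗ₜ[K] δ.lin y)))
    (α : RHom (X.bc L) X') (k : ℕ) (z : Bal X Y) :
    iterCoact δ' X' k (compar α β (1 ⊗ₜ[K] z))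
      = compar (SCompar α k) β (1 ⊗ₜ[K] iterCoact δ X k z) := by
  induction k with
  | zero => rfl
  | succ k ih =>
    exact (congrArg (coact δ' (S X' k)) ih).trans (coact_compar hβ (SCompar α k) _)

/-- Compatibility of α, α₁ with the operations and of β with δ makes every single term of the two
sums correspond. Both sums are finite at each vector, so the totals correspond as well. -/
theorem boxTotal_compar {X₁ : RMod D.I K} {X₁' : RMod D.I L} {f : Ops X X₁} {f' : Ops X' X₁'}
    (hβ : ∀ y, δ'.lin (β.lin (1 ⊗ₜ[K] y))
      = (AtensMap β).lin ((AtensToBC L Y).lin (1 ⊗ₜ[K] δ.lin y)))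
    (α : RHom (X.bc L) X') (α₁ : RHom (X₁.bc L) X₁')
    (hα : ∀ n x a, α₁.lin (1 ⊗ₜ[K] ev f n x a)
      = ev f' n (α.lin (1 ⊗ₜ[K] x)) fun t => extMap L (a t))
    (hf : LocFinite f δ) (hf' : LocFinite f' δ') (z : L ⊗[K] Bal X Y) :
    compar α₁ β ((boxTotal f δ).baseChange L z) = boxTotal f' δ' (compar α β z) := by
  have h1 : ∀ n (p : (S X n).carrier),
      α₁.lin (1 ⊗ₜ[K] (f n).lin p) = (f' n).lin ((SCompar α n).lin (1 ⊗ₜ[K] p)) := by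
    intro n p
    have e : α₁.lin ∘ₗ (f n).lin.baseChange L = (f' n).lin ∘ₗ (SCompar α n).lin := by
      refine LinearMap.ext_on (span_one_tmul (L := L) (span_pure (M := X) (X := Set.univ)
        (Y := Set.univ) Submodule.span_univ Submodule.span_univ n)) ?_
      rintro _ ⟨_, ⟨x, -, a, -, rfl⟩, rfl⟩
      exact (hα n x a).trans (congrArg (f' n).lin (SCompar_pure α n x a)).symm
    exact LinearMap.congr_fun e (1 ⊗ₜ[K] p)
  have h2 : ∀ n (z : Bal X Y), compar α₁ β (1 ⊗ₜ[K] boxTerm f δ n z)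
      = boxTerm f' δ' n (compar α β (1 ⊗ₜ[K] z)) := by
    intro n z
    rw [boxTerm_apply, boxTerm_apply, iterCoact_compar hβ]
    refine LinearMap.congr_fun (f := compar α₁ β ∘ₗ (rmap (f n) Y).baseChange L)
      (g := rmap (f' n) Y' ∘ₗ compar (SCompar α n) β) (Bal.bc_hom_ext fun p y => ?_)
      (1 ⊗ₜ[K] iterCoact δ X n z)
    refine (congrArg (fun w => compar α₁ β (1 ⊗ₜ[K] w)) (rmap_mk (f n) p y)).trans ?_
    refine (compar_mk α₁ β _ _).trans ?_
    rw [h1]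
    exact ((congrArg (rmap (f' n) Y') (compar_mk (SCompar α n) β p y)).trans (rmap_mk _ _ _)).symm
  refine LinearMap.congr_fun (f := compar α₁ β ∘ₗ (boxTotal f δ).baseChange L)
    (g := boxTotal f' δ' ∘ₗ compar α β) (bc_hom_ext fun z => ?_) z
  -- One truncation is chosen beyond which the terms vanish on both sides.
  obtain ⟨T, hT⟩ := Filter.eventually_atTop.1
    ((hf.eventually z).and (hf'.eventually (compar α β (1 ⊗ₜ[K] z))))
  refine (congrArg (fun w => compar α₁ β (1 ⊗ₜ[K] w))
    (hf.boxTotal_eq fun n hn => (hT n hn).1.1)).trans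
    (Eq.trans ?_ (hf'.boxTotal_eq fun n hn => (hT n hn).2.1).symm)
  rw [TensorProduct.tmul_sum, map_sum]
  exact Finset.sum_congr rfl fun n _ => h2 n z

/-- The hypotheses are kept abstract in α and β because in the application the two modules are
extended along different towers: M by a swap of intermediate rings, N by a cancellation. -/
theorem box_diffIso {M : AData D K} {N : DData D K} {M' : AData D L} {N' : DData D L}
    (α : RHom (M.toRMod.bc L) M'.toRMod) (β : LHom (N.toLMod.bc L) N'.toLMod)
    (a : L ⊗[K] M.carrier ≃ₗ[L] M'.carrier) (ha : ∀ x, a x = α.lin x)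
    (b : L ⊗[K] N.carrier ≃ₗ[L] N'.carrier) (hb : ∀ x, b x = β.lin x)
    (hagr : ∀ g x, x ∈ (M.gr g).baseChange L ↔ a x ∈ M'.gr g)
    (hbgr : ∀ g y, y ∈ (N.gr g).baseChange L ↔ b y ∈ N'.gr g)
    (hα : ∀ n x c, α.lin (1 ⊗ₜ[K] ev M.m n x c)
      = ev M'.m n (α.lin (1 ⊗ₜ[K] x)) fun t => extMap L (c t))
    (hβ : ∀ y, N'.δ.lin (β.lin (1 ⊗ₜ[K] y))
      = (AtensMap β).lin ((AtensToBC L N.toLMod).lin (1 ⊗ₜ[K] N.δ.lin y)))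
    (hl : LocFinite M.m N.δ) (hl' : LocFinite M'.m N'.δ) :
    DiffIso ((box M N).bc L) (box M' N') := by
  refine ⟨comparEquiv α β a ha b hb, fun z => ?_, fun g z => ⟨fun hz => ?_, fun hz => ?_⟩⟩
  · rw [box_d]
    refine Eq.trans ?_ (boxTotal_compar hβ α α hα hl hl' z)
    change compar α β ((box M N).d.baseChange L z) = _
    rw [box_d]
    rfl
  · change compar α β z ∈ grBal M'.gr N'.gr g
    refine Submodule.span_induction (p := fun z _ => compar α β z ∈ grBal M'.gr N'.gr g)
      ?_ ?_ ?_ ?_ (mem_baseChange_span (p := grBal M.gr N.gr g) hz)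
    · rintro _ ⟨w, hw, rfl⟩
      refine Submodule.span_induction
        (p := fun w _ => compar α β (1 ⊗ₜ[K] w) ∈ grBal M'.gr N'.gr g) ?_ ?_ ?_ ?_ hw
      · rintro _ ⟨p, q, x, y, hx, hy, hpq, rfl⟩
        rw [compar_mk, ← ha, ← hb]
        exact Submodule.subset_span ⟨p, q, _, _,
          (hagr p _).1 (Submodule.tmul_mem_baseChange_of_mem 1 hx),
          (hbgr q _).1 (Submodule.tmul_mem_baseChange_of_mem 1 hy), hpq, rfl⟩
      · rw [TensorProduct.tmul_zero, map_zero]; exact Submodule.zero_mem _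
      · intro s t _ _ hs ht
        rw [TensorProduct.tmul_add, map_add]; exact Submodule.add_mem _ hs ht
      · intro r s _ hs
        rw [TensorProduct.tmul_smul, ← algebraMap_smul L r, map_smul]
        exact Submodule.smul_mem _ _ hs
    · rw [map_zero]; exact Submodule.zero_mem _
    · intro s t _ _ hs ht; rw [map_add]; exact Submodule.add_mem _ hs ht
    · intro r s _ hs; rw [map_smul]; exact Submodule.smul_mem _ r hs
  · suffices h : ∀ w ∈ grBal M'.gr N'.gr g,
        (comparEquiv α β a ha b hb).symm w ∈ (grBal M.gr N.gr g).baseChange L by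
      have := h _ hz
      exact ((comparEquiv α β a ha b hb).symm_apply_apply z) ▸ this
    intro w hw
    refine Submodule.span_induction (p := fun w _ => (comparEquiv α β a ha b hb).symm w ∈
      (grBal M.gr N.gr g).baseChange L) ?_ ?_ ?_ ?_ hw
    · rintro _ ⟨p, q, x, y, hx, hy, hpq, rfl⟩
      -- Homogeneous x and y are pulled back through a and b, so that `hagr` and `hbgr` place the
      -- preimages in the extended graded pieces, which are generated by elements defined over the
      -- smaller ring.
      rw [← a.apply_symm_apply x, ← hagr] at hx
      rw [← b.apply_symm_apply y, ← hbgr] at hy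
      suffices h : Bal.ofBC L M.toRMod N.toLMod (Bal.mk (M := M.toRMod.bc L) (N := N.toLMod.bc L)
          (a.symm x) (b.symm y)) ∈ (grBal M.gr N.gr g).baseChange L by
        exact (congrArg (Bal.ofBC L M.toRMod N.toLMod)
          (Bal.map_mk (α.inverse a ha) (β.inverse b hb) x y)) ▸ h
      refine Submodule.span_induction (p := fun x' _ => Bal.ofBC L M.toRMod N.toLMod
        (Bal.mkLin (M.toRMod.bc L) (N.toLMod.bc L) x' (b.symm y)) ∈ _) ?_ ?_ ?_ ?_
        (mem_baseChange_span hx)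
      · rintro _ ⟨x', hx', rfl⟩
        refine Submodule.span_induction (p := fun y' _ => Bal.ofBC L M.toRMod N.toLMod
          (Bal.mkLin (M.toRMod.bc L) (N.toLMod.bc L) (1 ⊗ₜ[K] x') y') ∈ _) ?_ ?_ ?_ ?_
          (mem_baseChange_span hy)
        · rintro _ ⟨y', hy', rfl⟩
          refine (congrArg (· ∈ (grBal M.gr N.gr g).baseChange L)
            (Bal.ofBC_mk L M.toRMod N.toLMod 1 1 x' y')).mpr ?_
          exact Submodule.tmul_mem_baseChange_of_mem _
            (Submodule.subset_span ⟨p, q, x', y', hx', hy', hpq, rfl⟩)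
        · rw [map_zero, map_zero]; exact Submodule.zero_mem _
        · intro s t _ _ hs ht; rw [map_add, map_add]; exact Submodule.add_mem _ hs ht
        · intro r s _ hs; rw [map_smul, map_smul]; exact Submodule.smul_mem _ r hs
      · rw [map_zero, LinearMap.zero_apply, map_zero]; exact Submodule.zero_mem _
      · intro s t _ _ hs ht
        rw [map_add, LinearMap.add_apply, map_add]; exact Submodule.add_mem _ hs ht
      · intro r s _ hs
        rw [map_smul, LinearMap.smul_apply, map_smul]; exact Submodule.smul_mem _ r hs
    · rw [map_zero]; exact Submodule.zero_mem _
    · intro s t _ _ hs ht; rw [map_add]; exact Submodule.add_mem _ hs ht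
    · intro r s _ hs; rw [map_smul]; exact Submodule.smul_mem _ r hs

end BoxComparison

/-! ### Iterated extension of scalars for linear maps. -/

section LinearTowers

variable {K₀ : Type*} [CommRing K₀] {K : Type*} [CommRing K] [Algebra K₀ K]
variable {L : Type*} [CommRing L] [Algebra K L]

theorem bc_bc_hom_ext {Y X : Type*} [AddCommGroup Y] [Module K₀ Y] [AddCommGroup X] [Module L X]
    {f g : L ⊗[K] (K ⊗[K₀] Y) →ₗ[L] X}
    (h : ∀ y, f (1 ⊗ₜ[K] (1 ⊗ₜ[K₀] y)) = g (1 ⊗ₜ[K] (1 ⊗ₜ[K₀] y))) : f = g := by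
  refine LinearMap.ext_on (span_one_tmul (L := L) (span_one_tmul (L := K)
    (Submodule.span_univ (R := K₀) (M := Y)))) ?_
  rintro _ ⟨_, ⟨y, -, rfl⟩, rfl⟩
  exact h y

theorem baseChange_baseChange_le {Y X : Type*} [AddCommGroup Y] [Module K₀ Y] [AddCommGroup X]
    [Module L X] {p : Submodule K₀ Y} {q : Submodule L X} (f : L ⊗[K] (K ⊗[K₀] Y) →ₗ[L] X)
    (h : ∀ y ∈ p, f (1 ⊗ₜ[K] (1 ⊗ₜ[K₀] y)) ∈ q) {z : L ⊗[K] (K ⊗[K₀] Y)}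
    (hz : z ∈ (p.baseChange K).baseChange L) : f z ∈ q := by
  refine Submodule.span_induction (p := fun z _ => f z ∈ q) ?_ ?_ ?_ ?_ (mem_baseChange_span hz)
  · rintro _ ⟨w, hw, rfl⟩
    refine Submodule.span_induction (p := fun w _ => f (1 ⊗ₜ[K] w) ∈ q) ?_ ?_ ?_ ?_
      (mem_baseChange_span hw)
    · rintro _ ⟨y, hy, rfl⟩
      exact h y hy
    · rw [TensorProduct.tmul_zero, map_zero]; exact Submodule.zero_mem _
    · intro s t _ _ hs ht
      rw [TensorProduct.tmul_add, map_add]; exact Submodule.add_mem _ hs ht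
    · intro r s _ hs
      rw [TensorProduct.tmul_smul, ← algebraMap_smul L r, map_smul]
      exact Submodule.smul_mem _ _ hs
  · rw [map_zero]; exact Submodule.zero_mem _
  · intro s t _ _ hs ht; rw [map_add]; exact Submodule.add_mem _ hs ht
  · intro r s _ hs; rw [map_smul]; exact Submodule.smul_mem _ r hs

variable [Algebra K₀ L] [IsScalarTower K₀ K L]

theorem cancelBaseChange_one_tmul {Y : Type*} [AddCommGroup Y] [Module K₀ Y] (y : Y) :
    TensorProduct.AlgebraTensorModule.cancelBaseChange K₀ K L L Y (1 ⊗ₜ[K] (1 ⊗ₜ[K₀] y))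
      = 1 ⊗ₜ[K₀] y := by
  rw [TensorProduct.AlgebraTensorModule.cancelBaseChange_tmul, one_smul]

theorem cancelBaseChange_baseChange {Y Y' : Type*} [AddCommGroup Y] [Module K₀ Y]
    [AddCommGroup Y'] [Module K₀ Y'] (f : Y →ₗ[K₀] Y') (z : L ⊗[K] (K ⊗[K₀] Y)) :
    TensorProduct.AlgebraTensorModule.cancelBaseChange K₀ K L L Y'
        ((f.baseChange K).baseChange L z)
      = f.baseChange L (TensorProduct.AlgebraTensorModule.cancelBaseChange K₀ K L L Y z) := by
  refine LinearMap.congr_fun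
    (f := (TensorProduct.AlgebraTensorModule.cancelBaseChange K₀ K L L Y').toLinearMap ∘ₗ
      (f.baseChange K).baseChange L)
    (g := f.baseChange L ∘ₗ
      (TensorProduct.AlgebraTensorModule.cancelBaseChange K₀ K L L Y).toLinearMap)
    (bc_bc_hom_ext fun x => ?_) z
  simp

variable {K' : Type*} [CommRing K'] [Algebra K₀ K'] [Algebra K' L] [IsScalarTower K₀ K' L]

variable (K₀ K K' L) in
/-- The canonical isomorphism `L ⊗ (K ⊗ Y) ≅ L ⊗ (K' ⊗ Y)`. -/
def bcSwap (Y : Type*) [AddCommGroup Y] [Module K₀ Y] :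
    L ⊗[K] (K ⊗[K₀] Y) ≃ₗ[L] L ⊗[K'] (K' ⊗[K₀] Y) :=
  TensorProduct.AlgebraTensorModule.cancelBaseChange K₀ K L L Y ≪≫ₗ
    (TensorProduct.AlgebraTensorModule.cancelBaseChange K₀ K' L L Y).symm

theorem bcSwap_one_tmul {Y : Type*} [AddCommGroup Y] [Module K₀ Y] (y : Y) :
    bcSwap K₀ K L K' Y (1 ⊗ₜ[K] (1 ⊗ₜ[K₀] y)) = 1 ⊗ₜ[K'] (1 ⊗ₜ[K₀] y) := by
  rw [bcSwap, LinearEquiv.trans_apply, LinearEquiv.symm_apply_eq, cancelBaseChange_one_tmul,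
    cancelBaseChange_one_tmul]

theorem bcSwap_symm_one_tmul {Y : Type*} [AddCommGroup Y] [Module K₀ Y] (y : Y) :
    (bcSwap K₀ K L K' Y).symm (1 ⊗ₜ[K'] (1 ⊗ₜ[K₀] y)) = 1 ⊗ₜ[K] (1 ⊗ₜ[K₀] y) := by
  rw [LinearEquiv.symm_apply_eq, bcSwap_one_tmul]

theorem bcSwap_baseChange {Y Y' : Type*} [AddCommGroup Y] [Module K₀ Y]
    [AddCommGroup Y'] [Module K₀ Y'] (f : Y →ₗ[K₀] Y') (z : L ⊗[K] (K ⊗[K₀] Y)) :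
    bcSwap K₀ K L K' Y' ((f.baseChange K).baseChange L z)
      = (f.baseChange K').baseChange L (bcSwap K₀ K L K' Y z) := by
  rw [bcSwap, LinearEquiv.trans_apply, LinearEquiv.symm_apply_eq, cancelBaseChange_baseChange,
    cancelBaseChange_baseChange, bcSwap, LinearEquiv.trans_apply, LinearEquiv.apply_symm_apply]

end LinearTowers

/-! ### Iterated extension of scalars for modules, type D structures and box products. -/

section Towers

variable {G : Type v} [AddCommGroupWithOne G] [DecidableEq G] {D : DGAlg.{u} G}
variable {K₀ : Type u} [CommRing K₀] [Algebra (ZMod 2) K₀]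
variable {K : Type u} [CommRing K] [Algebra (ZMod 2) K] [Algebra K₀ K] [IsScalarTower (ZMod 2) K₀ K]
variable {L : Type u} [CommRing L] [Algebra (ZMod 2) L] [Algebra K L] [IsScalarTower (ZMod 2) K L]
variable [Algebra K₀ L] [IsScalarTower (ZMod 2) K₀ L] [IsScalarTower K₀ K L]

theorem extMap_extMap (b : Ext D K₀) : extMap L (extMap K b) = extMap L b := by
  induction b using TensorProduct.induction_on with
  | zero => simp only [map_zero]
  | add b c hb hc => simp only [map_add, hb, hc]
  | tmul r a => rw [extMap_tmul, extMap_tmul, extMap_tmul, ← IsScalarTower.algebraMap_apply]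

variable {K' : Type u} [CommRing K'] [Algebra (ZMod 2) K'] [Algebra K₀ K']
  [IsScalarTower (ZMod 2) K₀ K'] [Algebra K' L] [IsScalarTower (ZMod 2) K' L]
  [IsScalarTower K₀ K' L]

variable (K L K') in
/-- The canonical isomorphism between iterated extensions of scalars of a right module. -/
def bcSwapHom (M : RMod D.I K₀) : RHom ((M.bc K).bc L) ((M.bc K').bc L) :=
  ⟨(bcSwap K₀ K L K' M.carrier).toLinearMap, fun e z => bcSwap_baseChange (M.act e) z⟩

omit [Algebra (ZMod 2) K₀] [Algebra (ZMod 2) K] [IsScalarTower (ZMod 2) K₀ K]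
  [Algebra (ZMod 2) L] [IsScalarTower (ZMod 2) K L] [IsScalarTower (ZMod 2) K₀ L]
  [Algebra (ZMod 2) K'] [IsScalarTower (ZMod 2) K₀ K'] [IsScalarTower (ZMod 2) K' L] in
theorem bcSwapHom_one_tmul (M : RMod D.I K₀) (x : M.carrier) :
    (bcSwapHom K L K' M).lin (1 ⊗ₜ[K] (1 ⊗ₜ[K₀] x)) = 1 ⊗ₜ[K'] (1 ⊗ₜ[K₀] x) :=
  bcSwap_one_tmul x

/-- Both double extensions carry operations that come from K₀. On generators defined over K₀ each
side is the original operation tensored twice with 1. -/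
theorem bcSwapHom_ev (M : AData D K₀) (n : ℕ) (x : (M.bc K).carrier) (c : ℕ → Ext D K) :
    (bcSwapHom K L K' M.toRMod).lin (1 ⊗ₜ[K] ev (M.bc K).m n x c)
      = ev ((M.bc K').bc L).m n ((bcSwapHom K L K' M.toRMod).lin (1 ⊗ₜ[K] x))
        fun t => extMap L (c t) := by
  have e : (bcSwapHom K L K' M.toRMod).lin ∘ₗ ((M.bc K).m n).lin.baseChange L
      = (((M.bc K').bc L).m n).lin ∘ₗ (SCompar (bcSwapHom K L K' M.toRMod) n).lin := by
    refine LinearMap.ext_on (span_one_tmul (L := L) (span_pure (M := M.toRMod.bc K)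
      (span_one_tmul (L := K) (Submodule.span_univ (R := K₀) (M := M.carrier)))
      (span_range_extMap (D := D) (K := K₀) K) n)) ?_
    rintro _ ⟨_, ⟨_, ⟨x, -, rfl⟩, b, hb, rfl⟩, rfl⟩
    choose! a ha using hb
    rw [pure_congr (M := M.toRMod.bc K) (1 ⊗ₜ x) fun t ht => (ha t ht).symm]
    refine (congrArg (fun w => (bcSwapHom K L K' M.toRMod).lin (1 ⊗ₜ[K] w))
      (ev_bc K M.m n x a)).trans ((bcSwapHom_one_tmul M.toRMod _).trans (Eq.symm ?_))
    refine (congrArg (((M.bc K').bc L).m n).lin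
      (SCompar_pure (bcSwapHom K L K' M.toRMod) n (1 ⊗ₜ[K₀] x) _)).trans ?_
    rw [bcSwapHom_one_tmul]
    -- The entries reach A_L through A_K. They are rewritten to pass directly from A_{K₀}, and then
    -- through A_{K'}, where the operations of the target are computed.
    simp only [extMap_extMap]
    simp only [← extMap_extMap (K := K') (L := L) (D := D) (K₀ := K₀)]
    refine (ev_bc L (M.bc K').m n _ _).trans ?_
    exact congrArg (fun w => (1 : L) ⊗ₜ[K'] w) (ev_bc K' M.m n x a)
  refine (LinearMap.congr_fun e (1 ⊗ₜ[K] pure x c n)).trans ?_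
  exact congrArg (((M.bc K').bc L).m n).lin (SCompar_pure (bcSwapHom K L K' M.toRMod) n x c)

variable (K L) in
/-- The canonical isomorphism between an iterated extension of scalars of a left module and the
direct one. -/
def bcCancelHom (N : LMod D.I K₀) : LHom ((N.bc K).bc L) (N.bc L) :=
  ⟨(TensorProduct.AlgebraTensorModule.cancelBaseChange K₀ K L L N.carrier).toLinearMap,
    fun e z => cancelBaseChange_baseChange (N.act e) z⟩

theorem AtensToBC_AtensToBC (N : LMod D.I K₀) (t : Bal (algR D K₀) N) :
    (AtensToBC L N).lin (1 ⊗ₜ[K₀] t) = (AtensMap (bcCancelHom K L N)).lin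
      ((AtensToBC L (N.bc K)).lin (1 ⊗ₜ[K] (AtensToBC K N).lin (1 ⊗ₜ[K₀] t))) := by
  -- The right-hand side naturally starts from L ⊗ (K ⊗ ⋯). The inverse cancellation is inserted so
  -- that both maps start from the single extension and can be compared on generators.
  refine LinearMap.congr_fun (f := (AtensToBC L N).lin)
    (g := (AtensMap (bcCancelHom K L N)).lin ∘ₗ (AtensToBC L (N.bc K)).lin ∘ₗ
      (AtensToBC K N).lin.baseChange L ∘ₗ
      (TensorProduct.AlgebraTensorModule.cancelBaseChange K₀ K L L
        (Bal (algR D K₀) N)).symm.toLinearMap)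
    (Bal.bc_hom_ext fun b y => ?_) (1 ⊗ₜ[K₀] t)
  refine (AtensToBC_mk L N b y).trans (Eq.symm ?_)
  refine (congrArg (fun w => (AtensMap (bcCancelHom K L N)).lin
    ((AtensToBC L (N.bc K)).lin (1 ⊗ₜ[K] w))) (AtensToBC_mk K N b y)).trans ?_
  refine (congrArg (AtensMap (bcCancelHom K L N)).lin
    (AtensToBC_mk L (N.bc K) (extMap K b) (1 ⊗ₜ[K₀] y))).trans ?_
  refine (Bal.map_mk (RHom.id (algR D L)) (bcCancelHom K L N) _ _).trans ?_
  exact congrArg₂ (fun c w => Bal.mk (M := algR D L) (N := N.bc L) c w) (extMap_extMap b)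
    (cancelBaseChange_one_tmul y)

theorem bcCancelHom_δ (N : DData D K₀) (y : (N.bc K).carrier) :
    (N.bc L).δ.lin ((bcCancelHom K L N.toLMod).lin (1 ⊗ₜ[K] y))
      = (AtensMap (bcCancelHom K L N.toLMod)).lin
        ((AtensToBC L (N.bc K).toLMod).lin (1 ⊗ₜ[K] (N.bc K).δ.lin y)) := by
  refine LinearMap.congr_fun (f := (N.bc L).δ.lin ∘ₗ (bcCancelHom K L N.toLMod).lin)
    (g := (AtensMap (bcCancelHom K L N.toLMod)).lin ∘ₗ (AtensToBC L (N.bc K).toLMod).lin ∘ₗ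
      (N.bc K).δ.lin.baseChange L) (bc_bc_hom_ext fun y => ?_) (1 ⊗ₜ[K] y)
  refine (congrArg (N.bc L).δ.lin (cancelBaseChange_one_tmul y)).trans ?_
  exact AtensToBC_AtensToBC N.toLMod (N.δ.lin y)

/-- M is routed through K' because the given homotopy equivalence lives over K' = F_{W''}, while the
box product was formed over K = F_{W⊕W̃}. For N the extension from K₁ to L is direct. -/
theorem box_bc_diffIso {K₁ : Type u} [CommRing K₁] [Algebra (ZMod 2) K₁] [Algebra K₁ K]
    [IsScalarTower (ZMod 2) K₁ K] [Algebra K₁ L] [IsScalarTower (ZMod 2) K₁ L]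
    [IsScalarTower K₁ K L] (M : AData D K₀) (N : DData D K₁)
    (hl : LocFinite (M.bc K).m (N.bc K).δ) (hl' : LocFinite ((M.bc K').bc L).m (N.bc L).δ) :
    DiffIso ((box (M.bc K) (N.bc K)).bc L) (box ((M.bc K').bc L) (N.bc L)) := by
  refine box_diffIso (bcSwapHom K L K' M.toRMod) (bcCancelHom K L N.toLMod)
    (bcSwap K₀ K L K' M.carrier) (fun _ => rfl)
    (TensorProduct.AlgebraTensorModule.cancelBaseChange K₁ K L L N.carrier) (fun _ => rfl)
    (fun g x => ⟨fun hx => ?_, fun hx => ?_⟩) (fun g y => ⟨fun hy => ?_, fun hy => ?_⟩)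
    (bcSwapHom_ev M) (bcCancelHom_δ N) hl hl'
  · refine baseChange_baseChange_le (p := M.gr g) (bcSwap K₀ K L K' M.carrier).toLinearMap
      (fun y hy => ?_) hx
    refine (congrArg (· ∈ ((M.gr g).baseChange K').baseChange L) (bcSwap_one_tmul y)).mpr ?_
    exact Submodule.tmul_mem_baseChange_of_mem _ (Submodule.tmul_mem_baseChange_of_mem _ hy)
  · have h := baseChange_baseChange_le (p := M.gr g) (q := ((M.gr g).baseChange K).baseChange L)
      (bcSwap K₀ K L K' M.carrier).symm.toLinearMap (fun y hy => by
        refine (congrArg (· ∈ ((M.gr g).baseChange K).baseChange L)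
          (bcSwap_symm_one_tmul y)).mpr ?_
        exact Submodule.tmul_mem_baseChange_of_mem _
          (Submodule.tmul_mem_baseChange_of_mem _ hy)) hx
    exact ((bcSwap K₀ K L K' M.carrier).symm_apply_apply x) ▸ h
  · refine baseChange_baseChange_le (p := N.gr g)
      (TensorProduct.AlgebraTensorModule.cancelBaseChange K₁ K L L N.carrier).toLinearMap
      (fun y hy => ?_) hy
    refine (congrArg (· ∈ (N.gr g).baseChange L) (cancelBaseChange_one_tmul y)).mpr ?_
    exact Submodule.tmul_mem_baseChange_of_mem _ hy
  · suffices h : ∀ w ∈ (N.gr g).baseChange L,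
        (TensorProduct.AlgebraTensorModule.cancelBaseChange K₁ K L L N.carrier).symm w
          ∈ ((N.gr g).baseChange K).baseChange L from
      ((TensorProduct.AlgebraTensorModule.cancelBaseChange K₁ K L L N.carrier).symm_apply_apply y) ▸
        h _ hy
    intro w hw
    refine Submodule.span_induction (p := fun w _ =>
      (TensorProduct.AlgebraTensorModule.cancelBaseChange K₁ K L L N.carrier).symm w
        ∈ ((N.gr g).baseChange K).baseChange L) ?_ ?_ ?_ ?_ (mem_baseChange_span hw)
    · rintro _ ⟨y, hy, rfl⟩
      rw [← cancelBaseChange_one_tmul (K := K), LinearEquiv.symm_apply_apply]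
      exact Submodule.tmul_mem_baseChange_of_mem _ (Submodule.tmul_mem_baseChange_of_mem _ hy)
    · rw [map_zero]; exact Submodule.zero_mem _
    · intro s t _ _ hs ht; rw [map_add]; exact Submodule.add_mem _ hs ht
    · intro r s _ hs; rw [map_smul]; exact Submodule.smul_mem _ r hs

end Towers

/-! ### Functoriality of W ↦ F_W. -/

section RatFunMaps

variable {W V U : Type u} [AddCommGroup W] [Module (ZMod 2) W] [AddCommGroup V]
  [Module (ZMod 2) V] [AddCommGroup U] [Module (ZMod 2) U]

theorem symMap_symMap (φ : W →ₗ[ZMod 2] V) (ψ : V →ₗ[ZMod 2] U) (x) :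
    symMap ψ (symMap φ x) = symMap (ψ ∘ₗ φ) x := by
  have h : (symMap ψ).comp (symMap φ) = symMap (ψ ∘ₗ φ) := by
    apply SymmetricAlgebra.algHom_ext
    ext x
    simp [symMap]
  exact DFunLike.congr_fun h x

theorem RatFun.map_algebraMap (φ : W →ₗ[ZMod 2] V) (hφ : Function.Injective φ) (x) :
    RatFun.map φ hφ (algebraMap (SymmetricAlgebra (ZMod 2) W) (RatFun W) x)
      = algebraMap (SymmetricAlgebra (ZMod 2) V) (RatFun V) (symMap φ x) :=
  IsLocalization.map_eq (M := nonZeroDivisors (SymmetricAlgebra (ZMod 2) W))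
    (T := nonZeroDivisors (SymmetricAlgebra (ZMod 2) V))
    (nonZeroDivisors_le_comap_nonZeroDivisors_of_injective _ (symMap_injective φ hφ)) x

/-- A ring map out of a field of fractions is determined on the symmetric algebra, where
functoriality can be checked on W. It supplies the scalar towers needed to compare iterated
extensions. -/
theorem RatFun.map_map {φ : W →ₗ[ZMod 2] V} {hφ : Function.Injective φ} {ψ : V →ₗ[ZMod 2] U}
    {hψ : Function.Injective ψ} {χ : W →ₗ[ZMod 2] U} {hχ : Function.Injective χ}
    (h : ψ ∘ₗ φ = χ) : (RatFun.map ψ hψ).comp (RatFun.map φ hφ) = RatFun.map χ hχ := by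
  refine IsLocalization.ringHom_ext (nonZeroDivisors (SymmetricAlgebra (ZMod 2) W))
    (RingHom.ext fun x => ?_)
  simp only [RingHom.comp_apply, RatFun.map_algebraMap, symMap_symMap, h]

end RatFunMaps

/-! ### Specialisation to the fields F_W. -/

section RatFunExt

variable {G : Type v} [AddCommGroupWithOne G] [DecidableEq G] {D : DGAlg.{u} G}
variable {W V : Type u} [AddCommGroup W] [Module (ZMod 2) W] [AddCommGroup V] [Module (ZMod 2) V]
variable (φ : W →ₗ[ZMod 2] V) (hφ : Function.Injective φ)

theorem AData.Laws.ext {M : AData D (RatFun W)} (hM : M.Laws) : (M.ext φ hφ).Laws :=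
  letI := (RatFun.map φ hφ).toAlgebra
  haveI : IsScalarTower (ZMod 2) (RatFun W) (RatFun V) := isScalarTower_zmod
  hM.bc (RatFun V)

theorem AData.Bounded.ext {M : AData D (RatFun W)} (hM : M.Bounded) : (M.ext φ hφ).Bounded :=
  letI := (RatFun.map φ hφ).toAlgebra
  haveI : IsScalarTower (ZMod 2) (RatFun W) (RatFun V) := isScalarTower_zmod
  OpsBounded.bc (RatFun V) hM

theorem DData.Laws.ext {N : DData D (RatFun W)} (hN : N.Laws) : (N.ext φ hφ).Laws :=
  letI := (RatFun.map φ hφ).toAlgebra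
  haveI : IsScalarTower (ZMod 2) (RatFun W) (RatFun V) := isScalarTower_zmod
  hN.bc (RatFun V)

theorem DData.Bounded.ext {N : DData D (RatFun W)} (hN : N.Bounded) : (N.ext φ hφ).Bounded :=
  letI := (RatFun.map φ hφ).toAlgebra
  haveI : IsScalarTower (ZMod 2) (RatFun W) (RatFun V) := isScalarTower_zmod
  hN.bc (RatFun V)

/-- Extension of scalars of a homotopy equivalence along the field extension `F_W → F_V`. -/
def AEquiv.ext {M M' : AData D (RatFun W)} (e : AEquiv M M') : AEquiv (M.ext φ hφ) (M'.ext φ hφ) :=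
  letI := (RatFun.map φ hφ).toAlgebra
  haveI : IsScalarTower (ZMod 2) (RatFun W) (RatFun V) := isScalarTower_zmod
  e.bc (RatFun V)

theorem AEquiv.Bounded.ext {M M' : AData D (RatFun W)} {e : AEquiv M M'} (he : e.Bounded) :
    (e.ext φ hφ).Bounded :=
  letI := (RatFun.map φ hφ).toAlgebra
  haveI : IsScalarTower (ZMod 2) (RatFun W) (RatFun V) := isScalarTower_zmod
  ⟨he.1.bc (RatFun V), he.2.1.bc (RatFun V), he.2.2.1.bc (RatFun V), he.2.2.2.bc (RatFun V)⟩

variable {U : Type u} [AddCommGroup U] [Module (ZMod 2) U]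

theorem prodMap_id_injective {φ : W →ₗ[ZMod 2] V} (hφ : Function.Injective φ) :
    Function.Injective (φ.prodMap (LinearMap.id : U →ₗ[ZMod 2] U)) :=
  hφ.prodMap Function.injective_id

theorem boxStar_ext_diffIso (M : AData D (RatFun W)) (N : DData D (RatFun U))
    (hl : LocFinite (M.ext (LinearMap.inl (ZMod 2) W U) LinearMap.inl_injective).m
      (N.ext (LinearMap.inr (ZMod 2) W U) LinearMap.inr_injective).δ)
    (hl' : LocFinite
      ((M.ext φ hφ).ext (LinearMap.inl (ZMod 2) V U) LinearMap.inl_injective).m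
      (N.ext (LinearMap.inr (ZMod 2) V U) LinearMap.inr_injective).δ) :
    DiffIso ((boxStar M N).ext (φ.prodMap (LinearMap.id : U →ₗ[ZMod 2] U))
        (prodMap_id_injective hφ))
      (box ((M.ext φ hφ).ext (LinearMap.inl (ZMod 2) V U) LinearMap.inl_injective)
        (N.ext (LinearMap.inr (ZMod 2) V U) LinearMap.inr_injective)) := by
  let : Algebra (RatFun W) (RatFun (W × U)) :=
    (RatFun.map (LinearMap.inl (ZMod 2) W U) LinearMap.inl_injective).toAlgebra
  let : Algebra (RatFun U) (RatFun (W × U)) :=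
    (RatFun.map (LinearMap.inr (ZMod 2) W U) LinearMap.inr_injective).toAlgebra
  let : Algebra (RatFun (W × U)) (RatFun (V × U)) :=
    (RatFun.map (φ.prodMap (LinearMap.id : U →ₗ[ZMod 2] U)) (prodMap_id_injective hφ)).toAlgebra
  let : Algebra (RatFun W) (RatFun V) := (RatFun.map φ hφ).toAlgebra
  let : Algebra (RatFun V) (RatFun (V × U)) :=
    (RatFun.map (LinearMap.inl (ZMod 2) V U) LinearMap.inl_injective).toAlgebra
  let : Algebra (RatFun W) (RatFun (V × U)) :=
    (RatFun.map (LinearMap.inl (ZMod 2) V U ∘ₗ φ) (LinearMap.inl_injective.comp hφ)).toAlgebra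
  let : Algebra (RatFun U) (RatFun (V × U)) :=
    (RatFun.map (LinearMap.inr (ZMod 2) V U) LinearMap.inr_injective).toAlgebra
  have : IsScalarTower (ZMod 2) (RatFun W) (RatFun (W × U)) := isScalarTower_zmod
  have : IsScalarTower (ZMod 2) (RatFun U) (RatFun (W × U)) := isScalarTower_zmod
  have : IsScalarTower (ZMod 2) (RatFun (W × U)) (RatFun (V × U)) := isScalarTower_zmod
  have : IsScalarTower (ZMod 2) (RatFun W) (RatFun V) := isScalarTower_zmod
  have : IsScalarTower (ZMod 2) (RatFun V) (RatFun (V × U)) := isScalarTower_zmod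
  have : IsScalarTower (ZMod 2) (RatFun W) (RatFun (V × U)) := isScalarTower_zmod
  have : IsScalarTower (ZMod 2) (RatFun U) (RatFun (V × U)) := isScalarTower_zmod
  -- The next three towers express (φ ⊕ id) ∘ inl = inl ∘ φ, the definition of the map F_W → F_{V⊕U}
  -- as a composite through F_V, and (φ ⊕ id) ∘ inr = inr.
  have : IsScalarTower (RatFun W) (RatFun (W × U)) (RatFun (V × U)) :=
    IsScalarTower.of_algebraMap_eq' (RatFun.map_map (by ext x <;> simp)).symm
  have : IsScalarTower (RatFun W) (RatFun V) (RatFun (V × U)) :=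
    IsScalarTower.of_algebraMap_eq' (RatFun.map_map rfl).symm
  have : IsScalarTower (RatFun U) (RatFun (W × U)) (RatFun (V × U)) :=
    IsScalarTower.of_algebraMap_eq' (RatFun.map_map (by ext x <;> simp)).symm
  exact box_bc_diffIso (K₀ := RatFun W) (K := RatFun (W × U)) (L := RatFun (V × U))
    (K' := RatFun V) (K₁ := RatFun U) M N hl hl'

end RatFunExt

end StableBox

end

theorem mainTheorem1 {G : Type v} [AddCommGroupWithOne G] [DecidableEq G]
    (D : StableBox.DGAlg.{u} G)
    {W W' W'' Wt : Type u}
    [AddCommGroup W] [Module (ZMod 2) W] [AddCommGroup W'] [Module (ZMod 2) W']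
    [AddCommGroup W''] [Module (ZMod 2) W''] [AddCommGroup Wt] [Module (ZMod 2) Wt]
    (N : StableBox.DData D (StableBox.RatFun Wt)) (hN : N.IsTypeD)
    (M : StableBox.AData D (StableBox.RatFun W)) (hM : M.IsAInf)
    (M' : StableBox.AData D (StableBox.RatFun W')) (hM' : M'.IsAInf)
    (φ : W →ₗ[ZMod 2] W'') (hφ : Function.Injective φ)
    (φ' : W' →ₗ[ZMod 2] W'') (hφ' : Function.Injective φ')
    (e : StableBox.AEquiv (M.ext φ hφ) (M'.ext φ' hφ'))
    (hb : N.Bounded ∨ (M.Bounded ∧ M'.Bounded ∧ e.Bounded)) :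
    (StableBox.boxStar M N).IsComplex ∧ (StableBox.boxStar M' N).IsComplex ∧
      StableBox.StablyChainHomotopicVia (StableBox.boxStar M N) (StableBox.boxStar M' N)
        (φ.prodMap (LinearMap.id : Wt →ₗ[ZMod 2] Wt))
        (φ'.prodMap (LinearMap.id : Wt →ₗ[ZMod 2] Wt)) := by
  -- Finiteness over W ⊕ W̃ and W' ⊕ W̃ makes the two box products of the statement well behaved.
  have hl : StableBox.LocFinite
      (M.ext (LinearMap.inl (ZMod 2) W Wt) LinearMap.inl_injective).m
      (N.ext (LinearMap.inr (ZMod 2) W Wt) LinearMap.inr_injective).δ :=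
    hb.elim (fun h => (h.ext _ _).locFinite _) fun h => (h.1.ext _ _).locFinite _
  have hl' : StableBox.LocFinite
      (M'.ext (LinearMap.inl (ZMod 2) W' Wt) LinearMap.inl_injective).m
      (N.ext (LinearMap.inr (ZMod 2) W' Wt) LinearMap.inr_injective).δ :=
    hb.elim (fun h => (h.ext _ _).locFinite _) fun h => (h.2.1.ext _ _).locFinite _
  -- Over W'' ⊕ W̃, where the homotopy equivalence is applied, the modules have been extended twice;
  -- boundedness survives both extensions.
  have hL : StableBox.LocFinite
      ((M.ext φ hφ).ext (LinearMap.inl (ZMod 2) W'' Wt) LinearMap.inl_injective).m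
      (N.ext (LinearMap.inr (ZMod 2) W'' Wt) LinearMap.inr_injective).δ :=
    hb.elim (fun h => (h.ext _ _).locFinite _) fun h => ((h.1.ext _ _).ext _ _).locFinite _
  have hL' : StableBox.LocFinite
      ((M'.ext φ' hφ').ext (LinearMap.inl (ZMod 2) W'' Wt) LinearMap.inl_injective).m
      (N.ext (LinearMap.inr (ZMod 2) W'' Wt) LinearMap.inr_injective).δ :=
    hb.elim (fun h => (h.ext _ _).locFinite _) fun h => ((h.2.1.ext _ _).ext _ _).locFinite _
  refine ⟨StableBox.box_isComplex (hM.laws.ext _ _) (hN.laws.ext _ _) hl,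
    StableBox.box_isComplex (hM'.laws.ext _ _) (hN.laws.ext _ _) hl',
    StableBox.prodMap_id_injective hφ, StableBox.prodMap_id_injective hφ', ?_⟩
  -- Both extended complexes are replaced by box products over F_{W''⊕W̃} with the same extension of
  -- N; the extension of e then relates them.
  refine StableBox.ChainHomotopic.congr ?_ (StableBox.boxStar_ext_diffIso φ hφ M N hl hL)
    (StableBox.boxStar_ext_diffIso φ' hφ' M' N hl' hL')
  refine StableBox.box_chainHomotopic (hN.laws.ext _ _)
    (e.ext (LinearMap.inl (ZMod 2) W'' Wt) LinearMap.inl_injective) hL hL' ?_ ?_ ?_ ?_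
  · exact hb.elim (fun h => (h.ext _ _).locFinite _) fun h => (h.2.2.ext _ _).1.locFinite _
  · exact hb.elim (fun h => (h.ext _ _).locFinite _) fun h => (h.2.2.ext _ _).2.1.locFinite _
  · exact hb.elim (fun h => (h.ext _ _).locFinite _) fun h => (h.2.2.ext _ _).2.2.1.locFinite _
  · exact hb.elim (fun h => (h.ext _ _).locFinite _) fun h => (h.2.2.ext _ _).2.2.2.locFinite _
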